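/- Let $k$ be a field of characteristic $0$. A DGLA over $k$ is a $\mathbb Z$-graded cochain complex $(L^\bullet,d)$ of $k$-vector spaces with a graded Lie bracket for which $d$ is a derivation. A cdga over $k$ is a $\mathbb Z$-graded chain complex with a unital, associative, graded-commutative multiplication for which the differential is a derivation. Let $dg\mathrm{Art}_k$ be the category of those cdgas $A$ which admit an augmentation $A\to k$ (a morphism of cdgas) whose kernel $\mathfrak m(A)$ is nilpotent and finite-dimensional, with all morphisms of unital cdgas (the augmentation is then unique), and let $\mathrm{pro}(dg\mathrm{Art}_k)$ be its category of pro-objects $A=\{A_\alpha\}_\alpha$. For a DGLA $L$ and $A\in dg\mathrm{Art}_k$, let $\mathrm{Tot}(L\otimes\mathfrak m(A))$ be the nilpotent DGLA with degree $n$ part $\bigoplus_{p-i=n}L^p\otimes\mathfrak m(A)_i$, differential $d(u\otimes a)=du\otimes a+(-1)^{\deg u}u\otimes da$ and bracket $[u\otimes a,v\otimes b]=(-1)^{\deg v\deg a}[u,v]\otimes ab$. Put $$\mathrm{mc}(L,A)=\{\omega\in \mathrm{Tot}(L\otimes\mathfrak m(A))^1:\ d\omega+\tfrac12[\omega,\omega]=0\},$$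 and let $\mathrm{Gg}(L,A)=\exp\big(\mathrm{Tot}(L\otimes \mathfrak m(A))^0\big)$ be the gauge group, acting on $\mathrm{mc}(L,A)$ by $g\star\omega=g\omega g^{-1}-(dg)g^{-1}$, i.e. $$e^x\star\omega=\omega+\sum_{n\ge 0}\frac{(\mathrm{ad}\,x)^n\big([x,\omega]-dx\big)}{(n+1)!}.$$ For a pro-object $A=\{A_\alpha\}_\alpha$, put $\mathrm{mc}(L,A)=\varprojlim_\alpha\mathrm{mc}(L,A_\alpha)$, $\mathrm{Gg}(L,A)=\varprojlim_\alpha\mathrm{Gg}(L,A_\alpha)$, and let $\mathrm{ddef}(L,A)=\mathrm{mc}(L,A)/\mathrm{Gg}(L,A)$ be the quotient of the first limit by the componentwise action of the second. Let $\beta:\mathrm{DGLA}_k\to \mathrm{pro}(dg\mathrm{Art}_k)^{\mathrm{op}}$ be the functor for which $\beta(L)$ pro-represents $\mathrm{mc}(L,-)$, and let $\beta^*$ be its left adjoint, so that for all $L$ and all $A\in\mathrm{pro}(dg\mathrm{Art}_k)$ $$\mathrm{Hom}_{\mathrm{DGLA}_k}(\beta^*A,L)\cong\mathrm{mc}(L,A)\cong\mathrm{Hom}_{\mathrm{pro}(dg\mathrm{Art}_k)}(\beta(L),A).\qquad(*)$$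 Let $\mathrm{Ho}(\mathrm{DGLA}_k)$ be the localization of $\mathrm{DGLA}_k$ at the quasi-isomorphisms, and $\mathrm{Ho}(\mathrm{pro}(dg\mathrm{Art}_k))$ the localization of $\mathrm{pro}(dg\mathrm{Art}_k)$ at the morphisms which $\beta^*$ sends to quasi-isomorphisms. **Proposition.** For all DGLAs $L$ over $k$ and all $A\in\mathrm{pro}(dg\mathrm{Art}_k)$ there are isomorphisms $$\mathrm{Hom}_{\mathrm{Ho}(\mathrm{DGLA}_k)}(\beta^*A,L)\;\cong\;\mathrm{ddef}(L,A)\;\cong\;\mathrm{Hom}_{\mathrm{Ho}(\mathrm{pro}(dg\mathrm{Art}_k))}(\beta(L),A),$$ natural in $L\in\mathrm{DGLA}_k$ and in $A\in\mathrm{pro}(dg\mathrm{Art}_k)$, and induced by $(*)$: the first sends the class of a morphism $\beta^*A\to L$ to the class in $\mathrm{ddef}(L,A)$ of the corresponding element of $\mathrm{mc}(L,A)$, and the second sends the class of an element of $\mathrm{mc}(L,A)$ to the class of the corresponding morphism $\beta(L)\to A$. -/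

import Mathlib

set_option linter.unusedVariables false

open CategoryTheory CategoryTheory.Limits Opposite TensorProduct DirectSum

universe u

namespace Koszul

noncomputable section

/-- The sign `(-1)^n` as an element of `k`. -/
def sgn (k : Type u) [Field k] (n : ℤ) : k := ((n.negOnePow : ℤ) : k)

section sign

variable (k : Type u) [Field k]

theorem sgn_add (a b : ℤ) : sgn k (a + b) = sgn k a * sgn k b := by
  simp [sgn, Int.negOnePow_add]

theorem sgn_one : sgn k 1 = -1 := by simp [sgn]

theorem sgn_zero : sgn k 0 = 1 := by simp [sgn]

theorem sgn_congr {a b : ℤ} (c : ℤ) (h : a - b = 2 * c) : sgn k a = sgn k b := by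
  have : a.negOnePow = b.negOnePow := by
    rw [Int.negOnePow_eq_iff, h]
    exact ⟨c, by ring⟩
  simp [sgn, this]

end sign

/-! ### Differential graded Lie algebras -/

/-- A differential graded Lie algebra over `k`: a cochain complex of `k`-vector spaces with a
graded Lie bracket for which the differential is a derivation.  The operations carry an equation
between degrees, so that no transport along such equations is ever needed. -/
structure DGLA (k : Type u) [Field k] where
  X : ℤ → Type u
  [grp : ∀ n, AddCommGroup (X n)]
  [mod : ∀ n, Module k (X n)]
  d : ∀ {i j : ℤ}, i + 1 = j → X i →ₗ[k] X j
  br : ∀ {i j n : ℤ}, i + j = n → X i →ₗ[k] X j →ₗ[k] X n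
  d_d : ∀ {i j l : ℤ} (h : i + 1 = j) (h' : j + 1 = l) (x : X i), d h' (d h x) = 0
  br_symm : ∀ {i j n : ℤ} (h : i + j = n) (h' : j + i = n) (x : X i) (y : X j),
    br h x y = -(sgn k (i * j) • br h' y x)
  jacobi : ∀ {p q r a b c n : ℤ} (ha : q + r = a) (h₁ : p + a = n) (hb : p + q = b)
    (h₂ : b + r = n) (hc : p + r = c) (h₃ : q + c = n) (x : X p) (y : X q) (z : X r),
    br h₁ x (br ha y z) = br h₂ (br hb x y) z + sgn k (p * q) • br h₃ y (br hc x z)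
  d_br : ∀ {i j n i' j' n' : ℤ} (h : i + j = n) (hn : n + 1 = n') (hi : i + 1 = i')
    (hj : j + 1 = j') (h₁ : i' + j = n') (h₂ : i + j' = n') (x : X i) (y : X j),
    d hn (br h x y) = br h₁ (d hi x) y + sgn k i • br h₂ x (d hj y)

attribute [instance] DGLA.grp DGLA.mod

namespace DGLA

variable {k : Type u} [Field k]

/-- Morphisms of DGLAs: chain maps that preserve the bracket. -/
@[ext]
structure Hom (L M : DGLA k) where
  f : ∀ n, L.X n →ₗ[k] M.X n
  map_d : ∀ {i j : ℤ} (h : i + 1 = j) (x : L.X i), f j (L.d h x) = M.d h (f i x)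
  map_br : ∀ {i j n : ℤ} (h : i + j = n) (x : L.X i) (y : L.X j),
    f n (L.br h x y) = M.br h (f i x) (f j y)

instance : Category.{u} (DGLA k) where
  Hom := Hom
  id L := ⟨fun _ => LinearMap.id, fun _ _ => rfl, fun _ _ _ => rfl⟩
  comp F G := ⟨fun n => G.f n ∘ₗ F.f n, fun h x => by simp [F.map_d, G.map_d],
    fun h x y => by simp [F.map_br, G.map_br]⟩

@[ext]
theorem hom_ext {L M : DGLA k} {F G : L ⟶ M} (h : ∀ n x, F.f n x = G.f n x) : F = G :=
  Hom.ext (funext fun n => LinearMap.ext (h n))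

@[simp] theorem id_f (L : DGLA k) (n : ℤ) (x : L.X n) : Hom.f (𝟙 L) n x = x := rfl

@[simp] theorem comp_f {L M N : DGLA k} (F : L ⟶ M) (G : M ⟶ N) (n : ℤ) (x : L.X n) :
    Hom.f (F ≫ G) n x = G.f n (F.f n x) := rfl

variable (k) in
/-- The underlying cochain complex of a DGLA. -/
def toComplex : DGLA k ⥤ CochainComplex (ModuleCat.{u} k) ℤ where
  obj L :=
    { X := fun n => ModuleCat.of k (L.X n)
      d := fun i j => if h : i + 1 = j then ModuleCat.ofHom (L.d h) else 0
      shape := fun i j h => dif_neg h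
      d_comp_d' := fun i j l hij hjl => by
        have hij : i + 1 = j := hij
        have hjl : j + 1 = l := hjl
        ext x
        simp [hij, hjl, L.d_d] }
  map {L M} F :=
    { f := fun n => ModuleCat.ofHom (F.f n)
      comm' := fun i j hij => by
        have hij : i + 1 = j := hij
        ext x
        simp [hij, F.map_d] }

variable (k) in
/-- The quasi-isomorphisms of DGLAs. -/
def quasiIso : MorphismProperty (DGLA k) :=
  (HomologicalComplex.quasiIso (ModuleCat.{u} k) (ComplexShape.up ℤ)).inverseImage (toComplex k)

/-- The Maurer-Cartan equation `dω + ½[ω,ω] = 0` for an element `ω` of degree one. -/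
def IsMC (L : DGLA k) (ω : L.X 1) : Prop :=
  L.d (show (1 : ℤ) + 1 = 2 by norm_num) ω
    + (2 : k)⁻¹ • L.br (show (1 : ℤ) + 1 = 2 by norm_num) ω ω = 0

/-- The Maurer-Cartan set of a DGLA. -/
def MC (L : DGLA k) : Type u := {ω : L.X 1 // L.IsMC ω}

theorem Hom.isMC {L M : DGLA k} (F : Hom L M) {ω : L.X 1} (h : L.IsMC ω) : M.IsMC (F.f 1 ω) := by
  have := congrArg (F.f 2) h
  simpa [IsMC, F.map_d, F.map_br] using this

/-- The adjoint action of `L⁰` on `L¹`. -/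
def ad (L : DGLA k) (x : L.X 0) : L.X 1 →ₗ[k] L.X 1 := L.br (zero_add 1) x

/-- The gauge action of `exp x`, for `x` of degree zero, on an element `ω` of degree one.  It is
`e^x ⋆ ω = e^x ω e^{-x} - (d e^x) e^{-x} = ω + ∑ₙ (ad x)ⁿ ([x,ω] - dx) / (n+1)!`,
where only finitely many terms are nonzero as soon as `ad x` is nilpotent. -/
def gauge (L : DGLA k) (x : L.X 0) (ω : L.X 1) : L.X 1 :=
  ω + ∑ᶠ n : ℕ, ((Nat.factorial (n + 1) : k)⁻¹ •
    (L.ad x ^ n) (L.br (zero_add 1) x ω - L.d (zero_add 1) x))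

end DGLA

/-! ### Commutative differential graded algebras -/

/-- Graded-commutative differential graded `k`-algebras in chain complexes, not necessarily
unital. -/
structure NCdga (k : Type u) [Field k] where
  X : ℤ → Type u
  [grp : ∀ n, AddCommGroup (X n)]
  [mod : ∀ n, Module k (X n)]
  d : ∀ {i j : ℤ}, j + 1 = i → X i →ₗ[k] X j
  mul : ∀ {i j n : ℤ}, i + j = n → X i →ₗ[k] X j →ₗ[k] X n
  d_d : ∀ {i j l : ℤ} (h : j + 1 = i) (h' : l + 1 = j) (x : X i), d h' (d h x) = 0
  mul_comm : ∀ {i j n : ℤ} (h : i + j = n) (h' : j + i = n) (x : X i) (y : X j),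
    mul h x y = sgn k (i * j) • mul h' y x
  mul_assoc : ∀ {p q r a b n : ℤ} (hb : p + q = b) (h₂ : b + r = n) (ha : q + r = a)
    (h₁ : p + a = n) (x : X p) (y : X q) (z : X r),
    mul h₂ (mul hb x y) z = mul h₁ x (mul ha y z)
  d_mul : ∀ {i j n i' j' n' : ℤ} (h : i + j = n) (hn : n' + 1 = n) (hi : i' + 1 = i)
    (hj : j' + 1 = j) (h₁ : i' + j = n') (h₂ : i + j' = n') (x : X i) (y : X j),
    d hn (mul h x y) = mul h₁ (d hi x) y + sgn k i • mul h₂ x (d hj y)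

attribute [instance] NCdga.grp NCdga.mod

/-- Commutative differential graded algebras over `k` (chain complexes with a unital associative
graded-commutative multiplication for which the differential is a derivation). -/
structure Cdga (k : Type u) [Field k] extends NCdga k where
  one : X 0
  one_mul : ∀ {i : ℤ} (x : X i), mul (zero_add i) one x = x

namespace NCdga

variable {k : Type u} [Field k]

/-- Morphisms of (not necessarily unital) cdgas. -/
@[ext]
structure Hom (A B : NCdga k) where
  f : ∀ n, A.X n →ₗ[k] B.X n
  map_d : ∀ {i j : ℤ} (h : j + 1 = i) (x : A.X i), f j (A.d h x) = B.d h (f i x)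
  map_mul : ∀ {i j n : ℤ} (h : i + j = n) (x : A.X i) (y : A.X j),
    f n (A.mul h x y) = B.mul h (f i x) (f j y)

instance : Category.{u} (NCdga k) where
  Hom := Hom
  id A := ⟨fun _ => LinearMap.id, fun _ _ => rfl, fun _ _ _ => rfl⟩
  comp F G := ⟨fun n => G.f n ∘ₗ F.f n, fun h x => by simp [F.map_d, G.map_d],
    fun h x y => by simp [F.map_mul, G.map_mul]⟩

theorem hom_ext {A B : NCdga k} {F G : A ⟶ B} (h : ∀ n x, F.f n x = G.f n x) : F = G :=
  Hom.ext (funext fun n => LinearMap.ext (h n))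

end NCdga

/-- An augmentation, that is, a morphism of cdgas from `A` to `k` (where `k` is concentrated in
degree zero). -/
structure Augmentation {k : Type u} [Field k] (A : Cdga k) where
  ε : ∀ n, A.X n →ₗ[k] k
  ε_of_ne : ∀ {n : ℤ}, n ≠ 0 → ∀ x : A.X n, ε n x = 0
  ε_one : ε 0 A.one = 1
  ε_mul : ∀ {i j n : ℤ} (h : i + j = n) (x : A.X i) (y : A.X j),
    ε n (A.mul h x y) = ε i x * ε j y
  ε_d : ∀ {i j : ℤ} (h : j + 1 = i) (x : A.X i), ε j (A.d h x) = 0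

namespace Augmentation

variable {k : Type u} [Field k] {A : Cdga k} (e : Augmentation A)

/-- The kernel of an augmentation, in degree `n`. -/
def ker (n : ℤ) : Submodule k (A.X n) := LinearMap.ker (e.ε n)

/-- `IsProd e r x` says that `x` is a product of `r ≥ 1` homogeneous elements of the kernel of the
augmentation. -/
inductive IsProd : ℕ → ∀ {n : ℤ}, A.X n → Prop
  | one {n : ℤ} (x : A.X n) (hx : x ∈ e.ker n) : IsProd 1 x
  | mul {r : ℕ} {i j n : ℤ} (h : i + j = n) (x : A.X i) (y : A.X j) (hx : x ∈ e.ker i)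
      (hy : IsProd r y) : IsProd (r + 1) (A.mul h x y)

end Augmentation

/-- Local Artinian `k`-cdgas: those which admit an augmentation whose kernel `𝔪` is nilpotent (any
product of `r` elements vanishes, for some `r > 0`) and finite-dimensional.  The augmentation is
unique; see `DgArt.map_ker`. -/
structure DgArt (k : Type u) [Field k] extends Cdga k where
  aug : Augmentation toCdga
  nilp : ∃ r : ℕ, 0 < r ∧ ∀ (n : ℤ) (x : X n), aug.IsProd r x → x = 0
  fin : ∀ n : ℤ, Module.Finite k (aug.ker n)
  bdd : {n : ℤ | aug.ker n ≠ ⊥}.Finite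

namespace DgArt

variable {k : Type u} [Field k]

/-- Morphisms of local Artinian cdgas are all the morphisms of unital cdgas. -/
@[ext]
structure Hom (A B : DgArt k) extends NCdga.Hom A.toNCdga B.toNCdga where
  map_one : f 0 A.one = B.one

instance : Category.{u} (DgArt k) where
  Hom := Hom
  id A := ⟨⟨fun _ => LinearMap.id, fun _ _ => rfl, fun _ _ _ => rfl⟩, rfl⟩
  comp F G := ⟨⟨fun n => G.f n ∘ₗ F.f n, fun h x => by simp [F.map_d, G.map_d],
    fun h x y => by simp [F.map_mul, G.map_mul]⟩, by simp [F.map_one, G.map_one]⟩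

theorem hom_ext {A B : DgArt k} {F G : A ⟶ B} (h : ∀ n x, F.f n x = G.f n x) : F = G :=
  Hom.ext (funext fun n => LinearMap.ext (h n))

@[simp] theorem id_f (L : DgArt k) (n : ℤ) (x : L.X n) : NCdga.Hom.f (Hom.toHom (𝟙 L)) n x = x :=
  rfl

@[simp] theorem comp_f {L M N : DgArt k} (F : L ⟶ M) (G : M ⟶ N) (n : ℤ) (x : L.X n) :
    NCdga.Hom.f (Hom.toHom (F ≫ G)) n x = G.f n (F.f n x) := rfl

/-- Morphisms preserve the augmentation ideals, whatever the augmentation of the target. -/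
theorem map_ker {A B : DgArt k} (F : A ⟶ B) (e : Augmentation B.toCdga) {n : ℤ} {x : A.X n}
    (hx : x ∈ A.aug.ker n) : F.f n x ∈ e.ker n := by
  rw [Augmentation.ker, LinearMap.mem_ker]
  by_cases hn : n = 0
  · subst hn
    have key : ∀ r : ℕ, ∃ y : A.X 0, A.aug.IsProd (r + 1) y ∧
        e.ε 0 (F.f 0 y) = (e.ε 0 (F.f 0 x)) ^ (r + 1) := by
      intro r
      induction r with
      | zero => exact ⟨x, .one x hx, by simp⟩
      | succ r ih =>
        obtain ⟨y, hy, hy'⟩ := ih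
        exact ⟨A.mul (zero_add 0) x y, .mul _ x y hx hy, by
          rw [F.map_mul, e.ε_mul, hy', pow_succ' _ (r + 1)]⟩
    obtain ⟨r, hr, h0⟩ := A.nilp
    obtain ⟨s, rfl⟩ : ∃ s, r = s + 1 := ⟨r - 1, by omega⟩
    obtain ⟨y, hy, hy'⟩ := key s
    rw [h0 0 y hy, map_zero, map_zero] at hy'
    exact pow_eq_zero_iff (Nat.succ_ne_zero s) |>.1 hy'.symm
  · exact e.ε_of_ne hn _

/-- The maximal ideal `𝔪(A)`, as a non-unital cdga. -/
def maxIdeal (A : DgArt k) : NCdga k where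
  X n := A.aug.ker n
  d {i j} h := (A.d h).restrict fun x _ => A.aug.ε_d h x
  mul {i j n} h := LinearMap.mk₂ k
    (fun x y => ⟨A.mul h x.1 y.1, by
      have hx : A.aug.ε i x.1 = 0 := x.2
      rw [Augmentation.ker, LinearMap.mem_ker, A.aug.ε_mul, hx, zero_mul]⟩)
    (fun x x' y => Subtype.ext (by simp)) (fun c x y => Subtype.ext (by simp))
    (fun x y y' => Subtype.ext (by simp)) (fun c x y => Subtype.ext (by simp))
  d_d h h' x := Subtype.ext (A.d_d h h' x.1)
  mul_comm h h' x y := Subtype.ext (A.mul_comm h h' x.1 y.1)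
  mul_assoc hb h₂ ha h₁ x y z := Subtype.ext (A.mul_assoc hb h₂ ha h₁ x.1 y.1 z.1)
  d_mul h hn hi hj h₁ h₂ x y := Subtype.ext (A.d_mul h hn hi hj h₁ h₂ x.1 y.1)

/-- The map on maximal ideals induced by a morphism. -/
def mapIdeal {A B : DgArt k} (F : A ⟶ B) : A.maxIdeal ⟶ B.maxIdeal where
  f n := (F.f n).restrict fun _ hx => map_ker F B.aug hx
  map_d h x := Subtype.ext (F.map_d h x.1)
  map_mul h x y := Subtype.ext (F.map_mul h x.1 y.1)

variable (k) in
/-- The maximal ideal, as a functor. -/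
def maxIdealFunctor : DgArt k ⥤ NCdga k where
  obj A := A.maxIdeal
  map F := mapIdeal F

end DgArt

/-! ### The DGLA `Tot (L ⊗ M)` -/

namespace Tot

variable {k : Type u} [Field k]

/-- The degree `n` part of `Tot (L ⊗ M)`: the direct sum of the `L^p ⊗ M_i` with `p - i = n`. -/
abbrev X (L : DGLA k) (M : NCdga k) (n : ℤ) : Type u :=
  ⨁ s : {s : ℤ × ℤ // s.1 - s.2 = n}, L.X s.1.1 ⊗[k] M.X s.1.2

section basic

variable {L : DGLA k} {M : NCdga k}

/-- The inclusion of the summand `L^p ⊗ M_i`. -/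
def incl (L : DGLA k) (M : NCdga k) {p i n : ℤ} (h : p - i = n) :
    L.X p ⊗[k] M.X i →ₗ[k] X L M n :=
  DirectSum.lof k {s : ℤ × ℤ // s.1 - s.2 = n} (fun s => L.X s.1.1 ⊗[k] M.X s.1.2) ⟨(p, i), h⟩

/-- The element `u ⊗ a`. -/
def tm {p i n : ℤ} (h : p - i = n) (u : L.X p) (a : M.X i) : X L M n := incl L M h (u ⊗ₜ a)

@[elab_as_elim]
theorem ind {n : ℤ} {P : X L M n → Prop} (x : X L M n) (h0 : P 0)
    (htm : ∀ {p i : ℤ} (h : p - i = n) (u : L.X p) (a : M.X i), P (tm h u a))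
    (hadd : ∀ x y, P x → P y → P (x + y)) : P x := by
  induction x using DirectSum.induction_on with
  | zero => exact h0
  | add x y hx hy => exact hadd x y hx hy
  | of s t =>
    obtain ⟨⟨p, i⟩, h⟩ := s
    induction t using TensorProduct.induction_on with
    | zero => simpa using h0
    | add x y hx hy => rw [map_add]; exact hadd _ _ hx hy
    | tmul u a => exact htm h u a

/-- The linear map out of a total degree determined by linear maps on the summands. -/
def desc {V : Type*} [AddCommMonoid V] [Module k V] {n : ℤ}
    (φ : ∀ (p i : ℤ), p - i = n → (L.X p ⊗[k] M.X i →ₗ[k] V)) : X L M n →ₗ[k] V :=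
  DirectSum.toModule k _ V fun s => φ s.1.1 s.1.2 s.2

@[simp] theorem desc_tm {V : Type*} [AddCommMonoid V] [Module k V] {n : ℤ}
    (φ : ∀ (p i : ℤ), p - i = n → (L.X p ⊗[k] M.X i →ₗ[k] V)) {p i : ℤ} (h : p - i = n)
    (u : L.X p) (a : M.X i) : desc φ (tm h u a) = φ p i h (u ⊗ₜ a) :=
  DirectSum.toModule_lof k (⟨(p, i), h⟩ : {s : ℤ × ℤ // s.1 - s.2 = n}) _

theorem tm_add_left {p i n : ℤ} (h : p - i = n) (u v : L.X p) (a : M.X i) :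
    tm h (u + v) a = tm h u a + tm h v a := by simp [tm, TensorProduct.add_tmul]

theorem tm_add_right {p i n : ℤ} (h : p - i = n) (u : L.X p) (a b : M.X i) :
    tm h u (a + b) = tm h u a + tm h u b := by simp [tm, TensorProduct.tmul_add]

theorem tm_smul_left {p i n : ℤ} (h : p - i = n) (c : k) (u : L.X p) (a : M.X i) :
    tm h (c • u) a = c • tm h u a := by simp [tm, ← TensorProduct.smul_tmul']

theorem tm_smul_right {p i n : ℤ} (h : p - i = n) (c : k) (u : L.X p) (a : M.X i) :
    tm h u (c • a) = c • tm h u a := by simp [tm]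

theorem tm_neg_left {p i n : ℤ} (h : p - i = n) (u : L.X p) (a : M.X i) :
    tm h (-u) a = -tm h u a := by simp [tm, TensorProduct.neg_tmul]

@[simp] theorem tm_zero_left {p i n : ℤ} (h : p - i = n) (a : M.X i) :
    tm h (0 : L.X p) a = 0 := by simp [tm]

@[simp] theorem tm_zero_right {p i n : ℤ} (h : p - i = n) (u : L.X p) :
    tm h u (0 : M.X i) = 0 := by simp [tm]

/-- The differential of `Tot (L ⊗ M)`: `d (u ⊗ a) = du ⊗ a + (-1)^{deg u} u ⊗ da`. -/
def d {n m : ℤ} (h : n + 1 = m) : X L M n →ₗ[k] X L M m :=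
  desc fun p i hs =>
    incl L M (show p + 1 - i = m by omega) ∘ₗ LinearMap.rTensor (M.X i) (L.d rfl)
      + sgn k p • incl L M (show p - (i - 1) = m by omega) ∘ₗ
        LinearMap.lTensor (L.X p) (M.d (sub_add_cancel i 1))

theorem d_tm {n m p i p' i' : ℤ} (h : n + 1 = m) (hs : p - i = n) (hp : p + 1 = p')
    (hi : i' + 1 = i) (u : L.X p) (a : M.X i) :
    d h (tm hs u a) = tm (show p' - i = m by omega) (L.d hp u) a
      + sgn k p • tm (show p - i' = m by omega) u (M.d hi a) := by
  subst hp
  obtain rfl : i' = i - 1 := by omega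
  rw [d, desc_tm]
  simp [tm]

/-- The bracket of `Tot (L ⊗ M)`: `[u ⊗ a, v ⊗ b] = (-1)^{deg v deg a} [u,v] ⊗ ab`. -/
def br {m n r : ℤ} (h : m + n = r) : X L M m →ₗ[k] X L M n →ₗ[k] X L M r :=
  desc fun p i hs => LinearMap.flip <| desc fun q j ht => LinearMap.flip <|
    sgn k (q * i) • (TensorProduct.map₂ (L.br (rfl : p + q = _)) (M.mul (rfl : i + j = _))).compr₂
      (incl L M (show p + q - (i + j) = r by omega))

theorem br_tm {m n r p i q j s t : ℤ} (h : m + n = r) (h₁ : p - i = m) (h₂ : q - j = n)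
    (hs : p + q = s) (ht : i + j = t) (u : L.X p) (a : M.X i) (v : L.X q) (b : M.X j) :
    br h (tm h₁ u a) (tm h₂ v b)
      = sgn k (q * i) • tm (show s - t = r by omega) (L.br hs u v) (M.mul ht a b) := by
  subst hs ht
  rw [br, desc_tm, LinearMap.flip_apply, desc_tm]
  simp [tm]

theorem d_d {i j l : ℤ} (h : i + 1 = j) (h' : j + 1 = l) (x : X L M i) : d h' (d h x) = 0 := by
  induction x using ind with
  | h0 => simp
  | hadd x y hx hy => simp [hx, hy]
  | @htm p q hs u a =>
    rw [d_tm h hs (p' := p + 1) (i' := q - 1) (by omega) (by omega), map_add, map_smul,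
      d_tm h' _ (p' := p + 1 + 1) (i' := q - 1) (by omega) (by omega),
      d_tm h' _ (p' := p + 1) (i' := q - 1 - 1) (by omega) (by omega), L.d_d, M.d_d, sgn_add,
      sgn_one]
    simp only [tm_zero_left, tm_zero_right, smul_zero, add_zero, zero_add]
    rw [mul_neg_one]
    module

theorem br_symm {i j n : ℤ} (h : i + j = n) (h' : j + i = n) (x : X L M i) (y : X L M j) :
    br h x y = -(sgn k (i * j) • br h' y x) := by
  induction x using ind with
  | h0 => simp
  | hadd x x' hx hx' => simp only [map_add, LinearMap.add_apply, hx, hx', smul_add, neg_add]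
  | @htm p a hs u α =>
    induction y using ind with
    | h0 => simp
    | hadd x x' hx hx' => simp only [map_add, LinearMap.add_apply, hx, hx', smul_add, neg_add]
    | @htm q b ht v β =>
      rw [br_tm h hs ht rfl rfl, br_tm h' ht hs (add_comm q p) (add_comm b a),
        L.br_symm rfl (add_comm q p), M.mul_comm rfl (add_comm b a)]
      rw [tm_neg_left, tm_smul_left, tm_smul_right, smul_neg, smul_smul, smul_smul, smul_smul,
        ← sgn_add, ← sgn_add, ← sgn_add]
      congr 2
      subst hs ht
      exact sgn_congr k (q * a + p * b - a * b + a * b - p * b ) (by ring)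

theorem jacobi {p q r a b c n : ℤ} (ha : q + r = a) (h₁ : p + a = n) (hb : p + q = b)
    (h₂ : b + r = n) (hc : p + r = c) (h₃ : q + c = n) (x : X L M p) (y : X L M q)
    (z : X L M r) :
    br h₁ x (br ha y z) = br h₂ (br hb x y) z + sgn k (p * q) • br h₃ y (br hc x z) := by
  induction x using ind with
  | h0 => simp
  | hadd x x' hx hx' =>
    simp only [map_add, LinearMap.add_apply, hx, hx', smul_add]
    abel
  | @htm px ix hx u α =>
    induction y using ind with
    | h0 => simp
    | hadd x x' hx hx' =>
      simp only [map_add, LinearMap.add_apply, hx, hx', smul_add]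
      abel
    | @htm py iy hy v β =>
      induction z using ind with
      | h0 => simp
      | hadd x x' hx hx' =>
        simp only [map_add, hx, hx', smul_add]
        abel
      | @htm pz iz hz w γ =>
        rw [br_tm ha hy hz (s := py + pz) (t := iy + iz) rfl rfl,
          br_tm hb hx hy (s := px + py) (t := ix + iy) rfl rfl,
          br_tm hc hx hz (s := px + pz) (t := ix + iz) rfl rfl]
        simp only [map_smul, LinearMap.smul_apply]
        rw [br_tm h₁ hx _ (s := px + (py + pz)) (t := ix + (iy + iz)) rfl rfl,
          br_tm h₂ _ hz (s := px + (py + pz)) (t := ix + (iy + iz)) (add_assoc _ _ _)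
            (add_assoc _ _ _),
          br_tm h₃ hy _ (s := px + (py + pz)) (t := ix + (iy + iz)) (by omega) (by omega),
          L.jacobi rfl rfl rfl (add_assoc _ _ _) rfl (by omega) u v w,
          M.mul_assoc (p := ix) (q := iy) (r := iz) rfl (add_assoc _ _ _) rfl rfl,
          ← M.mul_assoc (p := iy) (q := ix) (r := iz) (b := ix + iy) (by omega) (by omega)
            rfl (by omega),
          M.mul_comm (i := iy) (j := ix) (n := ix + iy) (by omega) rfl β α]
        simp only [map_smul, LinearMap.smul_apply]
        rw [M.mul_assoc (p := ix) (q := iy) (r := iz) rfl (add_assoc _ _ _) rfl rfl]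
        simp only [tm_add_left, tm_smul_left, tm_smul_right, smul_add, smul_smul, ← sgn_add]
        congr 2
        · exact sgn_congr k 0 (by ring)
        · subst hx hy hz
          exact sgn_congr k (py * ix - ix * iy) (by ring)

theorem d_br {i j n i' j' n' : ℤ} (h : i + j = n) (hn : n + 1 = n') (hi : i + 1 = i')
    (hj : j + 1 = j') (h₁ : i' + j = n') (h₂ : i + j' = n') (x : X L M i) (y : X L M j) :
    d hn (br h x y) = br h₁ (d hi x) y + sgn k i • br h₂ x (d hj y) := by
  induction x using ind with
  | h0 => simp
  | hadd x x' hx hx' =>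
    simp only [map_add, LinearMap.add_apply, hx, hx', smul_add]
    abel
  | @htm p a hs u α =>
    induction y using ind with
    | h0 => simp
    | hadd x x' hx hx' =>
      simp only [map_add, hx, hx', smul_add]
      abel
    | @htm q b ht v β =>
      rw [br_tm h hs ht (s := p + q) (t := a + b) rfl rfl, map_smul,
        d_tm hn _ (p' := p + q + 1) (i' := a + b - 1) rfl (by omega),
        d_tm hi hs (p' := p + 1) (i' := a - 1) rfl (by omega),
        d_tm hj ht (p' := q + 1) (i' := b - 1) rfl (by omega)]
      simp only [map_add, map_smul, LinearMap.add_apply, LinearMap.smul_apply]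
      rw [br_tm h₁ _ ht (s := p + q + 1) (t := a + b) (by omega) rfl,
        br_tm h₁ _ ht (s := p + q) (t := a + b - 1) rfl (by omega),
        br_tm h₂ hs _ (s := p + q + 1) (t := a + b) (by omega) rfl,
        br_tm h₂ hs _ (s := p + q) (t := a + b - 1) rfl (by omega),
        L.d_br rfl rfl (i' := p + 1) (j' := q + 1) rfl rfl (by omega) (by omega),
        M.d_mul rfl (by omega) (i' := a - 1) (j' := b - 1) (by omega) (by omega) (by omega)
          (by omega)]
      simp only [tm_add_left, tm_add_right, tm_smul_left, tm_smul_right, smul_add, smul_smul,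
        ← sgn_add]
      rw [sgn_congr k (a := q * a + p) (b := i + (q + 1) * a) 0 (by rw [← hs]; ring),
        sgn_congr k (a := q * a + (p + q)) (b := p + q * (a - 1)) q (by ring),
        sgn_congr k (a := q * a + (p + q + a)) (b := i + (q + q * a)) a (by rw [← hs]; ring)]
      abel

end basic

/-- The DGLA `Tot (L ⊗ M)`. -/
@[simps]
def dgla (L : DGLA k) (M : NCdga k) : DGLA k where
  X n := X L M n
  d h := d h
  br h := br h
  d_d := d_d
  br_symm := br_symm
  jacobi := jacobi
  d_br := d_br

section functoriality

variable {L L' L'' : DGLA k} {M M' M'' : NCdga k}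

/-- The linear map of totalisations induced by degreewise linear maps. -/
def mapLin (f : ∀ p, L.X p →ₗ[k] L'.X p) (g : ∀ i, M.X i →ₗ[k] M'.X i) (n : ℤ) :
    X L M n →ₗ[k] X L' M' n :=
  desc fun p i h => incl L' M' h ∘ₗ TensorProduct.map (f p) (g i)

@[simp] theorem mapLin_tm (f : ∀ p, L.X p →ₗ[k] L'.X p) (g : ∀ i, M.X i →ₗ[k] M'.X i) {n p i : ℤ}
    (h : p - i = n) (u : L.X p) (a : M.X i) :
    mapLin f g n (tm h u a) = tm h (f p u) (g i a) := by
  rw [mapLin, desc_tm]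
  simp [tm]

theorem mapLin_comp (f : ∀ p, L.X p →ₗ[k] L'.X p) (g : ∀ i, M.X i →ₗ[k] M'.X i)
    (f' : ∀ p, L'.X p →ₗ[k] L''.X p) (g' : ∀ i, M'.X i →ₗ[k] M''.X i) {n : ℤ} (x : X L M n) :
    mapLin f' g' n (mapLin f g n x) = mapLin (fun p => f' p ∘ₗ f p) (fun i => g' i ∘ₗ g i) n x := by
  induction x using ind with
  | h0 => simp
  | hadd x y hx hy => simp only [map_add, hx, hy]
  | htm h u a => simp

theorem mapLin_id {n : ℤ} (x : X L M n) :
    mapLin (fun p => LinearMap.id (M := L.X p)) (fun i => LinearMap.id (M := M.X i)) n x = x := by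
  induction x using ind with
  | h0 => simp
  | hadd x y hx hy => simp only [map_add, hx, hy]
  | htm h u a => simp

/-- The functoriality of `Tot (L ⊗ M)` in both arguments. -/
def map (F : L ⟶ L') (G : M ⟶ M') : dgla L M ⟶ dgla L' M' where
  f n := mapLin F.f G.f n
  map_d {i j} h x := by
    change X L M i at x
    change mapLin F.f G.f j (d h x) = d h (mapLin F.f G.f i x)
    induction x using ind with
    | h0 => simp
    | hadd x y hx hy => simp only [map_add, hx, hy]
    | @htm p a hs u α =>
      rw [d_tm h hs (p' := p + 1) (i' := a - 1) rfl (by omega), mapLin_tm,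
        d_tm h hs (p' := p + 1) (i' := a - 1) rfl (by omega)]
      simp [F.map_d, G.map_d]
  map_br {i j n} h x y := by
    change X L M i at x
    change X L M j at y
    change mapLin F.f G.f n (br h x y) = br h (mapLin F.f G.f i x) (mapLin F.f G.f j y)
    induction x using ind with
    | h0 => simp
    | hadd x y hx hy => simp only [map_add, LinearMap.add_apply, hx, hy]
    | @htm p a hs u α =>
      induction y using ind with
      | h0 => simp
      | hadd x y hx hy => simp only [map_add, hx, hy]
      | @htm q b ht v β =>
        rw [br_tm h hs ht rfl rfl, mapLin_tm, mapLin_tm, br_tm h hs ht rfl rfl]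
        simp [F.map_br, G.map_mul]

theorem map_f (F : L ⟶ L') (G : M ⟶ M') (n : ℤ) (x : X L M n) :
    DGLA.Hom.f (map F G) n x = mapLin F.f G.f n x := rfl

theorem map_id : map (𝟙 L) (𝟙 M) = 𝟙 (dgla L M) := DGLA.hom_ext fun _ x => mapLin_id x

theorem map_comp (F : L ⟶ L') (G : M ⟶ M') (F' : L' ⟶ L'') (G' : M' ⟶ M'') :
    map F G ≫ map F' G' = map (F ≫ F') (G ≫ G') := DGLA.hom_ext fun _ x => mapLin_comp _ _ _ _ x

end functoriality

variable (k) in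
/-- `Tot (L ⊗ M)` as a bifunctor. -/
def functor : DGLA k ⥤ NCdga k ⥤ DGLA k where
  obj L :=
    { obj := fun M => dgla L M
      map := fun G => map (𝟙 L) G
      map_id := fun _ => map_id
      map_comp := fun G H => by rw [map_comp, Category.id_comp] }
  map F :=
    { app := fun M => map F (𝟙 M)
      naturality := fun M M' G => by
        change map _ _ ≫ map _ _ = map _ _ ≫ map _ _
        rw [map_comp, map_comp, Category.id_comp, Category.comp_id, Category.id_comp,
          Category.comp_id] }
  map_id L := NatTrans.ext (funext fun _ => map_id)
  map_comp F G := NatTrans.ext (funext fun M => by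
    change map _ _ = map _ _ ≫ map _ _
    rw [map_comp, Category.id_comp])

end Tot

/-! ### Maurer-Cartan sets and gauge action over local Artinian cdgas -/

section functors

variable {k : Type u} [Field k]

namespace DGLA

theorem Hom.map_gauge {L M : DGLA k} (F : Hom L M) (x : L.X 0) (ω : L.X 1)
    (hx : IsNilpotent (L.ad x)) : F.f 1 (L.gauge x ω) = M.gauge (F.f 0 x) (F.f 1 ω) := by
  have had : ∀ (n : ℕ) (y : L.X 1), F.f 1 ((L.ad x ^ n) y) = (M.ad (F.f 0 x) ^ n) (F.f 1 y) := by
    intro n y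
    induction n with
    | zero => simp
    | succ n ih =>
      rw [pow_succ', pow_succ', Module.End.mul_apply, Module.End.mul_apply, ← ih, ad, F.map_br]
      rfl
  obtain ⟨r, hr⟩ := hx
  have hfin : (Function.support fun n : ℕ => ((Nat.factorial (n + 1) : k)⁻¹ •
      (L.ad x ^ n) (L.br (zero_add 1) x ω - L.d (zero_add 1) x))).Finite := by
    refine (Set.finite_lt_nat r).subset fun n hn => ?_
    by_contra hlt
    have hle : r ≤ n := not_lt.mp hlt
    exact hn (by simp [pow_eq_zero_of_le hle hr])
  rw [gauge, gauge, map_add]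
  congr 1
  have := (F.f 1).toAddMonoidHom.map_finsum hfin
  refine this.trans (finsum_congr fun n => ?_)
  simp [had, F.map_br, F.map_d]

end DGLA

theorem ad_isNilpotent (L : DGLA k) (A : DgArt k) (x : Tot.X L A.maxIdeal 0) :
    IsNilpotent (DGLA.ad (Tot.dgla L A.maxIdeal) x) := by
  let T : Module.End k (Tot.X L A.maxIdeal 1) := Tot.br (zero_add 1) x
  let S : ℕ → Submodule k (Tot.X L A.maxIdeal 1) := fun r =>
    Submodule.span k {y | ∃ (p i : ℤ) (h : p - i = 1) (u : L.X p) (a : A.maxIdeal.X i),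
      A.aug.IsProd r a.1 ∧ y = Tot.tm h u a}
  have hS1 : ∀ y, y ∈ S 1 := fun y => by
    induction y using Tot.ind with
    | h0 => exact zero_mem _
    | hadd x y hx hy => exact add_mem hx hy
    | htm h u a => exact Submodule.subset_span ⟨_, _, h, u, a, .one _ a.2, rfl⟩
  have hstep : ∀ r y, y ∈ S r → T y ∈ S (r + 1) := by
    intro r y hy
    induction hy using Submodule.span_induction with
    | zero => rw [map_zero]; exact zero_mem _
    | add y z _ _ hy hz => rw [map_add]; exact add_mem hy hz
    | smul c y _ hy => rw [map_smul]; exact Submodule.smul_mem _ _ hy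
    | mem y hy =>
      obtain ⟨p, i, h, u, a, ha, rfl⟩ := hy
      change Tot.br (zero_add 1) x (Tot.tm h u a) ∈ S (r + 1)
      induction x using Tot.ind with
      | h0 => rw [map_zero]; exact zero_mem _
      | hadd x y hx hy => rw [map_add]; exact add_mem hx hy
      | htm hs v b =>
        rw [Tot.br_tm _ hs h rfl rfl]
        exact Submodule.smul_mem _ _
          (Submodule.subset_span ⟨_, _, _, _, _, .mul _ b.1 a.1 b.2 ha, rfl⟩)
  obtain ⟨r, hr, h0⟩ := A.nilp
  obtain ⟨s, rfl⟩ : ∃ s, r = s + 1 := ⟨r - 1, by omega⟩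
  have hSr : S (s + 1) = ⊥ := by
    refine Submodule.span_eq_bot.mpr ?_
    rintro _ ⟨p, i, h, u, a, ha, rfl⟩
    have : a = 0 := Subtype.ext (h0 i a.1 ha)
    rw [this, Tot.tm_zero_right]
  have hpow : ∀ n y, (T ^ n) y ∈ S (n + 1) := by
    intro n
    induction n with
    | zero => exact fun y => hS1 y
    | succ n ih =>
      intro y
      rw [pow_succ', Module.End.mul_apply]
      exact hstep _ _ (ih y)
  have : IsNilpotent T := ⟨s, LinearMap.ext fun y => by
    have h1 := hpow s y
    rwa [hSr, Submodule.mem_bot] at h1⟩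
  exact this

variable (k)

/-- The functor `(L, A) ↦ Tot (L ⊗ 𝔪(A))`. -/
def totFunctor : DGLA k ⥤ DgArt k ⥤ DGLA k :=
  Tot.functor k ⋙ (Functor.whiskeringLeft _ _ _).obj (DgArt.maxIdealFunctor k)

/-- The Maurer-Cartan set, as a functor on DGLAs. -/
def mcFunctor : DGLA k ⥤ Type u where
  obj L := L.MC
  map F := ↾fun ω => ⟨F.f 1 ω.1, F.isMC ω.2⟩

/-- The degree zero part, as a functor on DGLAs.  For nilpotent DGLAs, the exponential map
identifies it with (the underlying set of) the gauge group. -/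
def degZeroFunctor : DGLA k ⥤ Type u where
  obj L := L.X 0
  map F := ↾fun x => F.f 0 x

/-- The functor `mc(L,-)` on local Artinian cdgas, for varying `L`. -/
def mcArt : DGLA k ⥤ DgArt k ⥤ Type u :=
  totFunctor k ⋙ (Functor.whiskeringRight _ _ _).obj (mcFunctor k)

/-- The functor `Gg(L,-)` on local Artinian cdgas, for varying `L`, in exponential coordinates:
`Gg(L,A) = exp (Tot (L ⊗ 𝔪(A))⁰)`. -/
def ggArt : DGLA k ⥤ DgArt k ⥤ Type u :=
  totFunctor k ⋙ (Functor.whiskeringRight _ _ _).obj (degZeroFunctor k)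

end functors

/-! ### The functors `mc(L,-)` are pro-representable

This is needed to define `β(L)`: we show that `mc(L,-)` is a filtered colimit of representable
functors. -/

section prorep

variable {k : Type u} [Field k]

namespace Augmentation

theorem IsProd.pred {A : Cdga k} {e : Augmentation A} {r : ℕ} {n : ℤ} {x : A.X n}
    (h : e.IsProd (r + 1) x) (hr : 0 < r) : e.IsProd r x := by
  induction r generalizing n with
  | zero => exact absurd hr (lt_irrefl 0)
  | succ r ih =>
    cases h with
    | mul h x y hx hy =>
      rcases Nat.eq_zero_or_pos r with rfl | hr'
      · refine .one _ ?_
        have hx' : e.ε _ x = 0 := hx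
        rw [ker, LinearMap.mem_ker, e.ε_mul, hx', zero_mul]
      · exact .mul h x y hx (ih hy hr')

theorem IsProd.of_le {A : Cdga k} {e : Augmentation A} {r s : ℕ} {n : ℤ} {x : A.X n}
    (h : e.IsProd s x) (hr : 0 < r) (hrs : r ≤ s) : e.IsProd r x := by
  induction s, hrs using Nat.le_induction with
  | base => exact h
  | succ s hs ih => exact ih (h.pred (hr.trans_le hs))

theorem IsProd.map {A B : Cdga k} {e : Augmentation A} {e' : Augmentation B}
    (F : A.toNCdga ⟶ B.toNCdga) (hF : ∀ n, ∀ x ∈ e.ker n, F.f n x ∈ e'.ker n) {r : ℕ} {n : ℤ}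
    {x : A.X n} (h : e.IsProd r x) : e'.IsProd r (F.f n x) := by
  induction h with
  | one x hx => exact .one _ (hF _ x hx)
  | mul h x y hx _ ih =>
    rw [F.map_mul]
    exact .mul h _ _ (hF _ x hx) ih

end Augmentation

namespace DgArt

/-- An augmented cdga that embeds in a product of two local Artinian cdgas is local Artinian. -/
def ofInj (C : Cdga k) (e : Augmentation C) (A B : DgArt k) (F : C.toNCdga ⟶ A.toNCdga)
    (G : C.toNCdga ⟶ B.toNCdga) (hF : ∀ n, ∀ x ∈ e.ker n, F.f n x ∈ A.aug.ker n)
    (hG : ∀ n, ∀ x ∈ e.ker n, G.f n x ∈ B.aug.ker n)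
    (hinj : ∀ n x, F.f n x = 0 → G.f n x = 0 → x = 0) : DgArt k where
  toCdga := C
  aug := e
  nilp := by
    obtain ⟨r, hr, h0⟩ := A.nilp
    obtain ⟨s, hs, h0'⟩ := B.nilp
    refine ⟨r + s, by omega, fun n x hx => hinj n x ?_ ?_⟩
    · exact h0 n _ ((hx.map F hF).of_le hr (by omega))
    · exact h0' n _ ((hx.map G hG).of_le hs (by omega))
  fin n := by
    have := A.fin n
    have := B.fin n
    refine Module.Finite.of_injective
      (LinearMap.prod ((F.f n).restrict (hF n)) ((G.f n).restrict (hG n))) ?_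
    rw [← LinearMap.ker_eq_bot, LinearMap.ker_eq_bot']
    intro x hx
    have h1 := congrArg (fun z => (z.1 : A.X n)) hx
    have h2 := congrArg (fun z => (z.2 : B.X n)) hx
    exact Subtype.ext (hinj n x.1 h1 h2)
  bdd := by
    refine (A.bdd.union B.bdd).subset fun n hn => ?_
    by_contra hcon
    simp only [Set.mem_union, Set.mem_ofPred_eq, not_or, not_not] at hcon
    refine hn ((Submodule.eq_bot_iff _).mpr fun x hx => hinj n x ?_ ?_)
    · have := hF n x hx
      rwa [hcon.1, Submodule.mem_bot] at this
    · have := hG n x hx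
      rwa [hcon.2, Submodule.mem_bot] at this

/-- The fibre product `A ×_k B`. -/
def prodCdga (A B : DgArt k) : Cdga k where
  X n := LinearMap.ker (A.aug.ε n ∘ₗ LinearMap.fst k (A.X n) (B.X n)
    - B.aug.ε n ∘ₗ LinearMap.snd k (A.X n) (B.X n))
  d {i j} h := (LinearMap.prodMap (A.d h) (B.d h)).restrict fun x _ => by
    simp [A.aug.ε_d, B.aug.ε_d]
  mul {i j n} h := LinearMap.mk₂ k
    (fun x y => ⟨(A.mul h x.1.1 y.1.1, B.mul h x.1.2 y.1.2), by
      have hx := x.2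
      have hy := y.2
      simp only [LinearMap.mem_ker, LinearMap.sub_apply, LinearMap.comp_apply, LinearMap.fst_apply,
        LinearMap.snd_apply, sub_eq_zero] at hx hy ⊢
      rw [A.aug.ε_mul, B.aug.ε_mul, hx, hy]⟩)
    (fun x x' y => Subtype.ext (by simp)) (fun c x y => Subtype.ext (by simp))
    (fun x y y' => Subtype.ext (by simp)) (fun c x y => Subtype.ext (by simp))
  d_d h h' x := Subtype.ext (Prod.ext (A.d_d h h' x.1.1) (B.d_d h h' x.1.2))
  mul_comm h h' x y :=
    Subtype.ext (Prod.ext (A.mul_comm h h' x.1.1 y.1.1) (B.mul_comm h h' x.1.2 y.1.2))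
  mul_assoc hb h₂ ha h₁ x y z := Subtype.ext (Prod.ext
    (A.mul_assoc hb h₂ ha h₁ x.1.1 y.1.1 z.1.1) (B.mul_assoc hb h₂ ha h₁ x.1.2 y.1.2 z.1.2))
  d_mul h hn hi hj h₁ h₂ x y := Subtype.ext (Prod.ext
    (A.d_mul h hn hi hj h₁ h₂ x.1.1 y.1.1) (B.d_mul h hn hi hj h₁ h₂ x.1.2 y.1.2))
  one := ⟨(A.one, B.one), by simp [A.aug.ε_one, B.aug.ε_one]⟩
  one_mul x := Subtype.ext (Prod.ext (A.one_mul x.1.1) (B.one_mul x.1.2))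

theorem prodCdga_eq {A B : DgArt k} {n : ℤ} (x : (prodCdga A B).X n) :
    A.aug.ε n x.1.1 = B.aug.ε n x.1.2 := by
  have hx := x.2
  simpa only [LinearMap.mem_ker, LinearMap.sub_apply, LinearMap.comp_apply, LinearMap.fst_apply,
    LinearMap.snd_apply, sub_eq_zero] using hx

/-- The fibre product `A ×_k B`, as a local Artinian cdga. -/
def prod (A B : DgArt k) : DgArt k :=
  ofInj (prodCdga A B)
    { ε := fun n => A.aug.ε n ∘ₗ LinearMap.fst k _ _ ∘ₗ Submodule.subtype _
      ε_of_ne := fun hn x => A.aug.ε_of_ne hn _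
      ε_one := A.aug.ε_one
      ε_mul := fun h x y => A.aug.ε_mul h _ _
      ε_d := fun h x => A.aug.ε_d h _ }
    A B ⟨fun n => LinearMap.fst k _ _ ∘ₗ Submodule.subtype _, fun _ _ => rfl, fun _ _ _ => rfl⟩
    ⟨fun n => LinearMap.snd k _ _ ∘ₗ Submodule.subtype _, fun _ _ => rfl, fun _ _ _ => rfl⟩
    (fun n x hx => hx) (fun n x hx => (prodCdga_eq x).symm.trans hx)
    (fun n x h h' => Subtype.ext (Prod.ext h h'))

/-- The first projection. -/
def fst (A B : DgArt k) : prod A B ⟶ A :=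
  ⟨⟨fun n => LinearMap.fst k _ _ ∘ₗ Submodule.subtype _, fun _ _ => rfl, fun _ _ _ => rfl⟩, rfl⟩

/-- The second projection. -/
def snd (A B : DgArt k) : prod A B ⟶ B :=
  ⟨⟨fun n => LinearMap.snd k _ _ ∘ₗ Submodule.subtype _, fun _ _ => rfl, fun _ _ _ => rfl⟩, rfl⟩

/-- The inclusion `𝔪(A) → 𝔪(A ×_k B)`. -/
def inl (A B : DgArt k) (n : ℤ) : A.maxIdeal.X n →ₗ[k] (prod A B).maxIdeal.X n where
  toFun a := ⟨⟨(a.1, 0), by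
    have : A.aug.ε n a.1 = 0 := a.2
    simp [this]⟩, a.2⟩
  map_add' a b := Subtype.ext (Subtype.ext (Prod.ext rfl (add_zero _).symm))
  map_smul' c a := Subtype.ext (Subtype.ext (Prod.ext rfl (smul_zero _).symm))

/-- The inclusion `𝔪(B) → 𝔪(A ×_k B)`. -/
def inr (A B : DgArt k) (n : ℤ) : B.maxIdeal.X n →ₗ[k] (prod A B).maxIdeal.X n where
  toFun b := ⟨⟨(0, b.1), by
    have : B.aug.ε n b.1 = 0 := b.2
    simp [this]⟩, map_zero (A.aug.ε n)⟩
  map_add' a b := Subtype.ext (Subtype.ext (Prod.ext (add_zero _).symm rfl))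
  map_smul' c a := Subtype.ext (Subtype.ext (Prod.ext (smul_zero _).symm rfl))

/-- The equaliser of two morphisms, as a cdga. -/
def eqCdga {A B : DgArt k} (f g : A ⟶ B) : Cdga k where
  X n := LinearMap.eqLocus (f.f n) (g.f n)
  d {i j} h := (A.d h).restrict fun x hx => by
    have hx : f.f i x = g.f i x := hx
    simp [f.map_d, g.map_d, hx]
  mul {i j n} h := LinearMap.mk₂ k
    (fun x y => ⟨A.mul h x.1 y.1, by
      have hx : f.f i x = g.f i x := x.2
      have hy : f.f j y = g.f j y := y.2
      simp [f.map_mul, g.map_mul, hx, hy]⟩)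
    (fun x x' y => Subtype.ext (by simp)) (fun c x y => Subtype.ext (by simp))
    (fun x y y' => Subtype.ext (by simp)) (fun c x y => Subtype.ext (by simp))
  d_d h h' x := Subtype.ext (A.d_d h h' x.1)
  mul_comm h h' x y := Subtype.ext (A.mul_comm h h' x.1 y.1)
  mul_assoc hb h₂ ha h₁ x y z := Subtype.ext (A.mul_assoc hb h₂ ha h₁ x.1 y.1 z.1)
  d_mul h hn hi hj h₁ h₂ x y := Subtype.ext (A.d_mul h hn hi hj h₁ h₂ x.1 y.1)
  one := ⟨A.one, f.map_one.trans g.map_one.symm⟩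
  one_mul x := Subtype.ext (A.one_mul x.1)

/-- The equaliser of two morphisms. -/
def eqz {A B : DgArt k} (f g : A ⟶ B) : DgArt k :=
  ofInj (eqCdga f g)
    { ε := fun n => A.aug.ε n ∘ₗ Submodule.subtype _
      ε_of_ne := fun hn x => A.aug.ε_of_ne hn _
      ε_one := A.aug.ε_one
      ε_mul := fun h x y => A.aug.ε_mul h _ _
      ε_d := fun h x => A.aug.ε_d h _ }
    A A ⟨fun n => Submodule.subtype _, fun _ _ => rfl, fun _ _ _ => rfl⟩
    ⟨fun n => Submodule.subtype _, fun _ _ => rfl, fun _ _ _ => rfl⟩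
    (fun n x hx => hx) (fun n x hx => hx) (fun n x h _ => Subtype.ext h)

/-- The inclusion of the equaliser. -/
def eqι {A B : DgArt k} (f g : A ⟶ B) : eqz f g ⟶ A :=
  ⟨⟨fun n => Submodule.subtype _, fun _ _ => rfl, fun _ _ _ => rfl⟩, rfl⟩

theorem eqι_comp {A B : DgArt k} (f g : A ⟶ B) : eqι f g ≫ f = eqι f g ≫ g :=
  hom_ext fun _ x => x.2

variable (k) in
/-- The field `k` as a cdga concentrated in degree zero. -/
def unitCdga : Cdga k where
  X n := ({ carrier := {x | n ≠ 0 → x = 0}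
            add_mem' := fun ha hb hn => by rw [ha hn, hb hn, add_zero]
            zero_mem' := fun _ => rfl
            smul_mem' := fun c x hx hn => by rw [hx hn, smul_zero] } : Submodule k k)
  d h := 0
  mul {i j n} h := LinearMap.mk₂ k
    (fun x y => ⟨x.1 * y.1, fun hn => by
      by_cases hi : i = 0
      · rw [y.2 (by omega), mul_zero]
      · rw [x.2 hi, zero_mul]⟩)
    (fun x x' y => Subtype.ext (by simp [add_mul]))
    (fun c x y => Subtype.ext (by simp [mul_assoc]))
    (fun x y y' => Subtype.ext (by simp [mul_add]))
    (fun c x y => Subtype.ext (by simp [mul_left_comm]))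
  d_d h h' x := rfl
  mul_comm {i j n} h h' x y := Subtype.ext (by
    by_cases hi : i = 0
    · subst hi
      simp [sgn_zero, mul_comm]
    · simp [x.2 hi])
  mul_assoc hb h₂ ha h₁ x y z := Subtype.ext (mul_assoc _ _ _)
  d_mul h hn hi hj h₁ h₂ x y := by
    simp only [LinearMap.zero_apply, map_zero, smul_zero, add_zero]
  one := ⟨1, fun h => absurd rfl h⟩
  one_mul x := Subtype.ext (one_mul _)

variable (k) in
/-- The field `k` as a local Artinian cdga. -/
def unit : DgArt k where
  toCdga := unitCdga k
  aug :=
    { ε := fun n => Submodule.subtype _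
      ε_of_ne := fun hn x => x.2 hn
      ε_one := rfl
      ε_mul := fun h x y => rfl
      ε_d := fun h x => rfl }
  nilp := ⟨1, one_pos, fun n x hx => by
    cases hx with
    | one x hx => exact Subtype.ext hx
    | mul h x y hx hy => cases hy⟩
  fin n := Module.Finite.of_injective
    (0 : _ →ₗ[k] k) fun x y _ => Subtype.ext (Subtype.ext (x.2.trans y.2.symm))
  bdd := by
    convert Set.finite_empty (α := ℤ)
    refine Set.eq_empty_iff_forall_notMem.mpr fun n hn => hn ?_
    exact (Submodule.eq_bot_iff _).mpr fun x hx => Subtype.ext hx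

end DgArt

namespace Tot

variable {L : DGLA k} {M M' : NCdga k}

theorem mapLin_add (f : ∀ p, L.X p →ₗ[k] L.X p) (g g' : ∀ i, M.X i →ₗ[k] M'.X i) {n : ℤ}
    (x : X L M n) :
    mapLin f (fun i => g i + g' i) n x = mapLin f g n x + mapLin f g' n x := by
  induction x using ind with
  | h0 => simp
  | hadd x y hx hy => simp only [map_add, hx, hy]; abel
  | htm h u a => simp [tm_add_right]

theorem mapLin_congr (f : ∀ p, L.X p →ₗ[k] L.X p) {g g' : ∀ i, M.X i →ₗ[k] M'.X i}
    (h : ∀ i a, g i a = g' i a) {n : ℤ} (x : X L M n) : mapLin f g n x = mapLin f g' n x := by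
  have : g = g' := funext fun i => LinearMap.ext (h i)
  rw [this]

theorem mapLin_zero (f : ∀ p, L.X p →ₗ[k] L.X p) {n : ℤ} (x : X L M n) :
    mapLin f (fun i => (0 : M.X i →ₗ[k] M'.X i)) n x = 0 := by
  induction x using ind with
  | h0 => simp
  | hadd x y hx hy => simp only [map_add, hx, hy, add_zero]
  | htm h u a => simp

end Tot

/-- The curvature `dω + ½[ω,ω]`. -/
def Tot.curv {L : DGLA k} {M : NCdga k} (ω : Tot.X L M 1) : Tot.X L M 2 :=
  Tot.d (by norm_num) ω + (2 : k)⁻¹ • Tot.br (by norm_num) ω ω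

theorem Tot.map_curv {L L' : DGLA k} {M M' : NCdga k} (F : L ⟶ L') (G : M ⟶ M')
    (ω : Tot.X L M 1) :
    Tot.mapLin F.f G.f 2 (Tot.curv ω) = Tot.curv (Tot.mapLin F.f G.f 1 ω) := by
  have hd : Tot.mapLin F.f G.f 2 (Tot.d (by norm_num) ω) =
      Tot.d (by norm_num) (Tot.mapLin F.f G.f 1 ω) :=
    (Tot.map F G).map_d (show (1 : ℤ) + 1 = 2 by norm_num) ω
  have hb : Tot.mapLin F.f G.f 2 (Tot.br (by norm_num) ω ω) =
      Tot.br (by norm_num) (Tot.mapLin F.f G.f 1 ω) (Tot.mapLin F.f G.f 1 ω) :=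
    (Tot.map F G).map_br (show (1 : ℤ) + 1 = 2 by norm_num) ω ω
  rw [Tot.curv, Tot.curv, map_add, map_smul, hd, hb]

theorem Tot.exists_prod (L : DGLA k) {M A B : NCdga k} (p₁ : M ⟶ A) (p₂ : M ⟶ B)
    (s₁ : ∀ i, A.X i →ₗ[k] M.X i) (s₂ : ∀ i, B.X i →ₗ[k] M.X i)
    (h₁₁ : ∀ i x, p₁.f i (s₁ i x) = x) (h₁₂ : ∀ i x, p₁.f i (s₂ i x) = 0)
    (h₂₁ : ∀ i x, p₂.f i (s₁ i x) = 0) (h₂₂ : ∀ i x, p₂.f i (s₂ i x) = x)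
    (hid : ∀ i x, s₁ i (p₁.f i x) + s₂ i (p₂.f i x) = x)
    (ω : Tot.X L A 1) (hω : Tot.curv ω = 0) (ω' : Tot.X L B 1) (hω' : Tot.curv ω' = 0) :
    ∃ ψ : Tot.X L M 1, Tot.curv ψ = 0 ∧
      Tot.mapLin (DGLA.Hom.f (𝟙 L)) p₁.f 1 ψ = ω ∧
      Tot.mapLin (DGLA.Hom.f (𝟙 L)) p₂.f 1 ψ = ω' := by
  let I : ∀ p, L.X p →ₗ[k] L.X p := DGLA.Hom.f (𝟙 L)
  have hinj : ∀ {n : ℤ} (x : Tot.X L M n),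
      Tot.mapLin I p₁.f n x = 0 → Tot.mapLin I p₂.f n x = 0 → x = 0 := by
    intro n x h₁ h₂
    have e₁ := Tot.mapLin_comp I p₁.f I s₁ x
    have e₂ := Tot.mapLin_comp I p₂.f I s₂ x
    have h := Tot.mapLin_add I (fun i => s₁ i ∘ₗ p₁.f i) (fun i => s₂ i ∘ₗ p₂.f i) x
    rw [Tot.mapLin_congr (g' := fun i => LinearMap.id) _ hid] at h
    rw [h₁, map_zero] at e₁
    rw [h₂, map_zero] at e₂
    exact (Tot.mapLin_id x).symm.trans
      (h.trans ((congrArg₂ (· + ·) e₁.symm e₂.symm).trans (add_zero _)))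
  let ψ : Tot.X L M 1 := Tot.mapLin I s₁ 1 ω + Tot.mapLin I s₂ 1 ω'
  have h₁ : Tot.mapLin I p₁.f 1 ψ = ω := by
    rw [map_add, Tot.mapLin_comp, Tot.mapLin_comp]
    have a₁ := Tot.mapLin_congr I (g := fun i => p₁.f i ∘ₗ s₁ i) (g' := fun i => LinearMap.id)
      h₁₁ ω
    have a₂ := Tot.mapLin_congr I (g := fun i => p₁.f i ∘ₗ s₂ i) (g' := fun i => 0) h₁₂ ω'
    exact (congrArg₂ (· + ·) (a₁.trans (Tot.mapLin_id _)) (a₂.trans (Tot.mapLin_zero _ _))).trans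
      (add_zero _)
  have h₂ : Tot.mapLin I p₂.f 1 ψ = ω' := by
    rw [map_add, Tot.mapLin_comp, Tot.mapLin_comp]
    have a₁ := Tot.mapLin_congr I (g := fun i => p₂.f i ∘ₗ s₁ i) (g' := fun i => 0) h₂₁ ω
    have a₂ := Tot.mapLin_congr I (g := fun i => p₂.f i ∘ₗ s₂ i) (g' := fun i => LinearMap.id)
      h₂₂ ω'
    exact (congrArg₂ (· + ·) (a₁.trans (Tot.mapLin_zero _ _)) (a₂.trans (Tot.mapLin_id _))).trans
      (zero_add _)
  refine ⟨ψ, hinj _ ?_ ?_, h₁, h₂⟩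
  · exact (Tot.map_curv (𝟙 L) p₁ ψ).trans ((congrArg Tot.curv h₁).trans hω)
  · exact (Tot.map_curv (𝟙 L) p₂ ψ).trans ((congrArg Tot.curv h₂).trans hω')

theorem Tot.exists_eqz (L : DGLA k) {E M N : NCdga k} (ι : E ⟶ M) (F G : M ⟶ N)
    (r : ∀ i, M.X i →ₗ[k] E.X i) (s : ∀ i, N.X i →ₗ[k] M.X i)
    (hιr : ∀ i x, ι.f i (r i x) + s i (F.f i x - G.f i x) = x) (hrι : ∀ i x, r i (ι.f i x) = x)
    (ω : Tot.X L M 1) (hω : Tot.curv ω = 0)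
    (h : Tot.mapLin (DGLA.Hom.f (𝟙 L)) F.f 1 ω = Tot.mapLin (DGLA.Hom.f (𝟙 L)) G.f 1 ω) :
    ∃ ψ : Tot.X L E 1, Tot.curv ψ = 0 ∧ Tot.mapLin (DGLA.Hom.f (𝟙 L)) ι.f 1 ψ = ω := by
  let I : ∀ p, L.X p →ₗ[k] L.X p := DGLA.Hom.f (𝟙 L)
  have hω0 : Tot.mapLin I (fun i => F.f i - G.f i) 1 ω = 0 := by
    have h1 := Tot.mapLin_add I (fun i => F.f i - G.f i) G.f ω
    rw [Tot.mapLin_congr I (g' := F.f) (fun i a => by simp)] at h1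
    exact right_eq_add.mp (h.symm.trans h1)
  have hψ : Tot.mapLin I ι.f 1 (Tot.mapLin I r 1 ω) = ω := by
    have h1 := Tot.mapLin_add I (fun i => ι.f i ∘ₗ r i) (fun i => s i ∘ₗ (F.f i - G.f i)) ω
    rw [Tot.mapLin_congr I (g' := fun i => LinearMap.id) hιr] at h1
    have h2 := Tot.mapLin_comp I (fun i => F.f i - G.f i) I s ω
    rw [hω0, map_zero] at h2
    exact (Tot.mapLin_comp I r I ι.f ω).trans ((add_zero _).symm.trans
      ((congrArg₂ (· + ·) rfl h2).trans (h1.symm.trans (Tot.mapLin_id ω))))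
  refine ⟨Tot.mapLin I r 1 ω, ?_, hψ⟩
  have h0 : Tot.mapLin I ι.f 2 (Tot.curv (Tot.mapLin I r 1 ω)) = 0 :=
    (Tot.map_curv (𝟙 L) ι _).trans ((congrArg Tot.curv hψ).trans hω)
  have h1 := congrArg (Tot.mapLin I r 2) h0
  rw [Tot.mapLin_comp, map_zero, Tot.mapLin_congr _ (g' := fun i => LinearMap.id) hrι] at h1
  exact (Tot.mapLin_id _).symm.trans h1

theorem exists_mc_prod (L : DGLA k) (A B : DgArt k) (ω : (Tot.dgla L A.maxIdeal).MC)
    (ω' : (Tot.dgla L B.maxIdeal).MC) : ∃ ψ : (Tot.dgla L (DgArt.prod A B).maxIdeal).MC,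
      ((mcArt k).obj L).map (DgArt.fst A B) ψ = ω ∧
      ((mcArt k).obj L).map (DgArt.snd A B) ψ = ω' := by
  obtain ⟨ψ, h, h₁, h₂⟩ := Tot.exists_prod L (DgArt.mapIdeal (DgArt.fst A B))
    (DgArt.mapIdeal (DgArt.snd A B)) (DgArt.inl A B) (DgArt.inr A B) (fun _ _ => rfl)
    (fun _ _ => rfl) (fun _ _ => rfl) (fun _ _ => rfl)
    (fun _ _ => Subtype.ext (Subtype.ext (Prod.ext (add_zero _) (zero_add _)))) ω.1 ω.2 ω'.1 ω'.2
  exact ⟨⟨ψ, h⟩, Subtype.ext h₁, Subtype.ext h₂⟩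

theorem exists_section {V W : Type*} [AddCommGroup V] [AddCommGroup W] [Module k V] [Module k W]
    (h : V →ₗ[k] W) : ∃ s : W →ₗ[k] V, ∀ x, h (s (h x)) = h x := by
  obtain ⟨t, ht⟩ := LinearMap.exists_rightInverse_of_surjective h.rangeRestrict
    (LinearMap.range_rangeRestrict _)
  obtain ⟨s, hs⟩ := LinearMap.exists_extend t
  refine ⟨s, fun x => ?_⟩
  have h1 : s (h x) = t (h.rangeRestrict x) := LinearMap.congr_fun hs (h.rangeRestrict x)
  have h2 := LinearMap.congr_fun ht (h.rangeRestrict x)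
  rw [h1]
  exact congrArg Subtype.val h2

theorem exists_mc_eqz (L : DGLA k) {A B : DgArt k} (f g : A ⟶ B)
    (ω : (Tot.dgla L A.maxIdeal).MC)
    (h : ((mcArt k).obj L).map f ω = ((mcArt k).obj L).map g ω) :
    ∃ ψ : (Tot.dgla L (DgArt.eqz f g).maxIdeal).MC,
      ((mcArt k).obj L).map (DgArt.eqι f g) ψ = ω := by
  choose s hs using fun i => exists_section
    ((DgArt.mapIdeal f).f i - (DgArt.mapIdeal g).f i : A.maxIdeal.X i →ₗ[k] B.maxIdeal.X i)
  let q : ∀ i, A.maxIdeal.X i →ₗ[k] A.maxIdeal.X i := fun i =>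
    LinearMap.id - s i ∘ₗ ((DgArt.mapIdeal f).f i - (DgArt.mapIdeal g).f i)
  have hq : ∀ i x, (DgArt.mapIdeal f).f i (q i x) = (DgArt.mapIdeal g).f i (q i x) := by
    intro i x
    have h1 : ((DgArt.mapIdeal f).f i - (DgArt.mapIdeal g).f i :
        A.maxIdeal.X i →ₗ[k] B.maxIdeal.X i) (q i x) = 0 :=
      (map_sub _ x _).trans (sub_eq_zero.mpr (hs i x).symm)
    exact sub_eq_zero.mp h1
  let r : ∀ i, A.maxIdeal.X i →ₗ[k] (DgArt.eqz f g).maxIdeal.X i := fun i =>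
    { toFun := fun x => ⟨⟨(q i x).1, congrArg Subtype.val (hq i x)⟩, (q i x).2⟩
      map_add' := fun x y =>
        Subtype.ext (Subtype.ext (congrArg (fun z : A.maxIdeal.X i => z.1) (map_add (q i) x y)))
      map_smul' := fun c x =>
        Subtype.ext (Subtype.ext (congrArg (fun z : A.maxIdeal.X i => z.1) (map_smul (q i) c x))) }
  have hr : ∀ i x, (DgArt.mapIdeal (DgArt.eqι f g)).f i (r i x) = q i x := fun i x => rfl
  have hιr : ∀ i x, (DgArt.mapIdeal (DgArt.eqι f g)).f i (r i x)
      + s i ((DgArt.mapIdeal f).f i x - (DgArt.mapIdeal g).f i x) = x := by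
    intro i x
    rw [hr]
    exact sub_add_cancel _ _
  have hrι : ∀ i x, r i ((DgArt.mapIdeal (DgArt.eqι f g)).f i x) = x := by
    intro i x
    have h1 := hιr i ((DgArt.mapIdeal (DgArt.eqι f g)).f i x)
    have h2 : (DgArt.mapIdeal f).f i ((DgArt.mapIdeal (DgArt.eqι f g)).f i x)
      = (DgArt.mapIdeal g).f i ((DgArt.mapIdeal (DgArt.eqι f g)).f i x) := Subtype.ext x.1.2
    rw [h2, sub_self, map_zero, add_zero] at h1
    exact Subtype.ext (Subtype.ext (congrArg (fun z : A.maxIdeal.X i => z.1) h1))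
  obtain ⟨ψ, h, h₁⟩ := Tot.exists_eqz L (DgArt.mapIdeal (DgArt.eqι f g)) (DgArt.mapIdeal f)
    (DgArt.mapIdeal g) r s hιr hrι ω.1 ω.2 (congrArg Subtype.val h)
  exact ⟨⟨ψ, h⟩, Subtype.ext h₁⟩

end prorep

section small

variable {k : Type u} [Field k]

namespace DgArt

theorem exists_embedding (A : DgArt k) (n : ℤ) :
    ∃ e : A.X n →ₗ[k] (ℕ → k), Function.Injective e := by
  have := A.fin n
  let φ : A.X n →ₗ[k] k := A.aug.ε n
  have : Module.Finite k (LinearMap.ker φ) := this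
  have hq : Module.Finite k (A.X n ⧸ LinearMap.ker φ) :=
    Module.Finite.equiv φ.quotKerEquivRange.symm
  have : Module.Finite k (A.X n) := Module.Finite.of_submodule_quotient (LinearMap.ker φ)
  let b := Module.finBasis k (A.X n)
  let ext : (Fin (Module.finrank k (A.X n)) → k) →ₗ[k] (ℕ → k) :=
    { toFun := fun f m => if h : m < Module.finrank k (A.X n) then f ⟨m, h⟩ else 0
      map_add' := fun f g => by ext m; by_cases h : m < Module.finrank k (A.X n) <;> simp [h]
      map_smul' := fun c f => by ext m; by_cases h : m < Module.finrank k (A.X n) <;> simp [h] }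
  refine ⟨ext ∘ₗ b.equivFun.toLinearMap, fun x y hxy => b.equivFun.injective (funext fun m => ?_)⟩
  have := congrFun hxy m.1
  simpa [ext] using this

/-- An embedding of each graded piece in `k^ℕ`. -/
def emb (A : DgArt k) (n : ℤ) : A.X n →ₗ[k] (ℕ → k) := (exists_embedding A n).choose

theorem emb_inj (A : DgArt k) (n : ℤ) : Function.Injective (A.emb n) :=
  (exists_embedding A n).choose_spec

/-- Data of bounded size that determine a local Artinian cdga up to isomorphism. -/
def code (A : DgArt k) : (ℤ → Set (ℕ → k)) × (ℤ → ℤ → Set ((ℕ → k) × (ℕ → k))) ×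
    (ℤ → ℤ → ℤ → Set ((ℕ → k) × (ℕ → k) × (ℕ → k))) × (ℕ → k) :=
  (fun n => Set.range (A.emb n),
    fun i j => {z | ∃ (h : j + 1 = i) (x : A.X i), z = (A.emb i x, A.emb j (A.d h x))},
    fun i j n => {z | ∃ (h : i + j = n) (x : A.X i) (y : A.X j),
      z = (A.emb i x, A.emb j y, A.emb n (A.mul h x y))},
    A.emb 0 A.one)

theorem exists_hom_of_code_eq {A B : DgArt k} (h : A.code = B.code) :
    ∃ F : A ⟶ B, ∀ n x, B.emb n (F.f n x) = A.emb n x := by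
  have h₁ : ∀ n, Set.range (A.emb n) = Set.range (B.emb n) := fun n => congrFun (congrArg (·.1) h) n
  have h₂ := congrArg (·.2.1) h
  have h₃ := congrArg (·.2.2.1) h
  have h₄ : A.emb 0 A.one = B.emb 0 B.one := congrArg (·.2.2.2) h
  have hex : ∀ n x, ∃ y, B.emb n y = A.emb n x := fun n x => by
    have : A.emb n x ∈ Set.range (B.emb n) := h₁ n ▸ Set.mem_range_self x
    exact this
  choose φ hφ using hex
  refine ⟨⟨⟨fun n => ⟨⟨φ n, fun x y => B.emb_inj n ?_⟩, fun c x => B.emb_inj n ?_⟩, ?_, ?_⟩, ?_⟩, hφ⟩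
  · rw [map_add, hφ, hφ, hφ, map_add]
  · rw [RingHom.id_apply, map_smul, hφ, hφ, map_smul]
  · intro i j hij x
    refine B.emb_inj j ?_
    have hm : (A.emb i x, A.emb j (A.d hij x)) ∈ B.code.2.1 i j := by
      rw [← h]
      exact ⟨hij, x, rfl⟩
    obtain ⟨_, y, hy⟩ := hm
    have e₁ := congrArg Prod.fst hy
    have e₂ := congrArg Prod.snd hy
    have hxy : φ i x = y := B.emb_inj i ((hφ i x).trans e₁)
    exact (hφ j _).trans (e₂.trans (by rw [← hxy]; rfl))
  · intro i j n hij x x'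
    refine B.emb_inj n ?_
    have hm : (A.emb i x, A.emb j x', A.emb n (A.mul hij x x')) ∈ B.code.2.2.1 i j n := by
      rw [← h]
      exact ⟨hij, x, x', rfl⟩
    obtain ⟨_, y, y', hy⟩ := hm
    have e₁ := congrArg (·.1) hy
    have e₂ := congrArg (·.2.1) hy
    have e₃ := congrArg (·.2.2) hy
    have hxy : φ i x = y := B.emb_inj i ((hφ i x).trans e₁)
    have hxy' : φ j x' = y' := B.emb_inj j ((hφ j x').trans e₂)
    exact (hφ n _).trans (e₃.trans (by rw [← hxy, ← hxy']; rfl))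
  · exact B.emb_inj 0 ((hφ 0 _).trans h₄)

theorem nonempty_iso_of_code_eq {A B : DgArt k} (h : A.code = B.code) : Nonempty (A ≅ B) := by
  obtain ⟨F, hF⟩ := exists_hom_of_code_eq h
  obtain ⟨G, hG⟩ := exists_hom_of_code_eq h.symm
  refine ⟨⟨F, G, hom_ext fun n x => A.emb_inj n ?_, hom_ext fun n x => B.emb_inj n ?_⟩⟩
  · rw [comp_f, hG, hF, id_f]
  · rw [comp_f, hF, hG, id_f]

instance : EssentiallySmall.{u} (DgArt k) := by
  rw [essentiallySmall_iff]
  refine ⟨?_, inferInstance⟩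
  refine small_of_injective (f := fun X : Skeleton (DgArt k) =>
    code ((fromSkeleton (DgArt k)).obj X)) fun X Y h => ?_
  obtain ⟨e⟩ := nonempty_iso_of_code_eq h
  exact skeleton_skeletal _ ⟨(fromSkeleton (DgArt k)).preimageIso e⟩

end DgArt

/-- `mc(L,-)` is an ind-object of the opposite of the category of local Artinian cdgas. -/
theorem isIndObject_mc (L : DGLA k) :
    IsIndObject (unopUnop (DgArt k) ⋙ (mcArt k).obj L) := by
  rw [isIndObject_iff]
  have : LocallySmall.{u} ((DgArt k)ᵒᵖᵒᵖ ⥤ Type u) :=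
    locallySmall_of_faithful (equivSmallModel.{u} (DgArt k)ᵒᵖᵒᵖ).congrLeft.functor
  refine ⟨?_, finallySmall_of_essentiallySmall _⟩
  suffices IsCofiltered (unopUnop (DgArt k) ⋙ (mcArt k).obj L).Elements from
    IsFiltered.of_equivalence (CategoryOfElements.costructuredArrowYonedaEquivalence _)
  have h₀ : Nonempty (unopUnop (DgArt k) ⋙ (mcArt k).obj L).Elements :=
    ⟨⟨op (op (DgArt.unit k)), ⟨(0 : Tot.X L (DgArt.unit k).maxIdeal 1), by
      change Tot.curv 0 = 0
      simp [Tot.curv]⟩⟩⟩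
  refine { cone_objs := ?_, cone_maps := ?_ }
  · rintro ⟨A, ω⟩ ⟨B, ω'⟩
    obtain ⟨ψ, h₁, h₂⟩ := exists_mc_prod L A.unop.unop B.unop.unop ω ω'
    exact ⟨⟨op (op (DgArt.prod A.unop.unop B.unop.unop)), ψ⟩,
      ⟨(DgArt.fst A.unop.unop B.unop.unop).op.op, h₁⟩,
      ⟨(DgArt.snd A.unop.unop B.unop.unop).op.op, h₂⟩, trivial⟩
  · rintro ⟨A, ω⟩ ⟨B, ω'⟩ ⟨f, hf⟩ ⟨g, hg⟩
    obtain ⟨ψ, h⟩ := exists_mc_eqz L f.unop.unop g.unop.unop ω (hf.trans hg.symm)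
    refine ⟨⟨op (op (DgArt.eqz f.unop.unop g.unop.unop)), ψ⟩,
      ⟨(DgArt.eqι f.unop.unop g.unop.unop).op.op, h⟩, ?_⟩
    refine Subtype.ext ?_
    exact congrArg (fun z => z.op.op) (DgArt.eqι_comp f.unop.unop g.unop.unop)

end small

/-! ### The pro-category, and the functors `mc`, `Gg` and `ddef` on it -/

section pro

variable (k : Type u) [Field k]

/-- The category `pro (dgArt k)` of pro-objects in local Artinian cdgas, as the opposite of the
category of ind-objects of the opposite category. -/
abbrev ProDgArt : Type (u + 1) := (Ind (DgArt k)ᵒᵖ)ᵒᵖ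

variable {k}

/-- The functor on `dgArt k` pro-represented by `A` (written on the double opposite): it sends `B`
to `Hom (A, B)`, which is `colim_α Hom (A_α, B)` when `A = {A_α}`. -/
abbrev ProDgArt.h (A : ProDgArt k) : (DgArt k)ᵒᵖᵒᵖ ⥤ Type u := (Ind.inclusion (DgArt k)ᵒᵖ).obj A.unop

/-- The extension of a functor `F` on `dgArt k` to pro-objects by taking limits.  For `A = {A_α}`,
this is the set of natural transformations `colim_α Hom (A_α,-) ⟶ F`, that is `lim_α F(A_α)`; see
`ProDgArt.evalEquiv`. -/
abbrev ProDgArt.eval (F : DgArt k ⥤ Type u) (A : ProDgArt k) : Type (u + 1) :=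
  A.h ⟶ unopUnop (DgArt k) ⋙ F

variable (k) in
/-- The extension of functors to pro-objects, as a bifunctor. -/
def ProDgArt.evalFunctor : ProDgArt k ⥤ (DgArt k ⥤ Type u) ⥤ Type (u + 1) :=
  (Ind.inclusion (DgArt k)ᵒᵖ).op ⋙ coyoneda ⋙
    (Functor.whiskeringLeft _ _ _).obj ((Functor.whiskeringLeft _ _ _).obj (unopUnop (DgArt k)))

end pro

section presentation

variable {k : Type u} [Field k]

/-- If the ind-object `A.h` is presented by a filtered system `i ↦ A_i`, then the extension of `F`
to `A` is the limit `lim_i F(A_i)`. -/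
def ProDgArt.evalEquiv (F : DgArt k ⥤ Type u) (A : ProDgArt k) (P : IndObjectPresentation A.h) :
    A.eval F ≃ (P.F.leftOp ⋙ F).sections :=
  let a : ∀ i : P.I, yoneda.obj (P.F.obj i) ⟶ A.h := fun i => P.ι.app i
  have ha : ∀ {i j : P.I} (f : i ⟶ j), yoneda.map (P.F.map f) ≫ a j = a i := fun f =>
    (P.ι.naturality f).trans (Category.comp_id _)
  let c : (P.F.leftOp ⋙ F).sections → Cocone (P.F ⋙ yoneda) := fun s =>
    ⟨unopUnop (DgArt k) ⋙ F,
      { app := fun i => yonedaEquiv.symm (s.1 (op i))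
        naturality := fun i j f => by
          refine yonedaEquiv.injective ?_
          refine Eq.trans (yonedaEquiv_naturality (yonedaEquiv.symm _) (P.F.map f)).symm ?_
          refine Eq.trans ?_ (congrArg yonedaEquiv (Category.comp_id _).symm)
          rw [Equiv.apply_symm_apply]
          exact (s.2 f.op).trans (Equiv.apply_symm_apply
            (yonedaEquiv (X := P.F.obj i) (F := unopUnop (DgArt k) ⋙ F)) (s.1 (op i))).symm }⟩
  let t : A.eval F → ∀ i : P.Iᵒᵖ, F.obj (P.F.leftOp.obj i) := fun τ i =>
    yonedaEquiv (X := P.F.obj i.unop) (F := unopUnop (DgArt k) ⋙ F) (a i.unop ≫ τ)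
  { toFun := fun τ => ⟨t τ, fun {i j} f => by
      refine Eq.trans (yonedaEquiv_naturality (a i.unop ≫ τ) (P.F.map f.unop)) ?_
      exact congrArg yonedaEquiv ((Category.assoc _ _ _).symm.trans (congrArg (· ≫ τ) (ha f.unop)))⟩
    invFun := fun s => P.isColimit.desc (c s)
    left_inv := fun τ => P.isColimit.hom_ext fun i =>
      (P.isColimit.fac _ i).trans (Equiv.symm_apply_apply yonedaEquiv _)
    right_inv := fun s => Subtype.ext (funext fun i =>
      (congrArg yonedaEquiv (P.isColimit.fac (c s) i.unop)).trans
        (Equiv.apply_symm_apply yonedaEquiv _)) }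

theorem ProDgArt.evalEquiv_naturality {F G : DgArt k ⥤ Type u} (η : F ⟶ G) (A : ProDgArt k)
    (P : IndObjectPresentation A.h) (τ : A.eval F) (i : P.Iᵒᵖ) :
    (evalEquiv G A P (τ ≫ Functor.whiskerLeft (unopUnop (DgArt k)) η)).1 i =
      η.app (P.F.leftOp.obj i) ((evalEquiv F A P τ).1 i) := rfl

end presentation

/-! ### Existence of the left adjoint of `β` -/

section leftadjoint

variable {k : Type u} [Field k]

namespace Tot

variable {L L' : DGLA k} {M M' : NCdga k}

/-- Contraction with a linear form on `M_i`. -/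
def contr {p i n : ℤ} (h : p - i = n) (φ : Module.Dual k (M.X i)) : X L M n →ₗ[k] L.X p :=
  (TensorProduct.rid k (L.X p)).toLinearMap ∘ₗ LinearMap.lTensor (L.X p) φ ∘ₗ
    DirectSum.component k {s : ℤ × ℤ // s.1 - s.2 = n} (fun s => L.X s.1.1 ⊗[k] M.X s.1.2)
      ⟨(p, i), h⟩

theorem contr_tm {p i n : ℤ} (h : p - i = n) (φ : Module.Dual k (M.X i)) (u : L.X p)
    (a : M.X i) : contr h φ (tm h u a) = φ a • u := by
  simp [contr, tm, incl, DirectSum.component.lof_self]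

theorem contr_tm_ne {p i q j n : ℤ} (h : p - i = n) (h' : q - j = n) (hne : i ≠ j)
    (φ : Module.Dual k (M.X i)) (u : L.X q) (a : M.X j) :
    contr h φ (tm h' u a) = 0 := by
  have : DirectSum.component k {s : ℤ × ℤ // s.1 - s.2 = n}
      (fun s => L.X s.1.1 ⊗[k] M.X s.1.2) ⟨(p, i), h⟩ (tm h' u a) = 0 := by
    rw [tm, incl, DirectSum.component.of, dif_neg]
    intro hcon
    exact hne (congrArg (fun z => z.1.2) hcon).symm
  rw [contr, LinearMap.comp_apply, LinearMap.comp_apply, this, map_zero, map_zero]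

theorem contr_mapLin {p i n : ℤ} (h : p - i = n) (φ : Module.Dual k (M'.X i))
    (f : ∀ p, L.X p →ₗ[k] L'.X p) (g : ∀ i, M.X i →ₗ[k] M'.X i) (x : X L M n) :
    contr h φ (mapLin f g n x) = f p (contr h (φ ∘ₗ g i) x) := by
  induction x using ind with
  | h0 => simp
  | hadd x y hx hy => simp only [map_add, hx, hy]
  | @htm q j hs u a =>
    rw [mapLin_tm]
    by_cases hij : i = j
    · subst hij
      obtain rfl : q = p := by omega
      rw [contr_tm, contr_tm, map_smul]
      rfl
    · rw [contr_tm_ne h hs hij, contr_tm_ne h hs hij, map_zero]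

theorem contr_ext {n : ℤ} {x y : X L M n}
    (hxy : ∀ {p i : ℤ} (h : p - i = n) (φ : Module.Dual k (M.X i)),
      contr h φ x = contr h φ y) : x = y := by
  classical
  refine DFinsupp.ext fun s => ?_
  obtain ⟨⟨p, i⟩, h⟩ := s
  let b := Module.Free.chooseBasis k (M.X i)
  refine (TensorProduct.equivFinsuppOfBasisRight (M := L.X p) b).injective
    (Finsupp.ext fun m => ?_)
  rw [TensorProduct.equivFinsuppOfBasisRight_apply, TensorProduct.equivFinsuppOfBasisRight_apply]
  exact hxy h (b.coord m)

theorem exists_contr_eq (hfin : ∀ i, Module.Finite k (M.X i))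
    (hbdd : {i : ℤ | ∃ x : M.X i, x ≠ 0}.Finite) (n : ℤ)
    (g : ∀ p i : ℤ, p - i = n → (Module.Dual k (M.X i) →ₗ[k] L.X p)) :
    ∃ x : X L M n, ∀ (p i : ℤ) (h : p - i = n) (φ : Module.Dual k (M.X i)),
      contr h φ x = g p i h φ := by
  classical
  let b := fun i => Module.finBasis k (M.X i)
  refine ⟨∑ i ∈ hbdd.toFinset, ∑ m, tm (show (n + i) - i = n by omega)
    (g (n + i) i (by omega) ((b i).coord m)) (b i m), fun p i h φ => ?_⟩
  obtain rfl : p = n + i := by omega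
  rw [map_sum]
  have hterm : ∀ j ∈ hbdd.toFinset, j ≠ i → contr h φ (∑ m, tm (show (n + j) - j = n by omega)
      (g (n + j) j (by omega) ((b j).coord m)) (b j m)) = 0 := by
    intro j _ hj
    rw [map_sum]
    exact Finset.sum_eq_zero fun m _ => contr_tm_ne h _ (Ne.symm hj) _ _ _
  have hi : i ∉ hbdd.toFinset → contr h φ (∑ m, tm (show (n + i) - i = n by omega)
      (g (n + i) i (by omega) ((b i).coord m)) (b i m)) = 0 := by
    intro hi
    rw [map_sum]
    refine Finset.sum_eq_zero fun m _ => ?_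
    have : b i m = 0 := by
      by_contra hne
      exact hi (hbdd.mem_toFinset.mpr ⟨_, hne⟩)
    rw [this, tm_zero_right, map_zero]
  rw [Finset.sum_eq_single i hterm hi, map_sum]
  simp only [contr_tm]
  have hφ : φ = ∑ m, φ (b i m) • (b i).coord m := by
    refine (b i).ext fun m => ?_
    simp
  conv_rhs => rw [hφ, map_sum]
  simp only [map_smul]

end Tot

/-! The value of `β*` on `lim_j A_j` is the DGLA freely generated by the duals of the `𝔪(A_j)`,
modulo the relations that say that the tautological elements of `Tot (- ⊗ 𝔪(A_j))¹` are compatible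
and satisfy the Maurer-Cartan equation.  It is obtained here as the image of the free object in the
product of all the DGLAs equipped with such a family. -/

namespace Cobar

variable {J : Type u} [Category.{u} J] (D : J ⥤ DgArt k)

/-- Compatible families of Maurer-Cartan elements: the elements of `lim_j mc(L, A_j)`. -/
abbrev Fam (L : DGLA k) : Type u := (D ⋙ (mcArt k).obj L).sections

variable {D} in
/-- The underlying elements of a compatible family. -/
def Fam.el {L : DGLA k} (s : Fam D L) (j : J) : Tot.X L (D.obj j).maxIdeal 1 :=
  (show (Tot.dgla L (D.obj j).maxIdeal).MC from s.1 j).1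

variable {D} in
theorem Fam.el_mc {L : DGLA k} (s : Fam D L) (j : J) : Tot.curv (s.el j) = 0 :=
  (show (Tot.dgla L (D.obj j).maxIdeal).MC from s.1 j).2

variable {D} in
theorem Fam.el_map {L : DGLA k} (s : Fam D L) {j j' : J} (f : j ⟶ j') :
    Tot.mapLin (DGLA.Hom.f (𝟙 L)) (DgArt.mapIdeal (D.map f)).f 1 (s.el j) = s.el j' :=
  congrArg Subtype.val (s.2 f)

/-- A family of compatible elements. -/
def Fam.mk {L : DGLA k} (ω : ∀ j, Tot.X L (D.obj j).maxIdeal 1) (h : ∀ j, Tot.curv (ω j) = 0)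
    (hω : ∀ {j j' : J} (f : j ⟶ j'),
      Tot.mapLin (DGLA.Hom.f (𝟙 L)) (DgArt.mapIdeal (D.map f)).f 1 (ω j) = ω j') : Fam D L :=
  ⟨fun j => (⟨ω j, h j⟩ : (Tot.dgla L (D.obj j).maxIdeal).MC), fun f => Subtype.ext (hω f)⟩

variable {D} in
theorem Fam.ext {L : DGLA k} {s t : Fam D L} (h : ∀ j, s.el j = t.el j) : s = t :=
  Subtype.ext (funext fun j => Subtype.ext (h j))

variable {D} in
/-- The functoriality of compatible families. -/
def Fam.map {L L' : DGLA k} (F : L ⟶ L') (s : Fam D L) : Fam D L' :=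
  (((Functor.whiskeringLeft _ _ _).obj D ⋙ Functor.sectionsFunctor J).map ((mcArt k).map F)) s

variable {D} in
theorem Fam.map_el {L L' : DGLA k} (F : L ⟶ L') (s : Fam D L) (j : J) :
    (s.map F).el j =
      Tot.mapLin F.f (NCdga.Hom.f (𝟙 (D.obj j).maxIdeal)) 1 (s.el j) := rfl

/-- Lie words in the generators, of a given degree. -/
inductive Term : ℤ → Type u
  | gen {a n : ℤ} (j : J) (h : n - a = 1) (φ : Module.Dual k ((D.obj j).maxIdeal.X a)) : Term n
  | zero {n : ℤ} : Term n
  | add {n : ℤ} (s t : Term n) : Term n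
  | smul {n : ℤ} (c : k) (t : Term n) : Term n
  | br {i j n : ℤ} (h : i + j = n) (s : Term i) (t : Term j) : Term n
  | d {i j : ℤ} (h : i + 1 = j) (t : Term i) : Term j

variable {D} in
/-- The evaluation of Lie words. -/
def eval {L : DGLA k} (s : Fam D L) : ∀ {n : ℤ}, Term D n → L.X n
  | _, .gen j h φ => Tot.contr h φ (s.el j)
  | _, .zero => 0
  | _, .add t t' => eval s t + eval s t'
  | _, .smul c t => c • eval s t
  | _, .br h t t' => L.br h (eval s t) (eval s t')
  | _, .d h t => L.d h (eval s t)

/-- The index of the product. -/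
abbrev Idx : Type (u + 1) := Σ L : DGLA k, Fam D L

/-- The values of Lie words. -/
def W (n : ℤ) : Submodule k (∀ z : Idx D, z.1.X n) where
  carrier := Set.range fun (t : Term D n) z => eval z.2 t
  zero_mem' := ⟨.zero, rfl⟩
  add_mem' := by
    rintro _ _ ⟨s, rfl⟩ ⟨t, rfl⟩
    exact ⟨.add s t, rfl⟩
  smul_mem' := by
    rintro c _ ⟨t, rfl⟩
    exact ⟨.smul c t, rfl⟩

instance (n : ℤ) : Small.{u} (W D n) :=
  inferInstanceAs (Small.{u} (Set.range fun (t : Term D n) (z : Idx D) => eval z.2 t))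

/-- The degree `n` part. -/
abbrev V (n : ℤ) : Type u := Shrink.{u} (W D n)

/-- The components of an element. -/
def val {n : ℤ} : V D n →ₗ[k] ∀ z : Idx D, z.1.X n :=
  (W D n).subtype ∘ₗ (Shrink.linearEquiv k (W D n)).toLinearMap

variable {D} in
theorem val_inj {n : ℤ} {x y : V D n} (h : ∀ z, val D x z = val D y z) : x = y :=
  (Shrink.linearEquiv k (W D n)).injective (Subtype.ext (funext h))

theorem val_mem {n : ℤ} (x : V D n) : val D x ∈ W D n := (Shrink.linearEquiv k (W D n) x).2

variable {D} in
/-- The element with given components. -/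
def mk {n : ℤ} (w : ∀ z : Idx D, z.1.X n) (h : w ∈ W D n) : V D n :=
  (Shrink.linearEquiv k (W D n)).symm ⟨w, h⟩

variable {D} in
@[simp] theorem val_mk {n : ℤ} (w : ∀ z : Idx D, z.1.X n) (h : w ∈ W D n) (z : Idx D) :
    val D (mk w h) z = w z := by
  simp [val, mk]

theorem d_mem {i j : ℤ} (h : i + 1 = j) {w : ∀ z : Idx D, z.1.X i} (hw : w ∈ W D i) :
    (fun z : Idx D => z.1.d h (w z)) ∈ W D j := by
  obtain ⟨t, rfl⟩ := hw
  exact ⟨.d h t, rfl⟩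

theorem br_mem {i j n : ℤ} (h : i + j = n) {w : ∀ z : Idx D, z.1.X i} (hw : w ∈ W D i)
    {w' : ∀ z : Idx D, z.1.X j} (hw' : w' ∈ W D j) :
    (fun z : Idx D => z.1.br h (w z) (w' z)) ∈ W D n := by
  obtain ⟨t, rfl⟩ := hw
  obtain ⟨t', rfl⟩ := hw'
  exact ⟨.br h t t', rfl⟩

/-- The differential. -/
def d {i j : ℤ} (h : i + 1 = j) : V D i →ₗ[k] V D j where
  toFun x := mk _ (d_mem D h (val_mem D x))
  map_add' x y := val_inj fun z => by simp
  map_smul' c x := val_inj fun z => by simp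

/-- The bracket. -/
def br {i j n : ℤ} (h : i + j = n) : V D i →ₗ[k] V D j →ₗ[k] V D n :=
  LinearMap.mk₂ k (fun x y => mk _ (br_mem D h (val_mem D x) (val_mem D y)))
    (fun x x' y => val_inj fun z => by simp) (fun c x y => val_inj fun z => by simp)
    (fun x y y' => val_inj fun z => by simp) (fun c x y => val_inj fun z => by simp)

@[simp] theorem val_d {i j : ℤ} (h : i + 1 = j) (x : V D i) (z : Idx D) :
    val D (d D h x) z = z.1.d h (val D x z) := val_mk _ _ z

@[simp] theorem val_br {i j n : ℤ} (h : i + j = n) (x : V D i) (y : V D j) (z : Idx D) :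
    val D (br D h x y) z = z.1.br h (val D x z) (val D y z) := val_mk _ _ z

/-- The DGLA of Lie words modulo relations. -/
def dgla : DGLA k where
  X := V D
  d := d D
  br := br D
  d_d h h' x := val_inj fun z => by simp [z.1.d_d]
  br_symm h h' x y := val_inj fun z => by simp [z.1.br_symm h h']
  jacobi ha h₁ hb h₂ hc h₃ x y w := val_inj fun z => by simp [z.1.jacobi ha h₁ hb h₂ hc h₃]
  d_br h hn hi hj h₁ h₂ x y := val_inj fun z => by simp [z.1.d_br h hn hi hj h₁ h₂]

variable {D} in
/-- The morphism determined by a compatible family of Maurer-Cartan elements. -/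
def proj {L : DGLA k} (s : Fam D L) : dgla D ⟶ L where
  f _ := LinearMap.proj (⟨L, s⟩ : Idx D) ∘ₗ val D
  map_d h x := val_d D h x ⟨L, s⟩
  map_br h x y := val_br D h x y ⟨L, s⟩

/-- The element defined by a Lie word. -/
def word {n : ℤ} (t : Term D n) : V D n := mk (fun z => eval z.2 t) ⟨t, rfl⟩

theorem val_word {n : ℤ} (t : Term D n) (z : Idx D) : val D (word D t) z = eval z.2 t :=
  val_mk _ _ z

theorem exists_word {n : ℤ} (x : V D n) : ∃ t, x = word D t := by
  obtain ⟨t, ht⟩ := val_mem D x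
  exact ⟨t, val_inj fun z => (congrFun ht z).symm.trans (val_word D t z).symm⟩

/-- The generators. -/
def genMap (j : J) {p i : ℤ} (h : p - i = 1) :
    Module.Dual k ((D.obj j).maxIdeal.X i) →ₗ[k] V D p where
  toFun φ := word D (.gen j h φ)
  map_add' φ ψ := val_inj fun z => by
    rw [map_add, Pi.add_apply, val_word, val_word, val_word]
    simp [eval, Tot.contr, LinearMap.lTensor_add]
  map_smul' c φ := val_inj fun z => by
    rw [map_smul, Pi.smul_apply, val_word, val_word]
    simp [eval, Tot.contr, LinearMap.lTensor_smul]

theorem exists_univ (j : J) : ∃ x : Tot.X (dgla D) (D.obj j).maxIdeal 1,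
    ∀ (p i : ℤ) (h : p - i = 1) (φ : Module.Dual k ((D.obj j).maxIdeal.X i)),
      Tot.contr h φ x = word D (.gen j h φ) := by
  have hb : {i : ℤ | ∃ x : (D.obj j).maxIdeal.X i, x ≠ 0}.Finite :=
    (D.obj j).bdd.subset fun i hi hbot => by
      obtain ⟨x, hx⟩ := hi
      exact hx (Subtype.ext ((Submodule.eq_bot_iff _).mp hbot x.1 x.2))
  exact Tot.exists_contr_eq (L := dgla D) (D.obj j).fin hb 1 fun p i h => genMap D j h

/-- The universal element. -/
def el (j : J) : Tot.X (dgla D) (D.obj j).maxIdeal 1 := (exists_univ D j).choose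

theorem contr_el (j : J) {p i : ℤ} (h : p - i = 1)
    (φ : Module.Dual k ((D.obj j).maxIdeal.X i)) :
    Tot.contr h φ (el D j) = word D (.gen j h φ) := (exists_univ D j).choose_spec p i h φ

theorem proj_el {L : DGLA k} (s : Fam D L) (j : J) :
    Tot.mapLin (proj s).f (NCdga.Hom.f (𝟙 (D.obj j).maxIdeal)) 1 (el D j) = s.el j :=
  Tot.contr_ext fun h φ => by
    rw [Tot.contr_mapLin, contr_el]
    exact val_mk _ _ (⟨L, s⟩ : Idx D)

/-- Elements of `Tot` are determined by their images in all the factors. -/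
theorem ext_proj {M : NCdga k} {n : ℤ} {x y : Tot.X (dgla D) M n}
    (h : ∀ (L : DGLA k) (s : Fam D L), Tot.mapLin (proj s).f (NCdga.Hom.f (𝟙 M)) n x =
      Tot.mapLin (proj s).f (NCdga.Hom.f (𝟙 M)) n y) : x = y :=
  Tot.contr_ext fun hp φ => val_inj fun z => by
    have := congrArg (Tot.contr hp φ) (h z.1 z.2)
    rw [Tot.contr_mapLin, Tot.contr_mapLin] at this
    exact this

/-- The universal compatible family. -/
def univ : Fam D (dgla D) :=
  Fam.mk D (el D)
    (fun j => ext_proj D fun L s => by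
      rw [Tot.map_curv, proj_el, map_zero, s.el_mc])
    (fun {j j'} f => ext_proj D fun L s => by
      rw [proj_el, Tot.mapLin_comp, ← s.el_map f, ← proj_el, Tot.mapLin_comp]
      rfl)

theorem map_word {L : DGLA k} (F : dgla D ⟶ L) {n : ℤ} (t : Term D n) :
    F.f n (word D t) = eval ((univ D).map F) t := by
  induction t with
  | @gen a n j h φ =>
    have h₁ : F.f n (word D (.gen j h φ)) = F.f n (Tot.contr h φ (el D j)) :=
      congrArg (F.f n) (contr_el D j h φ).symm
    rw [h₁, eval, Fam.map_el]
    exact (Tot.contr_mapLin h φ F.f (NCdga.Hom.f (𝟙 (D.obj j).maxIdeal)) (el D j)).symm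
  | @zero n =>
    have : word D (.zero : Term D n) = 0 := val_inj fun z => by simp [val_word, eval]
    rw [this]
    exact map_zero _
  | @add n s t hs ht =>
    have : word D (.add s t) = word D s + word D t := val_inj fun z => by simp [val_word, eval]
    rw [this, eval, ← hs, ← ht]
    exact map_add _ _ _
  | @smul n c t ht =>
    have : word D (.smul c t) = c • word D t := val_inj fun z => by simp [val_word, eval]
    rw [this, eval, ← ht]
    exact map_smul _ _ _
  | @br i j n h s t hs ht =>
    have : word D (.br h s t) = br D h (word D s) (word D t) :=
      val_inj fun z => by simp [val_word, eval]
    rw [this, eval, ← hs, ← ht]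
    exact F.map_br h _ _
  | @d i j h t ht =>
    have : word D (.d h t) = d D h (word D t) := val_inj fun z => by simp [val_word, eval]
    rw [this, eval, ← ht]
    exact F.map_d h _

/-- The universal property. -/
def homEquiv (L : DGLA k) : (dgla D ⟶ L) ≃ Fam D L where
  toFun F := (univ D).map F
  invFun s := proj s
  left_inv F := DGLA.hom_ext fun n x => by
    obtain ⟨t, rfl⟩ := exists_word D x
    exact (val_word D t (⟨L, (univ D).map F⟩ : Idx D)).trans (map_word D F t).symm
  right_inv s := Fam.ext fun j => proj_el D s j

theorem homEquiv_comp {L L' : DGLA k} (F : dgla D ⟶ L) (G : L ⟶ L') :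
    homEquiv D L' (F ≫ G) = (homEquiv D L F).map G :=
  Fam.ext fun j => by
    change ((univ D).map (F ≫ G)).el j = (((univ D).map F).map G).el j
    rw [Fam.map_el, Fam.map_el, Fam.map_el, Tot.mapLin_comp]
    rfl

end Cobar

end leftadjoint

/-! ### The functors `β` and `β*` -/

section beta

variable (k : Type u) [Field k]

/-- The functor that sends `L` to the ind-object of `(dgArt k)ᵒᵖ` given by `mc(L,-)`. -/
def betaInd : DGLA k ⥤ Ind (DgArt k)ᵒᵖ :=
  ObjectProperty.lift _ (mcArt k ⋙ (Functor.whiskeringLeft _ _ _).obj (unopUnop (DgArt k)))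
    isIndObject_mc ⋙ (Ind.equivalence (DgArt k)ᵒᵖ).inverse

/-- The defining property of `betaInd`. -/
def betaIndIso : betaInd k ⋙ Ind.inclusion (DgArt k)ᵒᵖ ≅
    mcArt k ⋙ (Functor.whiskeringLeft _ _ _).obj (unopUnop (DgArt k)) :=
  Functor.isoWhiskerLeft (ObjectProperty.lift _ _ _)
    (Functor.isoWhiskerRight (Ind.equivalence _).counitIso (ObjectProperty.ι _))

/-- The functor `β`, for which `β(L)` pro-represents the functor `mc(L,-)`; see `proRep`. -/
def beta : DGLA k ⥤ (ProDgArt k)ᵒᵖ := betaInd k ⋙ opOp _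

variable {k}

/-- The ind-object `betaInd k` at `L` is `mc(L,-)`. -/
def betaIndIsoApp (L : DGLA k) : (Ind.inclusion (DgArt k)ᵒᵖ).obj ((betaInd k).obj L) ≅
    unopUnop (DgArt k) ⋙ (mcArt k).obj L := (betaIndIso k).app L

theorem betaIndIsoApp_naturality {L L' : DGLA k} (F : L ⟶ L') :
    (Ind.inclusion (DgArt k)ᵒᵖ).map ((betaInd k).map F) ≫ (betaIndIsoApp L').hom =
      (betaIndIsoApp L).hom ≫ Functor.whiskerLeft (unopUnop (DgArt k)) ((mcArt k).map F) :=
  (betaIndIso k).hom.naturality F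

/-- `β(L)` pro-represents `mc(L,-)`: the set of morphisms from `β(L)` to a pro-object `A` is
`mc(L,A)`. -/
def proRep (L : DGLA k) (A : ProDgArt k) :
    (((beta k).obj L).unop ⟶ A) ≃ A.eval ((mcArt k).obj L) :=
  (opEquiv (op ((betaInd k).obj L)) A).trans
    ((Ind.inclusion.fullyFaithful (C := (DgArt k)ᵒᵖ)).homEquiv.trans (betaIndIsoApp L).homToEquiv)

theorem proRep_apply (L : DGLA k) (A : ProDgArt k) (g : ((beta k).obj L).unop ⟶ A) :
    proRep L A g = (Ind.inclusion _).map g.unop ≫ (betaIndIsoApp L).hom := rfl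

theorem proRep_naturality_left {L L' : DGLA k} (F : L ⟶ L') (A : ProDgArt k)
    (g : ((beta k).obj L).unop ⟶ A) :
    proRep L' A (((beta k).map F).unop ≫ g) =
      proRep L A g ≫ Functor.whiskerLeft (unopUnop (DgArt k)) ((mcArt k).map F) := by
  have h : (((beta k).map F).unop ≫ g).unop = g.unop ≫ (betaInd k).map F := rfl
  refine (proRep_apply _ _ _).trans (Eq.trans ?_
    (congrArg (· ≫ Functor.whiskerLeft _ _) (proRep_apply _ _ _).symm))
  refine (congrArg (fun z => (Ind.inclusion _).map z ≫ (betaIndIsoApp L').hom) h).trans ?_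
  refine (congrArg (· ≫ (betaIndIsoApp L').hom) (Functor.map_comp _ _ _)).trans ?_
  exact (Category.assoc _ _ _).trans ((congrArg (_ ≫ ·) (betaIndIsoApp_naturality F)).trans
    (Category.assoc _ _ _).symm)

theorem proRep_naturality_right (L : DGLA k) {A B : ProDgArt k} (f : A ⟶ B)
    (g : ((beta k).obj L).unop ⟶ A) :
    proRep L B (g ≫ f) = (Ind.inclusion _).map f.unop ≫ proRep L A g :=
  (congrArg (· ≫ (betaIndIsoApp L).hom) (Functor.map_comp _ f.unop g.unop)).trans
    (Category.assoc _ _ _)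

/-- The diagram of local Artinian cdgas of a chosen presentation `A = {A_α}` of a pro-object. -/
abbrev ProDgArt.diagram (A : ProDgArt k) : (Ind.presentation A.unop).Iᵒᵖ ⥤ DgArt k :=
  (Ind.presentation A.unop).F.leftOp

/-- The value of `β*` on objects. -/
def betaStarObj (A : ProDgArt k) : DGLA k := Cobar.dgla A.diagram

/-- `Hom (β*A, L) = mc(L,A)`. -/
def betaStarObjEquiv (A : ProDgArt k) (L : DGLA k) :
    (betaStarObj A ⟶ L) ≃ A.eval ((mcArt k).obj L) :=
  (Cobar.homEquiv A.diagram L).trans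
    (ProDgArt.evalEquiv ((mcArt k).obj L) A (Ind.presentation A.unop)).symm

theorem betaStarObjEquiv_naturality (A : ProDgArt k) {L L' : DGLA k} (F : betaStarObj A ⟶ L)
    (G : L ⟶ L') : betaStarObjEquiv A L' (F ≫ G) =
      betaStarObjEquiv A L F ≫ Functor.whiskerLeft (unopUnop (DgArt k)) ((mcArt k).map G) := by
  refine (ProDgArt.evalEquiv ((mcArt k).obj L') A (Ind.presentation A.unop)).injective ?_
  refine (Equiv.apply_symm_apply (ProDgArt.evalEquiv ((mcArt k).obj L') A
    (Ind.presentation A.unop)) _).trans ?_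
  refine (Cobar.homEquiv_comp A.diagram F G).trans (Subtype.ext (funext fun i => ?_))
  refine Eq.trans ?_ (ProDgArt.evalEquiv_naturality ((mcArt k).map G) A
    (Ind.presentation A.unop) (betaStarObjEquiv A L F) i).symm
  have h : ProDgArt.evalEquiv ((mcArt k).obj L) A (Ind.presentation A.unop)
      (betaStarObjEquiv A L F) = Cobar.homEquiv A.diagram L F := Equiv.apply_symm_apply _ _
  rw [h]
  rfl

/-- `Hom (β*A, L) = Hom (A, β(L))`, where the right hand side is taken in the opposite of the
pro-category. -/
def betaStarEquiv (A : (ProDgArt k)ᵒᵖ) (L : DGLA k) :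
    (betaStarObj A.unop ⟶ L) ≃ (A ⟶ (beta k).obj L) :=
  (betaStarObjEquiv A.unop L).trans ((proRep L A.unop).symm.trans
    (opEquiv A ((beta k).obj L)).symm)

theorem betaStarEquiv_naturality (A : (ProDgArt k)ᵒᵖ) (L L' : DGLA k) (G : L ⟶ L')
    (F : betaStarObj A.unop ⟶ L) :
    betaStarEquiv A L' (F ≫ G) = betaStarEquiv A L F ≫ (beta k).map G := by
  refine Quiver.Hom.unop_inj ((proRep L' A.unop).injective ?_)
  rw [unop_comp, proRep_naturality_left]
  simp only [betaStarEquiv, Equiv.trans_apply, opEquiv_symm_apply, Quiver.Hom.unop_op,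
    Equiv.apply_symm_apply]
  exact betaStarObjEquiv_naturality A.unop F G

variable (k)

/-- The functor `β*`, the left adjoint of `β`. -/
def betaStar : (ProDgArt k)ᵒᵖ ⥤ DGLA k :=
  Adjunction.leftAdjointOfEquiv betaStarEquiv betaStarEquiv_naturality

/-- The adjunction between `β*` and `β`. -/
def betaAdj : betaStar k ⊣ beta k :=
  Adjunction.adjunctionOfEquivLeft betaStarEquiv betaStarEquiv_naturality

end beta

/-! ### Deformations -/

section ddef

variable {k : Type u} [Field k]

/-- Gauge equivalence on `mc(L,A)`, for a pro-object `A`: two elements of `lim_α mc(L,A_α)` are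
related if the second is the image of the first under the componentwise action of some element of
`Gg(L,A) = lim_α Gg(L,A_α)`. -/
def gaugeRel (L : DGLA k) (A : ProDgArt k) (ω ω' : A.eval ((mcArt k).obj L)) : Prop :=
  ∃ x : A.eval ((ggArt k).obj L), ∀ (B : DgArt k) (b : A.h.obj (op (op B))),
    (show (Tot.dgla L B.maxIdeal).MC from ω'.app (op (op B)) b).1 =
      DGLA.gauge (Tot.dgla L B.maxIdeal) (x.app (op (op B)) b)
        (show (Tot.dgla L B.maxIdeal).MC from ω.app (op (op B)) b).1

theorem gaugeRel_map_left {L L' : DGLA k} (F : L ⟶ L') (A : ProDgArt k)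
    {ω ω' : A.eval ((mcArt k).obj L)} (h : gaugeRel L A ω ω') :
    gaugeRel L' A (ω ≫ Functor.whiskerLeft (unopUnop (DgArt k)) ((mcArt k).map F))
      (ω' ≫ Functor.whiskerLeft (unopUnop (DgArt k)) ((mcArt k).map F)) := by
  obtain ⟨x, hx⟩ := h
  refine ⟨x ≫ Functor.whiskerLeft (unopUnop (DgArt k)) ((ggArt k).map F), fun B b => ?_⟩
  have := congrArg (DGLA.Hom.f (Tot.map F (𝟙 B.maxIdeal)) 1) (hx B b)
  exact this.trans (DGLA.Hom.map_gauge (Tot.map F (𝟙 B.maxIdeal)) _ _ (ad_isNilpotent L B _))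

theorem gaugeRel_map_right (L : DGLA k) {A A' : ProDgArt k} (f : A ⟶ A')
    {ω ω' : A.eval ((mcArt k).obj L)} (h : gaugeRel L A ω ω') :
    gaugeRel L A' ((Ind.inclusion _).map f.unop ≫ ω) ((Ind.inclusion _).map f.unop ≫ ω') := by
  obtain ⟨x, hx⟩ := h
  exact ⟨(Ind.inclusion _).map f.unop ≫ x, fun B b => hx B _⟩

variable (k)

/-- The functor `(A, L) ↦ ddef(L,A) = mc(L,A) / Gg(L,A)` of deformations over pro-objects. -/
def ddef : ProDgArt k ⥤ DGLA k ⥤ Type (u + 1) where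
  obj A :=
    { obj := fun L => Quot (gaugeRel L A)
      map := fun F => ↾Quot.map
        (fun ω => ω ≫ Functor.whiskerLeft (unopUnop (DgArt k)) ((mcArt k).map F))
        fun _ _ h => gaugeRel_map_left F A h
      map_id := fun L => by
        ext ω
        induction ω using Quot.ind
        refine congrArg (Quot.mk _) ?_
        simp
      map_comp := fun F G => by
        ext ω
        induction ω using Quot.ind
        refine congrArg (Quot.mk _) ?_
        simp }
  map f :=
    { app := fun L => ↾Quot.map (fun ω => (Ind.inclusion _).map f.unop ≫ ω)
        fun _ _ h => gaugeRel_map_right L f h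
      naturality := fun L L' F => by
        ext ω
        induction ω using Quot.ind
        refine congrArg (Quot.mk _) ?_
        simp }
  map_id A := by
    ext L ω
    induction ω using Quot.ind
    refine congrArg (Quot.mk _) ?_
    simp
  map_comp f g := by
    ext L ω
    induction ω using Quot.ind
    refine congrArg (Quot.mk _) ?_
    simp

/-- The class in `ddef(L,A)` of an element of `mc(L,A)`. -/
def ddef.mk {k : Type u} [Field k] {L : DGLA k} {A : ProDgArt k}
    (ω : A.eval ((mcArt k).obj L)) : ((ddef k).obj A).obj L := Quot.mk (gaugeRel L A) ω

end ddef

/-! ### Homotopy categories -/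

section homotopy

variable (k : Type u) [Field k]

/-- The weak equivalences of pro-objects: the morphisms that `β*` sends to quasi-isomorphisms. -/
def proWeakEq : MorphismProperty (ProDgArt k) :=
  ((DGLA.quasiIso k).inverseImage (betaStar k)).unop

/-- The homotopy category of DGLAs: the localization at the quasi-isomorphisms. -/
abbrev HoDGLA : Type (u + 1) := (DGLA.quasiIso k).Localization

/-- The homotopy category of pro-objects: the localization at the weak equivalences. -/
abbrev HoPro : Type (u + 1) := (proWeakEq k).Localization

/-- The functor `(A, L) ↦ Hom (β*A, L)`, with morphisms in the homotopy category of DGLAs. -/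
def homHoDGLA : ProDgArt k ⥤ DGLA k ⥤ Type (u + 1) :=
  opOp _ ⋙ (betaStar k ⋙ (DGLA.quasiIso k).Q).op ⋙ coyoneda ⋙
    (Functor.whiskeringLeft _ _ _).obj (DGLA.quasiIso k).Q

/-- The functor `(A, L) ↦ Hom (β(L), A)`, with morphisms in the homotopy category of pro-objects. -/
def homHoPro : ProDgArt k ⥤ DGLA k ⥤ Type (u + 1) :=
  (beta k ⋙ (proWeakEq k).Q.op ⋙ coyoneda ⋙
    (Functor.whiskeringLeft _ _ _).obj (proWeakEq k).Q).flip

end homotopy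

end

end Koszul

open Koszul

/-!
Both isomorphisms come from the same principle, `bijective_of_isInvertedBy`. Let `D` be a
set-valued functor that inverts the weak equivalences, and suppose that every element of `D(Y)` is
the image of one element `x` of `D(c)` under some morphism `c ⟶ Y`. If sending such an element to
the class of the morphism in the localization is well defined and natural, then it is a bijection
of `D(Y)` with the morphisms `c ⟶ Y` in the localization: by the universal property of the
localization the map has an inverse, namely `g ↦ D(g)(x)`. Here `D` is `ddef`, as a functor of `L`
for the first isomorphism and of `A` for the second; the generating element is the universal
Maurer-Cartan element, since `mc` is represented by `β*A` and pro-represented by `β(L)`. What has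
to be shown is that `ddef` inverts the weak equivalences in both variables, and that gauge
equivalent Maurer-Cartan elements give the same morphism in either homotopy category.

*Invariance in `L`* (`quasiIso_isInvertedBy_ddef`). A surjective quasi-isomorphism of DGLAs over a
field has a linear section and a linear contraction of its kernel (`DGLA.exists_splitting`). They
induce the same on `Tot (L ⊗ 𝔪(A))`, compatibly with the filtration by the powers of `𝔪(A)`, so
that Maurer-Cartan elements can be lifted, and lifts of the same element can be related by a gauge
transformation, by a successive approximation in which each step gains one degree of the
filtration (`DGLA.liftFix_isMC`, `DGLA.gauge_gaugeFix`). Since these constructions only involve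
the chosen linear maps, they are natural in `A` and pass to the limit over a pro-object; no `lim¹`
intervenes. An arbitrary quasi-isomorphism is reduced to a surjective one by its mapping path
object, which is built from the polynomial path object `L[t, dt]`.

*Gauge equivalence and paths.* If `ω' = e^x ⋆ ω`, then `e^{tx} ⋆ ω` is a Maurer-Cartan element
with coefficients in `L[t, dt]` that is `ω` at `t = 0` and `ω'` at `t = 1`. Both evaluations `L[t,
dt] ⟶ L` are inverse to the inclusion of the constants in the homotopy category, so the morphisms
`β*A ⟶ L` attached to `ω` and `ω'` agree there. This gives the first isomorphism, `ddefToHoDGLA`.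

*The second variable.* Quasi-isomorphisms of DGLAs are detected by cohomology, hence are exactly
the morphisms that become invertible in the homotopy category. With the first isomorphism it
follows that a morphism of pro-objects is a weak equivalence if and only if it induces a bijection
on `ddef` (`proWeakEq_iff`). It remains to find path objects. The cdga `B[t, dt]` is not Artinian,
but it contains the Rees algebra of the forms `f + g dt` for which the coefficient of `tⁱ` lies in
`𝔪(B)ⁱ` for `f` and in `𝔪(B)ⁱ⁺¹` for `g`. It is stable under the differential and under
integration, its augmentation ideal is nilpotent and finite-dimensional, and it contains the forms
`b t` with `b` in `𝔪(B)`. So this cylinder `DgArt.cyl` carries the families `e^{tx} ⋆ ω`, and, by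
the contraction given by integration, evaluation at `0` induces a bijection on `ddef`. The
cylinder functor is extended to pro-objects termwise (`Prolongation`), and the second isomorphism,
`ddefToHoPro`, follows as the first one did.
-/

namespace Koszul

noncomputable section

/-! ### Gauge transformations in filtered nilpotent DGLAs -/

namespace DGLA

variable {k : Type u} [Field k]

/-- A finite decreasing filtration of a DGLA `T` by subcomplexes, starting with `T`, for which the
bracket with any element of `T` raises the filtration degree. -/
structure Filt (T : DGLA k) where
  F : ℕ → ∀ n, Submodule k (T.X n)
  top : ∀ {n} (x : T.X n), x ∈ F 0 n
  le : ∀ {r n} {x : T.X n}, x ∈ F (r + 1) n → x ∈ F r n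
  d_mem : ∀ {i j r} (h : i + 1 = j) {x : T.X i}, x ∈ F r i → T.d h x ∈ F r j
  br_mem : ∀ {i j n r} (h : i + j = n) (x : T.X i) {y : T.X j},
    y ∈ F r j → T.br h x y ∈ F (r + 1) n
  bot : ∃ r, ∀ n (x : T.X n), x ∈ F r n → x = 0

/-- The curvature `dω + ½[ω,ω]`. -/
def curv (T : DGLA k) (ω : T.X 1) : T.X 2 :=
  T.d (show (1 : ℤ) + 1 = 2 by norm_num) ω
    + (2 : k)⁻¹ • T.br (show (1 : ℤ) + 1 = 2 by norm_num) ω ω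

theorem Hom.map_curv {T T' : DGLA k} (p : Hom T T') (ω : T.X 1) :
    p.f 2 (T.curv ω) = T'.curv (p.f 1 ω) := by
  simp [curv, p.map_d, p.map_br]

/-- The bracket is symmetric on elements of degree one. -/
theorem br_comm_one (T : DGLA k) (h : (1 : ℤ) + 1 = 2) (x y : T.X 1) :
    T.br h x y = T.br h y x := by
  rw [T.br_symm h h x y]
  simp [sgn_one]

namespace Filt

variable {T : DGLA k} (Φ : Filt T)

theorem br_mem' {i j n : ℤ} {r : ℕ} (h : i + j = n) {x : T.X i} (y : T.X j)
    (hx : x ∈ Φ.F r i) : T.br h x y ∈ Φ.F (r + 1) n := by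
  rw [T.br_symm h (by omega) x y]
  exact neg_mem (Submodule.smul_mem _ _ (Φ.br_mem _ y hx))

theorem le_of_le {r s n} (h : r ≤ s) {x : T.X n} (hx : x ∈ Φ.F s n) : x ∈ Φ.F r n := by
  induction s, h using Nat.le_induction with
  | base => exact hx
  | succ s hs ih => exact ih (Φ.le hx)

theorem ad_pow_mem (x : T.X 0) (y : T.X 1) (n : ℕ) : (T.ad x ^ n) y ∈ Φ.F n 1 := by
  induction n with
  | zero => exact Φ.top _
  | succ n ih =>
    rw [pow_succ', Module.End.mul_apply]
    exact Φ.br_mem _ x ih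

theorem ad_isNilpotent {T : DGLA k} (Φ : Filt T) (x : T.X 0) : IsNilpotent (T.ad x) := by
  obtain ⟨r, hr⟩ := Φ.bot
  exact ⟨r, LinearMap.ext fun y => hr 1 _ (Φ.ad_pow_mem x y r)⟩

end Filt

section gauge

variable (T : DGLA k)

/-- The coefficient of `tⁿ` in `e^{tx} ⋆ ω`. -/
def gaugeCoeff (x : T.X 0) (ω : T.X 1) : ℕ → T.X 1
  | 0 => ω
  | n + 1 => (Nat.factorial (n + 1) : k)⁻¹ •
      (T.ad x ^ n) (T.br (zero_add 1) x ω - T.d (zero_add 1) x)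

variable {T}

theorem gaugeCoeff_eq_zero {x : T.X 0} {r : ℕ} (hr : T.ad x ^ r = 0) (ω : T.X 1) {n : ℕ}
    (hn : r < n) : T.gaugeCoeff x ω n = 0 := by
  obtain ⟨m, rfl⟩ : ∃ m, n = m + 1 := ⟨n - 1, by omega⟩
  simp [gaugeCoeff, pow_eq_zero_of_le (Nat.lt_succ_iff.mp hn) hr]

theorem gauge_eq_sum {x : T.X 0} {r : ℕ} (hr : T.ad x ^ r = 0) (ω : T.X 1) :
    T.gauge x ω = ∑ n ∈ Finset.range (r + 1), T.gaugeCoeff x ω n := by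
  rw [Finset.sum_range_succ', gauge, add_comm]
  congr 1
  refine finsum_eq_sum_of_support_subset _ fun n hn => ?_
  by_contra h
  have hle : r ≤ n := by simpa using h
  exact hn (by simp [pow_eq_zero_of_le hle hr])

theorem gauge_zero (ω : T.X 1) : T.gauge 0 ω = ω := by
  have h : T.ad (0 : T.X 0) = 0 := by simp [ad]
  rw [gauge_eq_sum (r := 1) (by simp [h])]
  simp [Finset.sum_range_succ, gaugeCoeff]

variable [CharZero k]

/-- The differential equation for `e^{tx} ⋆ ω`, read off on coefficients. -/
theorem gaugeCoeff_succ (x : T.X 0) (ω : T.X 1) (n : ℕ) :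
    ((n + 1 : ℕ) : k) • T.gaugeCoeff x ω (n + 1) =
      T.br (zero_add 1) x (T.gaugeCoeff x ω n) - if n = 0 then T.d (zero_add 1) x else 0 := by
  have hn : ((n + 1 : ℕ) : k) ≠ 0 := Nat.cast_ne_zero.mpr n.succ_ne_zero
  rcases n with _ | n
  · simp [gaugeCoeff]
  · simp only [gaugeCoeff, Nat.succ_ne_zero, if_false, sub_zero]
    rw [Nat.factorial_succ (n + 1), Nat.cast_mul, mul_inv, smul_smul, mul_inv_cancel_left₀ hn,
      pow_succ', Module.End.mul_apply, map_smul]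
    rfl

/-- The coefficient of `tⁿ` in the curvature of `e^{tx} ⋆ ω`. -/
def curvCoeff (x : T.X 0) (ω : T.X 1) (n : ℕ) : T.X 2 :=
  T.d (show (1 : ℤ) + 1 = 2 by norm_num) (T.gaugeCoeff x ω n) + (2 : k)⁻¹ •
    ∑ p ∈ Finset.HasAntidiagonal.antidiagonal n, T.br (show (1 : ℤ) + 1 = 2 by norm_num)
      (T.gaugeCoeff x ω p.1) (T.gaugeCoeff x ω p.2)

/-- The curvature `R` of `e^{tx} ⋆ ω` satisfies the linear differential equation `R' = [x, R]`,
read off on coefficients. -/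
theorem curvCoeff_succ (x : T.X 0) (ω : T.X 1) (n : ℕ) :
    ((n + 1 : ℕ) : k) • curvCoeff x ω (n + 1) = T.br (zero_add 2) x (curvCoeff x ω n) := by
  have h2 : (1 : ℤ) + 1 = 2 := by norm_num
  set γ := T.gaugeCoeff x ω with hγ
  set dx := T.d (zero_add 1) x
  let B : T.X 1 → T.X 1 → T.X 2 := fun a b => T.br h2 a b
  have hrec := gaugeCoeff_succ x ω
  rw [← hγ] at hrec
  -- differentiating the left, respectively the right, factor of the quadratic term
  have hL : ∑ p ∈ Finset.HasAntidiagonal.antidiagonal (n + 1), (p.1 : k) • B (γ p.1) (γ p.2) =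
      ∑ p ∈ Finset.HasAntidiagonal.antidiagonal n, B (T.br (zero_add 1) x (γ p.1)) (γ p.2) -
        B dx (γ n) := by
    rw [Finset.Nat.sum_antidiagonal_succ]
    have : ∀ p : ℕ × ℕ, ((p.1 + 1 : ℕ) : k) • B (γ (p.1 + 1)) (γ p.2) =
        B (T.br (zero_add 1) x (γ p.1)) (γ p.2) - if p.1 = 0 then B dx (γ p.2) else 0 := by
      intro p
      have := congrArg (fun z => B z (γ p.2)) (hrec p.1)
      simp only [B, map_smul, LinearMap.smul_apply, map_sub, LinearMap.sub_apply] at this ⊢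
      rw [this]
      split_ifs <;> simp [dx]
    simp only [this, Finset.sum_sub_distrib]
    rw [← Finset.sum_filter]
    have : (Finset.HasAntidiagonal.antidiagonal n).filter (fun p : ℕ × ℕ => p.1 = 0) =
        {(0, n)} := by
      ext ⟨a, b⟩
      simp
      omega
    simp [this]
  have hR : ∑ p ∈ Finset.HasAntidiagonal.antidiagonal (n + 1), (p.2 : k) • B (γ p.1) (γ p.2) =
      ∑ p ∈ Finset.HasAntidiagonal.antidiagonal n, B (γ p.1) (T.br (zero_add 1) x (γ p.2)) -
        B dx (γ n) := by
    have hB : ∀ a b, B a b = B b a := T.br_comm_one h2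
    rw [← Finset.Nat.sum_antidiagonal_swap]
    simp only [Prod.fst_swap, Prod.snd_swap]
    rw [← Finset.Nat.sum_antidiagonal_swap (n := n)]
    simp only [Prod.fst_swap, Prod.snd_swap]
    rw [Finset.sum_congr rfl fun p _ => congrArg ((p.1 : k) • ·) (hB (γ p.2) (γ p.1)), hL]
    congr 1
    exact Finset.sum_congr rfl fun p _ => hB _ _
  have hsum : ((n + 1 : ℕ) : k) •
        ∑ p ∈ Finset.HasAntidiagonal.antidiagonal (n + 1), B (γ p.1) (γ p.2) =
      ∑ p ∈ Finset.HasAntidiagonal.antidiagonal n, T.br (zero_add 2) x (B (γ p.1) (γ p.2))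
        - (2 : k) • B dx (γ n) := by
    have h1 : ((n + 1 : ℕ) : k) •
          ∑ p ∈ Finset.HasAntidiagonal.antidiagonal (n + 1), B (γ p.1) (γ p.2) =
        ∑ p ∈ Finset.HasAntidiagonal.antidiagonal (n + 1), (p.1 : k) • B (γ p.1) (γ p.2) +
        ∑ p ∈ Finset.HasAntidiagonal.antidiagonal (n + 1), (p.2 : k) • B (γ p.1) (γ p.2) := by
      rw [Finset.smul_sum, ← Finset.sum_add_distrib]
      refine Finset.sum_congr rfl fun p hp => ?_
      rw [← add_smul, ← Nat.cast_add, Finset.HasAntidiagonal.mem_antidiagonal.mp hp]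
    have hJ : ∀ p : ℕ × ℕ, T.br (zero_add 2) x (B (γ p.1) (γ p.2)) =
        B (T.br (zero_add 1) x (γ p.1)) (γ p.2) + B (γ p.1) (T.br (zero_add 1) x (γ p.2)) := by
      intro p
      have := T.jacobi h2 (zero_add 2) (zero_add 1) h2 (zero_add 1) h2 x (γ p.1) (γ p.2)
      rw [zero_mul, sgn_zero, one_smul] at this
      exact this
    rw [h1, hL, hR]
    simp only [hJ, Finset.sum_add_distrib]
    module
  have hd : ((n + 1 : ℕ) : k) • T.d h2 (γ (n + 1)) =
      B dx (γ n) + T.br (zero_add 2) x (T.d h2 (γ n)) := by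
    rw [← map_smul, hrec, map_sub, T.d_br (zero_add 1) h2 (zero_add 1) h2 h2 (zero_add 2),
      sgn_zero, one_smul]
    split_ifs <;> simp [T.d_d, B, dx]
  change ((n + 1 : ℕ) : k) • (T.d h2 (γ (n + 1)) + (2 : k)⁻¹ •
    ∑ p ∈ Finset.HasAntidiagonal.antidiagonal (n + 1), B (γ p.1) (γ p.2)) = T.br (zero_add 2) x
    (T.d h2 (γ n) + (2 : k)⁻¹ • ∑ p ∈ Finset.HasAntidiagonal.antidiagonal n, B (γ p.1) (γ p.2))
  rw [smul_add, hd, smul_comm, hsum, map_add, map_smul, map_sum, smul_sub, smul_smul,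
    inv_mul_cancel₀ two_ne_zero, one_smul]
  abel

theorem curvCoeff_eq_zero (x : T.X 0) {ω : T.X 1} (hω : T.IsMC ω) (n : ℕ) :
    curvCoeff x ω n = 0 := by
  induction n with
  | zero =>
    rw [curvCoeff, Finset.HasAntidiagonal.antidiagonal_zero, Finset.sum_singleton]
    exact hω
  | succ n ih =>
    have h := curvCoeff_succ x ω n
    rw [ih, map_zero] at h
    exact (smul_eq_zero.mp h).resolve_left (Nat.cast_ne_zero.mpr n.succ_ne_zero)

/-- Gauge transformations preserve the Maurer-Cartan equation. -/
theorem gauge_isMC {x : T.X 0} (hx : IsNilpotent (T.ad x)) {ω : T.X 1} (hω : T.IsMC ω) :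
    T.IsMC (T.gauge x ω) := by
  obtain ⟨r, hr⟩ := hx
  have h2 : (1 : ℤ) + 1 = 2 := by norm_num
  set γ := T.gaugeCoeff x ω with hγ
  have h0 : ∀ n, r < n → γ n = 0 := fun n hn => gaugeCoeff_eq_zero hr ω hn
  have hsq : ∑ n ∈ Finset.range (2 * (r + 1)), ∑ p ∈ Finset.HasAntidiagonal.antidiagonal n,
      T.br h2 (γ p.1) (γ p.2) = T.br h2 (∑ n ∈ Finset.range (r + 1), γ n)
        (∑ n ∈ Finset.range (r + 1), γ n) := by
    simp only [map_sum, LinearMap.sum_apply]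
    rw [Finset.sum_comm, ← Finset.sum_product', ← Finset.sum_fiberwise_of_maps_to
      (s := Finset.range (r + 1) ×ˢ Finset.range (r + 1)) (t := Finset.range (2 * (r + 1)))
      (g := fun p => p.1 + p.2) (fun p hp => by
        simp only [Finset.mem_product, Finset.mem_range] at hp ⊢
        omega)]
    refine Finset.sum_congr rfl fun n _ => (Finset.sum_subset (fun p hp => ?_) ?_).symm
    · simpa using (Finset.mem_filter.mp hp).2
    · intro p hp hp'
      simp only [Finset.mem_filter, Finset.mem_product, Finset.mem_range, not_and] at hp'
      rcases Nat.lt_or_ge r p.1 with h | h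
      · simp [h0 _ h]
      · rcases Nat.lt_or_ge r p.2 with h' | h'
        · simp [h0 _ h']
        · exact absurd (Finset.HasAntidiagonal.mem_antidiagonal.mp hp) (hp' ⟨by omega, by omega⟩)
  have hlin : ∑ n ∈ Finset.range (2 * (r + 1)), γ n = ∑ n ∈ Finset.range (r + 1), γ n := by
    refine (Finset.sum_subset (Finset.range_subset_range.mpr (by omega)) fun n _ hn => ?_).symm
    exact h0 n (by simpa using hn)
  have hc := Finset.sum_eq_zero fun n (_ : n ∈ Finset.range (2 * (r + 1))) =>
    curvCoeff_eq_zero x hω n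
  unfold curvCoeff at hc
  rw [Finset.sum_add_distrib, ← Finset.smul_sum, ← map_sum, hsq, hlin] at hc
  rw [IsMC, gauge_eq_sum hr]
  exact hc

end gauge

section estimates

variable {T : DGLA k}

/-- To first order, changing `x` by `y` changes `e^x ⋆ ω` by `-dy`. -/
theorem gauge_add_mem (Φ : Filt T) (x y : T.X 0) (ω : T.X 1) {r : ℕ} (hy : y ∈ Φ.F r 0) :
    T.gauge (x + y) ω - T.gauge x ω + T.d (zero_add 1) y ∈ Φ.F (r + 1) 1 := by
  obtain ⟨a, ha⟩ := Φ.ad_isNilpotent x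
  obtain ⟨b, hb⟩ := Φ.ad_isNilpotent (x + y)
  rw [gauge_eq_sum (pow_eq_zero_of_le (le_max_left a b) ha),
    gauge_eq_sum (pow_eq_zero_of_le (le_max_right a b) hb)]
  set N := max a b
  have key : ∀ n, (T.ad (x + y) ^ n)
      (T.br (zero_add 1) (x + y) ω - T.d (zero_add 1) (x + y)) -
      (T.ad x ^ n) (T.br (zero_add 1) x ω - T.d (zero_add 1) x) +
      (if n = 0 then T.d (zero_add 1) y else 0) ∈ Φ.F (r + 1) 1 := by
    intro n
    induction n with
    | zero =>
      have h : T.br (zero_add 1) y ω ∈ Φ.F (r + 1) 1 := Φ.br_mem' _ ω hy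
      convert h using 1
      simp only [pow_zero, Module.End.one_apply, if_true, map_add, LinearMap.add_apply]
      abel
    | succ n ih =>
      set v' := (T.ad (x + y) ^ n) (T.br (zero_add 1) (x + y) ω - T.d (zero_add 1) (x + y)) with hv'
      set v := (T.ad x ^ n) (T.br (zero_add 1) x ω - T.d (zero_add 1) x) with hv
      have hsub : v' - v ∈ Φ.F r 1 := by
        have h := Φ.le ih
        split_ifs at h
        · have h' := sub_mem h (Φ.d_mem (zero_add 1) hy)
          rwa [add_sub_cancel_right] at h'
        · rwa [add_zero] at h
      rw [if_neg n.succ_ne_zero, add_zero, pow_succ', pow_succ', Module.End.mul_apply,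
        Module.End.mul_apply, ← hv, ← hv']
      have h1 : T.ad (x + y) v' - T.ad x v =
          T.br (zero_add 1) y v' + T.br (zero_add 1) x (v' - v) := by
        simp only [ad, map_add, LinearMap.add_apply, map_sub]
        abel
      rw [h1]
      exact add_mem (Φ.br_mem' _ _ hy) (Φ.br_mem _ _ hsub)
  have hN : T.ad (x + y) ^ (N + 1) = 0 := pow_eq_zero_of_le (by omega) hb
  have hN' : T.ad x ^ (N + 1) = 0 := pow_eq_zero_of_le (by omega) ha
  have e₁ : ∀ z, ∑ n ∈ Finset.range (N + 1), T.gaugeCoeff z ω n =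
      ω + ∑ n ∈ Finset.range N, T.gaugeCoeff z ω (n + 1) := fun z => by
    rw [Finset.sum_range_succ', add_comm]
    rfl
  rcases Nat.eq_zero_or_pos N with h0 | hpos
  · -- here the whole space vanishes
    have hid : ∀ z : T.X 1, z = 0 := fun z => by
      have := pow_eq_zero_of_le (show a ≤ 0 by omega) ha
      rw [pow_zero] at this
      exact LinearMap.congr_fun this z
    rw [hid (_ + _)]
    exact zero_mem _
  · rw [e₁, e₁, add_sub_add_left_eq_sub, ← Finset.sum_sub_distrib]
    have e₂ : T.d (zero_add 1) y = ∑ n ∈ Finset.range N, (Nat.factorial (n + 1) : k)⁻¹ •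
        (if n = 0 then T.d (zero_add 1) y else 0) := by
      rw [Finset.sum_eq_single 0]
      · simp
      · intro n _ hn
        simp [hn]
      · intro h
        exact absurd (Finset.mem_range.mpr hpos) h
    rw [e₂, ← Finset.sum_add_distrib]
    refine Submodule.sum_mem _ fun n _ => ?_
    simp only [gaugeCoeff, ← smul_sub, ← smul_add]
    exact Submodule.smul_mem _ _ (key n)

theorem br_sub_mem (Φ : Filt T) {ω ω' : T.X 1} {r : ℕ} (h : ω' - ω ∈ Φ.F r 1)
    (h2 : (1 : ℤ) + 1 = 2) :
    T.br h2 ω' ω' - T.br h2 ω ω ∈ Φ.F (r + 1) 2 := by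
  have : T.br h2 ω' ω' - T.br h2 ω ω = T.br h2 (ω' - ω) ω' + T.br h2 ω (ω' - ω) := by
    simp only [map_sub, LinearMap.sub_apply]
    abel
  rw [this]
  exact add_mem (Φ.br_mem' _ _ h) (Φ.br_mem _ _ h)

/-- The difference of two Maurer-Cartan elements is a cocycle to first order. -/
theorem d_sub_mem_of_isMC (Φ : Filt T) {ω ω' : T.X 1} (hω : T.IsMC ω) (hω' : T.IsMC ω') {r : ℕ}
    (h : ω' - ω ∈ Φ.F r 1) (h2 : (1 : ℤ) + 1 = 2) : T.d h2 (ω' - ω) ∈ Φ.F (r + 1) 2 := by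
  have e : T.d h2 (ω' - ω) = -((2 : k)⁻¹ • (T.br h2 ω' ω' - T.br h2 ω ω)) := by
    have e₁ := eq_neg_of_add_eq_zero_left hω
    have e₂ := eq_neg_of_add_eq_zero_left hω'
    rw [map_sub, e₁, e₂, smul_sub]
    abel
  rw [e]
  exact neg_mem (Submodule.smul_mem _ _ (br_sub_mem Φ h h2))

/-- To first order, changing `ω` by `y` changes the curvature by `dy`. -/
theorem curv_add_mem (Φ : Filt T) (ω y : T.X 1) {r : ℕ} (h : y ∈ Φ.F r 1) (h2 : (1 : ℤ) + 1 = 2) :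
    T.curv (ω + y) - T.curv ω - T.d h2 y ∈ Φ.F (r + 1) 2 := by
  have e : T.curv (ω + y) - T.curv ω - T.d h2 y =
      (2 : k)⁻¹ • (T.br h2 (ω + y) (ω + y) - T.br h2 ω ω) := by
    simp only [curv, map_add, LinearMap.add_apply, smul_add, smul_sub]
    abel
  rw [e]
  exact Submodule.smul_mem _ _ (br_sub_mem Φ (by simpa using h) h2)

/-- The Jacobi identity says that three times this element vanishes. -/
theorem br_br_self [CharZero k] (ω : T.X 1) (h2 : (1 : ℤ) + 1 = 2) (h3 : (2 : ℤ) + 1 = 3) :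
    T.br h3 (T.br h2 ω ω) ω = 0 := by
  have h3' : (1 : ℤ) + 2 = 3 := by norm_num
  have h1 := T.jacobi h2 h3' h2 h3 h2 h3' ω ω ω
  have hs := T.br_symm h3' h3 ω (T.br h2 ω ω)
  rw [show (1 : ℤ) * 2 = 1 + 1 by norm_num, sgn_add, sgn_one] at hs
  rw [mul_one, sgn_one] at h1
  simp only [mul_neg, mul_one, neg_neg, one_smul] at hs
  rw [hs] at h1
  have h4 : (3 : k) • T.br h3 (T.br h2 ω ω) ω = 0 := by
    have : (3 : k) • T.br h3 (T.br h2 ω ω) ω = T.br h3 (T.br h2 ω ω) ω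
      + -1 • -T.br h3 (T.br h2 ω ω) ω - -T.br h3 (T.br h2 ω ω) ω := by module
    rw [this]
    simp only [neg_smul, one_smul, neg_neg] at h1 ⊢
    rw [← h1]
    abel
  exact (smul_eq_zero.mp h4).resolve_left three_ne_zero

/-- To first order the curvature is a cocycle, by the Bianchi identity
`d (curv ω) = [curv ω, ω]`. -/
theorem d_curv_mem [CharZero k] (Φ : Filt T) {ω : T.X 1} {r : ℕ} (h : T.curv ω ∈ Φ.F r 2)
    (h3 : (2 : ℤ) + 1 = 3) : T.d h3 (T.curv ω) ∈ Φ.F (r + 1) 3 := by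
  have h2 : (1 : ℤ) + 1 = 2 := by norm_num
  have h3' : (1 : ℤ) + 2 = 3 := by norm_num
  have e : T.d h3 (T.curv ω) = T.br h3 (T.curv ω) ω := by
    have e₁ : T.d h3 (T.br h2 ω ω) = (2 : k) • T.br h3 (T.d h2 ω) ω := by
      rw [T.d_br h2 h3 h2 h2 h3 h3', sgn_one, T.br_symm h3' h3,
        show (1 : ℤ) * 2 = 1 + 1 by norm_num, sgn_add, sgn_one]
      module
    simp only [curv, map_add, map_smul, LinearMap.add_apply, LinearMap.smul_apply]
    rw [T.d_d, e₁, br_br_self, smul_smul, inv_mul_cancel₀ two_ne_zero]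
    simp
  rw [e]
  exact Φ.br_mem' _ _ h

end estimates

end DGLA

end

end Koszul

namespace Koszul

noncomputable section

/-! ### Gauge fixing and lifting along contractions -/

/-- The value at which a sequence becomes stationary (and a junk value if it does not). -/
def eventualValue {α : Type*} (x : ℕ → α) : α :=
  open Classical in if h : ∃ r, ∀ j, r ≤ j → x j = x r then x h.choose else x 0

theorem eventualValue_eq {α : Type*} {x : ℕ → α} {r : ℕ} (h : ∀ j, r ≤ j → x j = x r) :
    eventualValue x = x r := by
  have hex : ∃ r, ∀ j, r ≤ j → x j = x r := ⟨r, h⟩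
  rw [eventualValue, dif_pos hex]
  rcases le_total r hex.choose with hle | hle
  · exact h _ hle
  · exact (hex.choose_spec r hle).symm

theorem map_eventualValue {α β : Type*} (f : α → β) {x : ℕ → α} {r : ℕ}
    (h : ∀ j, r ≤ j → x j = x r) : f (eventualValue x) = eventualValue fun j => f (x j) := by
  rw [eventualValue_eq h, eventualValue_eq (x := fun j => f (x j)) fun j hj => congrArg f (h j hj)]

namespace DGLA

variable {k : Type u} [Field k]

/-- A filtered `k`-linear contraction of the kernel of a morphism of DGLAs, extended to a graded
map on the whole source. -/
structure Contraction {T T' : DGLA k} (p : Hom T T') (Φ : Filt T) where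
  s : ∀ {i j : ℤ}, j + 1 = i → T.X i →ₗ[k] T.X j
  map_s : ∀ {i j : ℤ} (h : j + 1 = i) (x : T.X i), p.f j (s h x) = 0
  s_mem : ∀ {i j : ℤ} (h : j + 1 = i) {r : ℕ} {x : T.X i}, x ∈ Φ.F r i → s h x ∈ Φ.F r j
  hty : ∀ {i j l : ℤ} (h : j + 1 = i) (h' : i + 1 = l) (x : T.X i), p.f i x = 0 →
    T.d h (s h x) + s h' (T.d h' x) = x

/-- Successive approximations to a gauge transformation from `ω` to `ω'`. -/
def gaugeSeq {T : DGLA k} (s : T.X 1 →ₗ[k] T.X 0) (ω ω' : T.X 1) : ℕ → T.X 0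
  | 0 => 0
  | j + 1 => gaugeSeq s ω ω' j - s (ω' - T.gauge (gaugeSeq s ω ω' j) ω)

/-- Successive approximations to a solution of the Maurer-Cartan equation. -/
def liftSeq {T : DGLA k} (s : T.X 2 →ₗ[k] T.X 1) (ω : T.X 1) : ℕ → T.X 1
  | 0 => ω
  | j + 1 => liftSeq s ω j - s (T.curv (liftSeq s ω j))

/-- The gauge transformation from `ω` to `ω'` approximated by `gaugeSeq`. -/
def gaugeFix {T : DGLA k} (s : T.X 1 →ₗ[k] T.X 0) (ω ω' : T.X 1) : T.X 0 :=
  eventualValue (gaugeSeq s ω ω')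

/-- The solution of the Maurer-Cartan equation approximated by `liftSeq`. -/
def liftFix {T : DGLA k} (s : T.X 2 →ₗ[k] T.X 1) (ω : T.X 1) : T.X 1 :=
  eventualValue (liftSeq s ω)

section naturality

variable {T U : DGLA k} (g : Hom T U)

theorem map_gaugeSeq (Φ : Filt T) {s : T.X 1 →ₗ[k] T.X 0} {s' : U.X 1 →ₗ[k] U.X 0}
    (hs : ∀ x, g.f 0 (s x) = s' (g.f 1 x)) (ω ω' : T.X 1) (j : ℕ) :
    g.f 0 (gaugeSeq s ω ω' j) = gaugeSeq s' (g.f 1 ω) (g.f 1 ω') j := by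
  induction j with
  | zero => simp [gaugeSeq]
  | succ j ih =>
    rw [gaugeSeq, gaugeSeq, ← ih, map_sub, hs, map_sub, g.map_gauge _ _ (Φ.ad_isNilpotent _)]

theorem map_liftSeq {s : T.X 2 →ₗ[k] T.X 1} {s' : U.X 2 →ₗ[k] U.X 1}
    (hs : ∀ x, g.f 1 (s x) = s' (g.f 2 x)) (ω : T.X 1) (j : ℕ) :
    g.f 1 (liftSeq s ω j) = liftSeq s' (g.f 1 ω) j := by
  induction j with
  | zero => rfl
  | succ j ih => rw [liftSeq, liftSeq, ← ih, map_sub, hs, g.map_curv]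

end naturality

section convergence

variable [CharZero k] {T T' : DGLA k} {p : Hom T T'} {Φ : Filt T} (c : Contraction p Φ)

/-- Each approximation gains one degree of the filtration: correcting the gauge transformation by
`-s δ`, for the error `δ`, changes the error to `δ - d (s δ) = s (dδ)` to first order, and `dδ` is
of higher order. -/
theorem gaugeSeq_spec {ω ω' : T.X 1} (hω : T.IsMC ω) (hω' : T.IsMC ω')
    (hp : p.f 1 ω' = p.f 1 ω) (j : ℕ) :
    p.f 0 (gaugeSeq (c.s (zero_add 1)) ω ω' j) = 0 ∧
      ω' - T.gauge (gaugeSeq (c.s (zero_add 1)) ω ω' j) ω ∈ Φ.F j 1 := by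
  have h2 : (1 : ℤ) + 1 = 2 := by norm_num
  induction j with
  | zero => exact ⟨map_zero _, Φ.top _⟩
  | succ j ih =>
    obtain ⟨h0, hj⟩ := ih
    set x := gaugeSeq (c.s (zero_add 1)) ω ω' j with hx
    set δ := ω' - T.gauge x ω with hδ
    have hpδ : p.f 1 δ = 0 := by
      rw [hδ, map_sub, p.map_gauge _ _ (Φ.ad_isNilpotent _), h0, gauge_zero, hp, sub_self]
    have hstep : gaugeSeq (c.s (zero_add 1)) ω ω' (j + 1) = x + -(c.s (zero_add 1) δ) := by
      rw [gaugeSeq, sub_eq_add_neg]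
    rw [hstep]
    refine ⟨by rw [map_add, map_neg, c.map_s, h0, neg_zero, add_zero], ?_⟩
    have hd : T.d h2 δ ∈ Φ.F (j + 1) 2 :=
      d_sub_mem_of_isMC Φ (gauge_isMC (Φ.ad_isNilpotent _) hω) hω' hj h2
    have hg := gauge_add_mem Φ x (-(c.s (zero_add 1) δ)) ω (neg_mem (c.s_mem _ hj))
    have hh := c.hty (zero_add 1) h2 δ hpδ
    have e : ω' - T.gauge (x + -(c.s (zero_add 1) δ)) ω = c.s h2 (T.d h2 δ) -
        (T.gauge (x + -(c.s (zero_add 1) δ)) ω - T.gauge x ω +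
          T.d (zero_add 1) (-(c.s (zero_add 1) δ))) := by
      rw [← eq_sub_iff_add_eq'] at hh
      rw [hh, map_neg, hδ]
      abel
    rw [e]
    exact sub_mem (c.s_mem _ hd) hg

theorem gaugeSeq_stationary {ω ω' : T.X 1} (hω : T.IsMC ω) (hω' : T.IsMC ω')
    (hp : p.f 1 ω' = p.f 1 ω) : ∃ r, T.gauge (gaugeSeq (c.s (zero_add 1)) ω ω' r) ω = ω' ∧
      ∀ j, r ≤ j → gaugeSeq (c.s (zero_add 1)) ω ω' j = gaugeSeq (c.s (zero_add 1)) ω ω' r := by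
  obtain ⟨r, hr⟩ := Φ.bot
  have h : ∀ j, r ≤ j → ω' - T.gauge (gaugeSeq (c.s (zero_add 1)) ω ω' j) ω = 0 := fun j hj =>
    hr 1 _ (Φ.le_of_le hj (gaugeSeq_spec c hω hω' hp j).2)
  refine ⟨r, (sub_eq_zero.mp (h r le_rfl)).symm, fun j hj => ?_⟩
  induction j, hj using Nat.le_induction with
  | base => rfl
  | succ j hj ih => rw [gaugeSeq, h j hj, map_zero, sub_zero, ih]

/-- Maurer-Cartan elements with the same image are gauge equivalent, if the kernel can be
contracted. -/
theorem gauge_gaugeFix {ω ω' : T.X 1} (hω : T.IsMC ω) (hω' : T.IsMC ω')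
    (hp : p.f 1 ω' = p.f 1 ω) : T.gauge (gaugeFix (c.s (zero_add 1)) ω ω') ω = ω' := by
  obtain ⟨r, h, hr⟩ := gaugeSeq_stationary c hω hω' hp
  rw [gaugeFix, eventualValue_eq hr, h]

theorem map_gaugeFix {U : DGLA k} (g : Hom T U) {s' : U.X 1 →ₗ[k] U.X 0}
    (hs : ∀ x, g.f 0 (c.s (zero_add 1) x) = s' (g.f 1 x)) {ω ω' : T.X 1} (hω : T.IsMC ω)
    (hω' : T.IsMC ω') (hp : p.f 1 ω' = p.f 1 ω) :
    g.f 0 (gaugeFix (c.s (zero_add 1)) ω ω') = gaugeFix s' (g.f 1 ω) (g.f 1 ω') := by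
  obtain ⟨r, h, hr⟩ := gaugeSeq_stationary c hω hω' hp
  rw [gaugeFix, map_eventualValue (g.f 0) hr]
  exact congrArg eventualValue (funext fun j => map_gaugeSeq g Φ hs ω ω' j)

/-- Each approximation gains one degree of the filtration, because the curvature is a cocycle to
first order. -/
theorem liftSeq_spec {ω : T.X 1} (hω : T'.IsMC (p.f 1 ω))
    (h2 : (1 : ℤ) + 1 = 2) (j : ℕ) : p.f 1 (liftSeq (c.s h2) ω j) = p.f 1 ω ∧
      T.curv (liftSeq (c.s h2) ω j) ∈ Φ.F j 2 := by
  have h3 : (2 : ℤ) + 1 = 3 := by norm_num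
  induction j with
  | zero => exact ⟨rfl, Φ.top _⟩
  | succ j ih =>
    obtain ⟨h0, hj⟩ := ih
    set ψ := liftSeq (c.s h2) ω j with hψ
    have hpδ : p.f 2 (T.curv ψ) = 0 := by
      rw [p.map_curv, h0]
      exact hω
    have hstep : liftSeq (c.s h2) ω (j + 1) = ψ + -(c.s h2 (T.curv ψ)) := by
      rw [liftSeq, sub_eq_add_neg]
    rw [hstep]
    refine ⟨by rw [map_add, map_neg, c.map_s, h0, neg_zero, add_zero], ?_⟩
    have hd := d_curv_mem Φ hj h3
    have hg := curv_add_mem Φ ψ (-(c.s h2 (T.curv ψ))) (neg_mem (c.s_mem _ hj)) h2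
    have hh := c.hty h2 h3 (T.curv ψ) hpδ
    have e : T.curv (ψ + -(c.s h2 (T.curv ψ))) = T.curv (ψ + -(c.s h2 (T.curv ψ))) - T.curv ψ -
        T.d h2 (-(c.s h2 (T.curv ψ))) + c.s h3 (T.d h3 (T.curv ψ)) := by
      rw [← eq_sub_iff_add_eq'] at hh
      rw [hh, map_neg]
      abel
    rw [e]
    exact add_mem hg (c.s_mem _ hd)

theorem liftSeq_stationary {ω : T.X 1} (hω : T'.IsMC (p.f 1 ω)) (h2 : (1 : ℤ) + 1 = 2) :
    ∃ r, T.IsMC (liftSeq (c.s h2) ω r) ∧ p.f 1 (liftSeq (c.s h2) ω r) = p.f 1 ω ∧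
      ∀ j, r ≤ j → liftSeq (c.s h2) ω j = liftSeq (c.s h2) ω r := by
  obtain ⟨r, hr⟩ := Φ.bot
  have h : ∀ j, r ≤ j → T.curv (liftSeq (c.s h2) ω j) = 0 := fun j hj =>
    hr 2 _ (Φ.le_of_le hj (liftSeq_spec c hω h2 j).2)
  refine ⟨r, h r le_rfl, (liftSeq_spec c hω h2 r).1, fun j hj => ?_⟩
  induction j, hj using Nat.le_induction with
  | base => rfl
  | succ j hj ih => rw [liftSeq, h j hj, map_zero, sub_zero, ih]

/-- A Maurer-Cartan element in the target lifts, if the kernel can be contracted. -/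
theorem liftFix_isMC {ω : T.X 1} (hω : T'.IsMC (p.f 1 ω)) (h2 : (1 : ℤ) + 1 = 2) :
    T.IsMC (liftFix (c.s h2) ω) ∧ p.f 1 (liftFix (c.s h2) ω) = p.f 1 ω := by
  obtain ⟨r, h, h', hr⟩ := liftSeq_stationary c hω h2
  rw [liftFix, eventualValue_eq hr]
  exact ⟨h, h'⟩

theorem map_liftFix {U : DGLA k} (g : Hom T U) (h2 : (1 : ℤ) + 1 = 2)
    {s' : U.X 2 →ₗ[k] U.X 1} (hs : ∀ x, g.f 1 (c.s h2 x) = s' (g.f 2 x)) {ω : T.X 1}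
    (hω : T'.IsMC (p.f 1 ω)) :
    g.f 1 (liftFix (c.s h2) ω) = liftFix s' (g.f 1 ω) := by
  obtain ⟨r, h, h', hr⟩ := liftSeq_stationary c hω h2
  rw [liftFix, map_eventualValue (g.f 1) hr]
  exact congrArg eventualValue (funext fun j => map_liftSeq g hs ω j)

end convergence

end DGLA

end

end Koszul

namespace Koszul

noncomputable section

/-! ### Filtrations of nilpotent cdgas -/

variable {k : Type u} [Field k]

/-- A finite decreasing filtration of a non-unital cdga `M` by subcomplexes, starting with `M`, for
which multiplication with any element of `M` raises the filtration degree. -/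
structure NCdga.Filt (M : NCdga k) where
  F : ℕ → ∀ n, Submodule k (M.X n)
  top : ∀ {n} (x : M.X n), x ∈ F 0 n
  le : ∀ {r n} {x : M.X n}, x ∈ F (r + 1) n → x ∈ F r n
  d_mem : ∀ {i j r} (h : j + 1 = i) {x : M.X i}, x ∈ F r i → M.d h x ∈ F r j
  mul_mem : ∀ {i j n r} (h : i + j = n) (x : M.X i) {y : M.X j},
    y ∈ F r j → M.mul h x y ∈ F (r + 1) n
  bot : ∃ r, ∀ n (x : M.X n), x ∈ F r n → x = 0

section totfilt

variable {L L' : DGLA k} {M M' : NCdga k}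

/-- The span of the elements `u ⊗ a`, where `a` lies in the `r`-th step of a filtration of `M`. -/
def Tot.filtStep (L : DGLA k) (Φ : M.Filt) (r : ℕ) (n : ℤ) : Submodule k (Tot.X L M n) :=
  Submodule.span k {y : Tot.X L M n | ∃ (p i : ℤ) (h : p - i = n) (u : L.X p) (a : M.X i),
    a ∈ Φ.F r i ∧ y = Tot.tm h u a}

theorem Tot.tm_mem (Φ : M.Filt) {p i n : ℤ} (h : p - i = n) (u : L.X p) {a : M.X i} {r : ℕ}
    (ha : a ∈ Φ.F r i) : Tot.tm h u a ∈ Tot.filtStep L Φ r n :=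
  Submodule.subset_span ⟨_, _, h, u, a, ha, rfl⟩

/-- A linear map out of `Tot (L ⊗ M)` sends the `r`-th step of the filtration to a given subspace
if it does so for elements `u ⊗ a`. -/
theorem Tot.map_mem {V : Type*} [AddCommGroup V] [Module k V] (Φ : M.Filt) {n : ℤ} {r : ℕ}
    (f : Tot.X L M n →ₗ[k] V) (S : Submodule k V)
    (hf : ∀ {p i : ℤ} (h : p - i = n) (u : L.X p) (a : M.X i), a ∈ Φ.F r i → f (Tot.tm h u a) ∈ S)
    {x : Tot.X L M n} (hx : x ∈ Tot.filtStep L Φ r n) : f x ∈ S := by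
  have h : Tot.filtStep L Φ r n ≤ S.comap f := by
    refine Submodule.span_le.mpr ?_
    rintro _ ⟨p, i, h, u, a, ha, rfl⟩
    exact hf h u a ha
  exact h hx

theorem Tot.mem_filtStep_zero (Φ : M.Filt) {n : ℤ} (x : Tot.X L M n) :
    x ∈ Tot.filtStep L Φ 0 n := by
  induction x using Tot.ind with
  | h0 => exact zero_mem _
  | hadd x y hx hy => exact add_mem hx hy
  | htm h u a => exact Tot.tm_mem Φ h u (Φ.top a)

theorem Tot.br_mem (Φ : M.Filt) {i j n : ℤ} {r : ℕ} (h : i + j = n) (x : Tot.X L M i)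
    {y : Tot.X L M j} (hy : y ∈ Tot.filtStep L Φ r j) :
    Tot.br h x y ∈ Tot.filtStep L Φ (r + 1) n := by
  refine Tot.map_mem Φ (Tot.br h x) _ (fun hs u a ha => ?_) hy
  induction x using Tot.ind with
  | h0 => rw [map_zero]; exact zero_mem _
  | hadd x y hx hy => rw [map_add]; exact add_mem hx hy
  | htm ht v b =>
    rw [Tot.br_tm _ ht hs rfl rfl]
    exact Submodule.smul_mem _ _ (Tot.tm_mem Φ _ _ (Φ.mul_mem _ b ha))

theorem Tot.d_mem (Φ : M.Filt) {i j : ℤ} {r : ℕ} (h : i + 1 = j) {x : Tot.X L M i}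
    (hx : x ∈ Tot.filtStep L Φ r i) : Tot.d h x ∈ Tot.filtStep L Φ r j := by
  refine Tot.map_mem Φ (Tot.d h) _ (fun {p q} hs u a ha => ?_) hx
  rw [Tot.d_tm h hs (p' := p + 1) (i' := q - 1) rfl (by omega)]
  exact add_mem (Tot.tm_mem Φ _ _ ha)
    (Submodule.smul_mem _ _ (Tot.tm_mem Φ _ _ (Φ.d_mem _ ha)))

theorem Tot.eq_zero_of_mem (Φ : M.Filt) {r : ℕ} (hr : ∀ n (a : M.X n), a ∈ Φ.F r n → a = 0)
    {n : ℤ} {x : Tot.X L M n} (hx : x ∈ Tot.filtStep L Φ r n) : x = 0 :=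
  Tot.map_mem Φ LinearMap.id ⊥ (fun h u a ha => by
    rw [hr _ _ ha, Tot.tm_zero_right, map_zero]
    exact zero_mem _) hx

theorem Tot.filtStep_le (Φ : M.Filt) {r : ℕ} {n : ℤ} {x : Tot.X L M n}
    (hx : x ∈ Tot.filtStep L Φ (r + 1) n) : x ∈ Tot.filtStep L Φ r n :=
  Tot.map_mem Φ LinearMap.id _ (fun h u _ ha => Tot.tm_mem Φ h u (Φ.le ha)) hx

/-- The filtration of `Tot (L ⊗ M)` induced by a filtration of `M`. -/
def Tot.filt (L : DGLA k) (Φ : M.Filt) : (Tot.dgla L M).Filt where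
  F r n := Tot.filtStep L Φ r n
  top x := Tot.mem_filtStep_zero Φ x
  le {r n x} hx := by
    exact Tot.filtStep_le Φ hx
  d_mem h _ hx := Tot.d_mem Φ h hx
  br_mem h x _ hy := Tot.br_mem Φ h x hy
  bot := by
    obtain ⟨r, hr⟩ := Φ.bot
    exact ⟨r, fun n (x : Tot.X L M n) (hx : x ∈ Tot.filtStep L Φ r n) =>
      Tot.eq_zero_of_mem Φ hr hx⟩

end totfilt

namespace DgArt

/-- The powers of the maximal ideal, in degree `n`. -/
def pow (A : DgArt k) : ℕ → ∀ n : ℤ, Submodule k (A.X n)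
  | 0, _ => ⊤
  | r + 1, n => Submodule.span k {x : A.X n | A.aug.IsProd (r + 1) x}

variable (A : DgArt k)

theorem pow_one (n : ℤ) : A.pow 1 n = A.aug.ker n := by
  refine le_antisymm (Submodule.span_le.mpr fun x hx => ?_) fun x hx =>
    Submodule.subset_span (.one x hx)
  generalize hr : 0 + 1 = r at hx
  cases hx with
  | one x hx => exact hx
  | @mul r i j n h x y hx hy =>
    obtain rfl : r = 0 := by omega
    cases hy

variable {A}

theorem pow_le {r : ℕ} {n : ℤ} {x : A.X n} (hx : x ∈ A.pow (r + 1) n) : x ∈ A.pow r n := by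
  rcases r with _ | r
  · exact Submodule.mem_top
  · exact Submodule.span_mono (fun y hy => Augmentation.IsProd.pred hy r.succ_pos) hx

theorem pow_le_of_le {r s : ℕ} (h : r ≤ s) {n : ℤ} {x : A.X n} (hx : x ∈ A.pow s n) :
    x ∈ A.pow r n := by
  induction s, h using Nat.le_induction with
  | base => exact hx
  | succ s hs ih => exact ih (pow_le hx)

theorem map_pow {B : DgArt k} (f : A ⟶ B) {r : ℕ} {n : ℤ} {x : A.X n} (hx : x ∈ A.pow r n) :
    f.f n x ∈ B.pow r n := by
  rcases r with _ | r
  · exact Submodule.mem_top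
  · induction hx using Submodule.span_induction with
    | zero => rw [map_zero]; exact zero_mem _
    | add y z _ _ hy hz => rw [map_add]; exact add_mem hy hz
    | smul c y _ hy => rw [map_smul]; exact Submodule.smul_mem _ _ hy
    | mem y hy =>
      exact Submodule.subset_span (hy.map f.toHom fun n z hz => map_ker f B.aug hz)

theorem ker_mul_mem {r : ℕ} {i j n : ℤ} (h : i + j = n) {x : A.X i} {y : A.X j}
    (hx : x ∈ A.aug.ker i) (hy : y ∈ A.pow r j) : A.mul h x y ∈ A.pow (r + 1) n := by
  rcases r with _ | r
  · refine Submodule.subset_span (.one _ ?_)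
    have hx : A.aug.ε i x = 0 := hx
    rw [Augmentation.ker, LinearMap.mem_ker, A.aug.ε_mul, hx, zero_mul]
  · induction hy using Submodule.span_induction with
    | zero => rw [map_zero]; exact zero_mem _
    | add y z _ _ hy hz => rw [map_add]; exact add_mem hy hz
    | smul c y _ hy => rw [map_smul]; exact Submodule.smul_mem _ _ hy
    | mem y hy => exact Submodule.subset_span (.mul h x y hx hy)

theorem mul_pow_mem {r : ℕ} {i j n : ℤ} (h : i + j = n) (x : A.X i) {y : A.X j}
    (hy : y ∈ A.pow r j) : A.mul h x y ∈ A.pow r n := by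
  rcases r with _ | r
  · exact Submodule.mem_top
  · have hker : ∀ {a b c : ℤ} (h : a + b = c) (x : A.X a) (y : A.X b), y ∈ A.aug.ker b →
        A.mul h x y ∈ A.aug.ker c := by
      intro a b c h x y hy
      have hy : A.aug.ε b y = 0 := hy
      rw [Augmentation.ker, LinearMap.mem_ker, A.aug.ε_mul, hy, mul_zero]
    induction hy using Submodule.span_induction with
    | zero => rw [map_zero]; exact zero_mem _
    | add y z _ _ hy hz => rw [map_add]; exact add_mem hy hz
    | smul c y _ hy => rw [map_smul]; exact Submodule.smul_mem _ _ hy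
    | mem y hy =>
      refine Submodule.subset_span ?_
      obtain ⟨s, hs⟩ : ∃ s, s = r + 1 := ⟨_, rfl⟩
      replace hy : A.aug.IsProd (r + 1) y := hy
      change A.aug.IsProd (r + 1) _
      rw [← hs] at hy ⊢
      cases hy with
      | one y hy => exact .one _ (hker h x y hy)
      | @mul s i' j' _ h' y z hy hz =>
        rw [← A.mul_assoc (b := i + i') rfl (by omega) h' h]
        exact .mul _ _ _ (hker _ x y hy) hz

theorem pow_mul_mem {r s : ℕ} {i j n : ℤ} (h : i + j = n) {x : A.X i} {y : A.X j}
    (hx : x ∈ A.pow r i) (hy : y ∈ A.pow s j) : A.mul h x y ∈ A.pow (r + s) n := by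
  rcases r with _ | r
  · rw [zero_add]
    exact mul_pow_mem h x hy
  · induction hx using Submodule.span_induction with
    | zero => rw [map_zero]; exact zero_mem _
    | add y z _ _ hy hz => rw [map_add]; exact add_mem hy hz
    | smul c y _ hy => rw [map_smul]; exact Submodule.smul_mem _ _ hy
    | mem x hx =>
      replace hx : A.aug.IsProd (r + 1) x := hx
      generalize r + 1 = q at hx
      induction hx generalizing n with
      | one x hx =>
        rw [add_comm 1 s]
        exact ker_mul_mem h hx hy
      | @mul q i' j' _ h' x z hx hz ih =>
        rw [A.mul_assoc (a := j' + j) h' h rfl (by omega), add_right_comm]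
        exact ker_mul_mem _ hx (ih (x := z) rfl)

theorem d_pow_mem {r : ℕ} {i j : ℤ} (h : j + 1 = i) {x : A.X i} (hx : x ∈ A.pow r i) :
    A.d h x ∈ A.pow r j := by
  rcases r with _ | r
  · exact Submodule.mem_top
  · induction hx using Submodule.span_induction with
    | zero => rw [map_zero]; exact zero_mem _
    | add y z _ _ hy hz => rw [map_add]; exact add_mem hy hz
    | smul c y _ hy => rw [map_smul]; exact Submodule.smul_mem _ _ hy
    | mem x hx =>
      replace hx : A.aug.IsProd (r + 1) x := hx
      generalize r + 1 = q at hx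
      induction hx generalizing j with
      | one x hx =>
        rw [pow_one]
        exact A.aug.ε_d h _
      | @mul q i' j' n' h' x z hx hz ih =>
        rw [A.d_mul h' h (i' := i' - 1) (j' := j' - 1) (by omega) (by omega) (by omega) (by omega)]
        have hz' : z ∈ A.pow q j' := by
          cases hz with
          | one z hz => exact Submodule.subset_span (.one _ hz)
          | mul h x y hx hy => exact Submodule.subset_span (.mul h x y hx hy)
        exact add_mem (ker_mul_mem _ (A.aug.ε_d _ _) hz')
          (Submodule.smul_mem _ _ (ker_mul_mem _ hx (ih (x := z) _)))

theorem exists_pow_eq_bot (A : DgArt k) : ∃ r, 0 < r ∧ ∀ n (x : A.X n), x ∈ A.pow r n → x = 0 := by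
  obtain ⟨r, hr, h0⟩ := A.nilp
  obtain ⟨s, rfl⟩ : ∃ s, r = s + 1 := ⟨r - 1, by omega⟩
  refine ⟨s + 1, hr, fun n x hx => ?_⟩
  have : A.pow (s + 1) n = ⊥ := Submodule.span_eq_bot.mpr fun y hy => h0 n y hy
  rwa [this, Submodule.mem_bot] at hx

variable (A)

/-- The inclusion of the maximal ideal. -/
def maxIncl (n : ℤ) : A.maxIdeal.X n →ₗ[k] A.X n := (A.aug.ker n).subtype

theorem mem_comap_maxIncl {n : ℤ} {S : Submodule k (A.X n)} {x : A.maxIdeal.X n} :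
    x ∈ S.comap (A.maxIncl n) ↔ x.1 ∈ S := Iff.rfl

/-- The filtration of the maximal ideal by its powers. -/
def adicFilt : A.maxIdeal.Filt where
  F r n := (A.pow (r + 1) n).comap (A.maxIncl n)
  top {n} x := by
    refine A.mem_comap_maxIncl.mpr ?_
    rw [zero_add, pow_one]
    exact x.2
  le h := A.mem_comap_maxIncl.mpr (pow_le (A.mem_comap_maxIncl.mp h))
  d_mem h _ hx := A.mem_comap_maxIncl.mpr (d_pow_mem h (A.mem_comap_maxIncl.mp hx))
  mul_mem h x _ hy := A.mem_comap_maxIncl.mpr (ker_mul_mem h x.2 (A.mem_comap_maxIncl.mp hy))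
  bot := by
    obtain ⟨r, hr, h0⟩ := A.exists_pow_eq_bot
    obtain ⟨s, rfl⟩ : ∃ s, r = s + 1 := ⟨r - 1, by omega⟩
    exact ⟨s, fun n x hx => Subtype.ext (h0 n x.1 hx)⟩

end DgArt

end

end Koszul

namespace Koszul

noncomputable section

/-! ### Quasi-isomorphisms in terms of elements -/

/-- A morphism of short complexes of modules is a quasi-isomorphism if and only if it is injective
and surjective on homology classes. -/
theorem moduleCat_quasiIso_iff {R : Type u} [Ring R] {S₁ S₂ : ShortComplex (ModuleCat.{u} R)}
    (φ : S₁ ⟶ S₂) : ShortComplex.QuasiIso φ ↔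
      (∀ x : S₁.X₂, S₁.g x = 0 → (∃ y, S₂.f y = φ.τ₂ x) → ∃ z, S₁.f z = x) ∧
      (∀ y : S₂.X₂, S₂.g y = 0 → ∃ x, S₁.g x = 0 ∧ ∃ z, S₂.f z = y - φ.τ₂ x) := by
  let h₁ := S₁.moduleCatLeftHomologyData
  let h₂ := S₂.moduleCatLeftHomologyData
  let γ : ShortComplex.LeftHomologyMapData φ h₁ h₂ := default
  have hi : ∀ z : h₁.K, h₂.i (γ.φK z) = φ.τ₂ (h₁.i z) := fun z =>
    congrArg (fun (f : h₁.K ⟶ S₂.X₂) => f z) γ.commi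
  have hπ : ∀ z : h₁.K, γ.φH (h₁.π z) = h₂.π (γ.φK z) := fun z =>
    congrArg (fun (f : h₁.K ⟶ h₂.H) => f z) γ.commπ
  have surj : ∀ (S : ShortComplex (ModuleCat.{u} R)),
      Function.Surjective S.moduleCatLeftHomologyData.π := fun S =>
    Submodule.mkQ_surjective _
  have ker : ∀ (S : ShortComplex (ModuleCat.{u} R)) (z : S.moduleCatLeftHomologyData.K),
      S.moduleCatLeftHomologyData.π z = 0 ↔ ∃ y, S.f y = S.moduleCatLeftHomologyData.i z := by
    intro S z
    refine (Submodule.Quotient.mk_eq_zero _).trans ⟨?_, ?_⟩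
    · rintro ⟨y, hy⟩
      exact ⟨y, congrArg Subtype.val hy⟩
    · rintro ⟨y, hy⟩
      exact ⟨y, Subtype.ext hy⟩
  have lift : ∀ (S : ShortComplex (ModuleCat.{u} R)) (x : S.X₂), S.g x = 0 →
      ∃ z, S.moduleCatLeftHomologyData.i z = x := fun S x hx => ⟨⟨x, hx⟩, rfl⟩
  have hg : ∀ (S : ShortComplex (ModuleCat.{u} R)) (z : S.moduleCatLeftHomologyData.K),
      S.g (S.moduleCatLeftHomologyData.i z) = 0 := fun S z => z.2
  rw [γ.quasiIso_iff, ConcreteCategory.isIso_iff_bijective]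
  refine and_congr ?_ ?_
  · rw [injective_iff_map_eq_zero]
    constructor
    · intro h x hx hy
      obtain ⟨z, rfl⟩ := lift _ x hx
      refine (ker _ _).mp (h (h₁.π z) ?_)
      rw [hπ, ker, hi]
      exact hy
    · intro h a ha
      obtain ⟨z, rfl⟩ := surj _ a
      rw [hπ, ker, hi] at ha
      exact (ker _ _).mpr (h _ (hg _ z) ha)
  · constructor
    · intro h y hy
      obtain ⟨y, rfl⟩ := lift _ y hy
      obtain ⟨a, ha⟩ := h (h₂.π y)
      obtain ⟨x, rfl⟩ := surj _ a
      rw [hπ] at ha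
      refine ⟨h₁.i x, hg _ x, ?_⟩
      rw [← hi, ← map_sub]
      refine (ker _ _).mp ?_
      rw [map_sub, sub_eq_zero]
      exact ha.symm
    · intro h b
      obtain ⟨y, rfl⟩ := surj _ b
      obtain ⟨x, hx, hz⟩ := h _ (hg _ y)
      obtain ⟨x, rfl⟩ := lift _ x hx
      refine ⟨h₁.π x, ?_⟩
      rw [← hi, ← map_sub, ← ker, map_sub, sub_eq_zero] at hz
      rw [hπ]
      exact hz.symm

namespace DGLA

variable {k : Type u} [Field k]

instance : (quasiIso k).HasTwoOutOfThreeProperty :=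
  inferInstanceAs ((HomologicalComplex.quasiIso (ModuleCat.{u} k)
    (ComplexShape.up ℤ)).inverseImage (toComplex k)).HasTwoOutOfThreeProperty

theorem quasiIso_iff {L M : DGLA k} (p : L ⟶ M) : quasiIso k p ↔
    ∀ {i j l : ℤ} (h : i + 1 = j) (h' : j + 1 = l),
      (∀ x : L.X j, L.d h' x = 0 → (∃ y, M.d h y = p.f j x) → ∃ z, L.d h z = x) ∧
      (∀ y : M.X j, M.d h' y = 0 → ∃ x, L.d h' x = 0 ∧ ∃ z, M.d h z = y - p.f j x) := by
  have e₁ : quasiIso k p ↔ ∀ j, QuasiIsoAt ((toComplex k).map p) j :=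
    _root_.quasiIso_iff _
  have e₂ : ∀ {i j l : ℤ} (h : i + 1 = j) (h' : j + 1 = l),
      QuasiIsoAt ((toComplex k).map p) j ↔
      (∀ x : L.X j, L.d h' x = 0 → (∃ y, M.d h y = p.f j x) → ∃ z, L.d h z = x) ∧
      (∀ y : M.X j, M.d h' y = 0 → ∃ x, L.d h' x = 0 ∧ ∃ z, M.d h z = y - p.f j x) := by
    intro i j l h h'
    rw [quasiIsoAt_iff' _ i j l (by simp [← h]) (by simp [h']), moduleCat_quasiIso_iff]
    have dL : ∀ {a b : ℤ} (hab : a + 1 = b) (x : L.X a),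
        ((toComplex k).obj L).d a b x = L.d hab x := fun {a b} hab x => by
      have : ((toComplex k).obj L).d a b = ModuleCat.ofHom (L.d hab) := dif_pos hab
      rw [this]
      rfl
    have dM : ∀ {a b : ℤ} (hab : a + 1 = b) (x : M.X a),
        ((toComplex k).obj M).d a b x = M.d hab x := fun {a b} hab x => by
      have : ((toComplex k).obj M).d a b = ModuleCat.ofHom (M.d hab) := dif_pos hab
      rw [this]
      rfl
    refine and_congr (forall_congr' fun x => ?_) (forall_congr' fun y => ?_)
    · refine imp_congr (Eq.congr (dL h' x) rfl) (imp_congr (exists_congr fun y => ?_)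
        (exists_congr fun z => ?_))
      · exact Eq.congr (dM h y) rfl
      · exact Eq.congr (dL h z) rfl
    · refine imp_congr (Eq.congr (dM h' y) rfl) (exists_congr fun x => and_congr ?_
        (exists_congr fun z => ?_))
      · exact Eq.congr (dL h' x) rfl
      · exact Eq.congr (dM h z) rfl
  rw [e₁]
  constructor
  · intro H i j l h h'
    exact (e₂ h h').mp (H j)
  · intro H j
    exact (e₂ (sub_add_cancel j 1) rfl).mpr (H _ _)

/-- A degreewise linear section `σ` of a morphism of DGLAs, together with a linear contraction of
the kernel, which is extended to a graded map `s` on the source: `ds + sd` differs from the identity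
by a map that factors through the given morphism. -/
structure Splitting {L M : DGLA k} (p : Hom L M) where
  σ : ∀ n, M.X n →ₗ[k] L.X n
  map_σ : ∀ n y, p.f n (σ n y) = y
  s : ∀ {i j : ℤ}, j + 1 = i → L.X i →ₗ[k] L.X j
  map_s : ∀ {i j : ℤ} (h : j + 1 = i) (x : L.X i), p.f j (s h x) = 0
  τ : ∀ n, M.X n →ₗ[k] L.X n
  hty : ∀ {i j l : ℤ} (h : j + 1 = i) (h' : i + 1 = l) (x : L.X i),
    L.d h (s h x) + s h' (L.d h' x) = x - τ i (p.f i x)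

/-- The kernel of a surjective quasi-isomorphism is acyclic. -/
theorem exists_preimage {L M : DGLA k} {p : L ⟶ M} (hp : ∀ n, Function.Surjective (p.f n))
    (hq : quasiIso k p) {i j l : ℤ} (h : i + 1 = j) (h' : j + 1 = l) (x : L.X j)
    (hx : p.f j x = 0) (hdx : L.d h' x = 0) : ∃ z, p.f i z = 0 ∧ L.d h z = x := by
  rw [quasiIso_iff] at hq
  obtain ⟨w, hw⟩ := (hq h h').1 x hdx ⟨0, by rw [map_zero, hx]⟩
  have hc : M.d h (p.f i w) = 0 := by rw [← p.map_d, hw, hx]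
  obtain ⟨w', hw', m, hm⟩ := (hq (sub_add_cancel i 1) h).2 _ hc
  obtain ⟨y, rfl⟩ := hp _ m
  refine ⟨w - w' - L.d (sub_add_cancel i 1) y, ?_, ?_⟩
  · rw [map_sub, map_sub, p.map_d, hm, sub_self]
  · rw [map_sub, map_sub, hw', L.d_d, hw, sub_zero, sub_zero]

/-- Surjective quasi-isomorphisms split, since `k` is a field and the kernel is acyclic. -/
theorem exists_splitting {L M : DGLA k} {p : L ⟶ M} (hp : ∀ n, Function.Surjective (p.f n))
    (hq : quasiIso k p) : Nonempty (Splitting p) := by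
  choose σ hσ using fun n => LinearMap.exists_rightInverse_of_surjective (p.f n)
    (LinearMap.range_eq_top.mpr (hp n))
  replace hσ : ∀ n y, p.f n (σ n y) = y := fun n y => LinearMap.congr_fun (hσ n) y
  -- the cocycles of the kernel are coboundaries, in a linear way
  have hτ : ∀ {i j : ℤ} (h : j + 1 = i), ∃ t : L.X i →ₗ[k] L.X j, (∀ x, p.f j (t x) = 0) ∧
      ∀ x, p.f i x = 0 → L.d (rfl : i + 1 = _) x = 0 → L.d h (t x) = x := by
    intro i j h
    let K : Submodule k (L.X j) := LinearMap.ker (p.f j)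
    obtain ⟨t, ht⟩ := exists_section ((L.d h) ∘ₗ K.subtype)
    refine ⟨K.subtype ∘ₗ t, fun x => (t x).2, fun x hx hdx => ?_⟩
    obtain ⟨z, hz, rfl⟩ := exists_preimage hp hq h rfl x hx hdx
    exact ht ⟨z, hz⟩
  choose t ht₁ ht₂ using @hτ
  let q : ∀ n, L.X n →ₗ[k] L.X n := fun n => LinearMap.id - σ n ∘ₗ p.f n
  have hq' : ∀ n x, p.f n (q n x) = 0 := fun n x => by simp [q, hσ]
  have hqx : ∀ n x, p.f n x = 0 → q n x = x := fun n x hx => by simp [q, hx]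
  let s : ∀ {i j : ℤ}, j + 1 = i → L.X i →ₗ[k] L.X j := fun {i j} h =>
    t h ∘ₗ (LinearMap.id - t (rfl : i + 1 = _) ∘ₗ L.d rfl) ∘ₗ q i
  have hs : ∀ {i j l : ℤ} (h : j + 1 = i) (h' : i + 1 = l) (x : L.X i), p.f i x = 0 →
      L.d h (s h x) + s h' (L.d h' x) = x := by
    intro i j l h h' x hx
    subst h'
    have hdx : p.f _ (L.d rfl x) = 0 := by rw [p.map_d, hx, map_zero]
    have h0 : L.d (rfl : i + 1 = _) (t rfl (L.d rfl x)) = L.d rfl x :=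
      ht₂ rfl _ hdx (L.d_d _ _ _)
    have e₁ : s h x = t h (x - t rfl (L.d rfl x)) := by simp [s, hqx i x hx]
    have e₂ : s rfl (L.d (rfl : i + 1 = _) x) = t rfl (L.d rfl x) := by
      simp [s, hqx _ _ hdx, L.d_d]
    rw [e₁, e₂, ht₂ h _ (by rw [map_sub, hx, ht₁, sub_zero]) (by rw [map_sub, h0, sub_self]),
      sub_add_cancel]
  refine ⟨⟨σ, hσ, s, fun h x => ht₁ h _, fun i => (LinearMap.id - (L.d (sub_add_cancel i 1) ∘ₗ
    s (sub_add_cancel i 1) + s rfl ∘ₗ L.d rfl)) ∘ₗ σ i, ?_⟩⟩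
  intro i j l h h' x
  obtain rfl : j = i - 1 := by omega
  subst h'
  have := hs h rfl (x - σ i (p.f i x)) (by rw [map_sub, hσ, sub_self])
  simp only [map_sub] at this
  simp only [LinearMap.comp_apply, LinearMap.sub_apply, LinearMap.add_apply, LinearMap.id_apply]
  rw [← sub_eq_zero] at this ⊢
  rw [← this]
  abel

end DGLA

/-! ### Contractions of `Tot (L ⊗ M)` -/

namespace Tot

variable {k : Type u} [Field k] {L L' : DGLA k} {M M' : NCdga k}

theorem tm_sub_left {p i n : ℤ} (h : p - i = n) (u v : L.X p) (a : M.X i) :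
    tm h (u - v) a = tm h u a - tm h v a := by simp [tm, TensorProduct.sub_tmul]

theorem tm_sub_right {p i n : ℤ} (h : p - i = n) (u : L.X p) (a b : M.X i) :
    tm h u (a - b) = tm h u a - tm h u b := by simp [tm, TensorProduct.tmul_sub]

theorem neg_smul_tm {p i n : ℤ} (h : p - i = n) (c : k) (u : L.X p) (a : M.X i) :
    (-c) • tm h u a = -(c • tm h u a) := by
  rw [← tm_smul_left, neg_smul, tm_neg_left, tm_smul_left]

/-- The map `s ⊗ 1` of degree `-1`, for a map `s` of degree `-1` on `L`. -/
def leftHty (M : NCdga k) (s : ∀ {i j : ℤ}, j + 1 = i → L.X i →ₗ[k] L.X j) {n m : ℤ}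
    (h : m + 1 = n) : X L M n →ₗ[k] X L M m :=
  desc fun p i hs => incl L M (show p - 1 - i = m by omega) ∘ₗ
    LinearMap.rTensor (M.X i) (s (sub_add_cancel p 1))

theorem leftHty_tm (s : ∀ {i j : ℤ}, j + 1 = i → L.X i →ₗ[k] L.X j) {n m p i p' : ℤ}
    (h : m + 1 = n) (hs : p - i = n) (hp : p' + 1 = p) (u : L.X p) (a : M.X i) :
    leftHty M s h (tm hs u a) = tm (show p' - i = m by omega) (s hp u) a := by
  obtain rfl : p' = p - 1 := by omega
  rw [leftHty, desc_tm]
  simp [tm]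

/-- The map `u ⊗ a ↦ (-1)^{deg u} u ⊗ s(a)` of degree `-1`, for a map `s` of homological degree
`1` on `M`. -/
def rightHty (L : DGLA k) (s : ∀ {i j : ℤ}, i + 1 = j → M.X i →ₗ[k] M.X j) {n m : ℤ}
    (h : m + 1 = n) : X L M n →ₗ[k] X L M m :=
  desc fun p i hs => sgn k p • incl L M (show p - (i + 1) = m by omega) ∘ₗ
    LinearMap.lTensor (L.X p) (s rfl)

theorem rightHty_tm (s : ∀ {i j : ℤ}, i + 1 = j → M.X i →ₗ[k] M.X j) {n m p i i' : ℤ}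
    (h : m + 1 = n) (hs : p - i = n) (hi : i + 1 = i') (u : L.X p) (a : M.X i) :
    rightHty L s h (tm hs u a) = sgn k p • tm (show p - i' = m by omega) u (s hi a) := by
  subst hi
  rw [rightHty, desc_tm]
  simp [tm]

theorem leftHty_hty {s : ∀ {i j : ℤ}, j + 1 = i → L.X i →ₗ[k] L.X j}
    {π : ∀ i, L.X i →ₗ[k] L.X i}
    (hs : ∀ {i j l : ℤ} (h : j + 1 = i) (h' : i + 1 = l) (x : L.X i),
      L.d h (s h x) + s h' (L.d h' x) = x - π i x) {n m l : ℤ} (h : m + 1 = n) (h' : n + 1 = l)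
    (x : X L M n) : d h (leftHty M s h x) + leftHty M s h' (d h' x) =
      x - mapLin π (fun i => LinearMap.id) n x := by
  induction x using ind with
  | h0 => simp
  | hadd x y hx hy =>
    simp only [map_add]
    rw [add_add_add_comm, hx, hy]
    abel
  | @htm p q hpq u a =>
    rw [leftHty_tm s h hpq (p' := p - 1) (by omega),
      d_tm h _ (p' := p) (i' := q - 1) (by omega) (by omega),
      d_tm h' hpq (p' := p + 1) (i' := q - 1) (by omega) (by omega), map_add, map_smul,
      leftHty_tm s h' _ (p' := p) (by omega), leftHty_tm s h' _ (p' := p - 1) (by omega)]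
    have hsgn : sgn k p = - sgn k (p - 1) := by
      have := sgn_add k (p - 1) 1
      rw [sub_add_cancel, sgn_one, mul_neg_one] at this
      exact this
    have e := congrArg (fun z => tm hpq z a) (hs (sub_add_cancel p 1) rfl u)
    simp only [tm_add_left, tm_sub_left] at e
    rw [hsgn, mapLin_tm, LinearMap.id_apply, neg_smul_tm, ← e]
    abel

theorem rightHty_hty {s : ∀ {i j : ℤ}, i + 1 = j → M.X i →ₗ[k] M.X j}
    {π : ∀ i, M.X i →ₗ[k] M.X i}
    (hs : ∀ {i j l : ℤ} (h : i + 1 = j) (h' : l + 1 = i) (x : M.X i),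
      M.d h (s h x) + s h' (M.d h' x) = x - π i x) {n m l : ℤ} (h : m + 1 = n) (h' : n + 1 = l)
    (x : X L M n) : d h (rightHty L s h x) + rightHty L s h' (d h' x) =
      x - mapLin (fun i => LinearMap.id) π n x := by
  induction x using ind with
  | h0 => simp
  | hadd x y hx hy =>
    simp only [map_add]
    rw [add_add_add_comm, hx, hy]
    abel
  | @htm p q hpq u a =>
    rw [rightHty_tm s h hpq (i' := q + 1) rfl, map_smul,
      d_tm h _ (p' := p + 1) (i' := q) (by omega) (by omega),
      d_tm h' hpq (p' := p + 1) (i' := q - 1) (by omega) (by omega), map_add, map_smul,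
      rightHty_tm s h' _ (i' := q + 1) rfl, rightHty_tm s h' _ (i' := q) (by omega)]
    have hsgn : sgn k (p + 1) = - sgn k p := by rw [sgn_add, sgn_one, mul_neg_one]
    have hsq : sgn k p * sgn k p = 1 := by
      rw [← sgn_add, ← sgn_zero]
      exact sgn_congr k p (by ring)
    have e := congrArg (fun z => tm hpq u z) (hs rfl (sub_add_cancel q 1) a)
    simp only [tm_add_right, tm_sub_right] at e
    rw [hsgn, mapLin_tm, LinearMap.id_apply, neg_smul_tm, smul_add, smul_smul, smul_smul, hsq,
      one_smul, one_smul, ← e]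
    abel

theorem mapLin_comp_leftHty {f : ∀ p, L.X p →ₗ[k] L'.X p} (g : ∀ i, M.X i →ₗ[k] M'.X i)
    (s : ∀ {i j : ℤ}, j + 1 = i → L.X i →ₗ[k] L.X j)
    (s' : ∀ {i j : ℤ}, j + 1 = i → L'.X i →ₗ[k] L'.X j)
    (hf : ∀ {i j : ℤ} (h : j + 1 = i) x, f j (s h x) = s' h (f i x)) {n m : ℤ} (h : m + 1 = n)
    (x : X L M n) :
    mapLin f g m (leftHty M s h x) = leftHty M' s' h (mapLin f g n x) := by
  induction x using ind with
  | h0 => simp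
  | hadd x y hx hy => simp only [map_add, hx, hy]
  | @htm p q hpq u a =>
    rw [leftHty_tm s h hpq (p' := p - 1) (by omega), mapLin_tm, mapLin_tm,
      leftHty_tm s' h hpq (p' := p - 1) (by omega), hf]

theorem mapLin_comp_rightHty (f : ∀ p, L.X p →ₗ[k] L'.X p) {g : ∀ i, M.X i →ₗ[k] M'.X i}
    (s : ∀ {i j : ℤ}, i + 1 = j → M.X i →ₗ[k] M.X j)
    (s' : ∀ {i j : ℤ}, i + 1 = j → M'.X i →ₗ[k] M'.X j)
    (hg : ∀ {i j : ℤ} (h : i + 1 = j) x, g j (s h x) = s' h (g i x)) {n m : ℤ} (h : m + 1 = n)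
    (x : X L M n) :
    mapLin f g m (rightHty L s h x) = rightHty L' s' h (mapLin f g n x) := by
  induction x using ind with
  | h0 => simp
  | hadd x y hx hy => simp only [map_add, hx, hy]
  | @htm p q hpq u a =>
    rw [rightHty_tm s h hpq (i' := q + 1) rfl, map_smul, mapLin_tm, mapLin_tm,
      rightHty_tm s' h hpq (i' := q + 1) rfl, hg]

/-- The contraction of the kernel of `Tot (L ⊗ M) ⟶ Tot (L' ⊗ M)` induced by a splitting of
`L ⟶ L'`. -/
def contractionLeft {p : L ⟶ L'} (S : DGLA.Splitting p) (Φ : M.Filt) :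
    DGLA.Contraction (Tot.map p (𝟙 M)) (Tot.filt L Φ) where
  s h := leftHty M S.s h
  map_s {i j} h x := by
    change X L M i at x
    change mapLin p.f (NCdga.Hom.f (𝟙 M)) j (leftHty M S.s h x) = 0
    rw [mapLin_comp_leftHty _ S.s (fun _ => 0) (fun h x => S.map_s h x)]
    generalize mapLin p.f (NCdga.Hom.f (𝟙 M)) i x = y
    induction y using ind with
    | h0 => simp
    | hadd x y hx hy => simp only [map_add, hx, hy, add_zero]
    | @htm p q hpq u a =>
      rw [leftHty_tm _ h hpq (p' := p - 1) (by omega), LinearMap.zero_apply, tm_zero_left]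
  s_mem {i j} h {r x} hx := by
    refine map_mem (L := L) Φ (leftHty M S.s h) (filtStep L Φ r j) (fun {p q} hpq u a ha => ?_) hx
    rw [leftHty_tm S.s h hpq (p' := p - 1) (by omega)]
    exact tm_mem Φ _ _ ha
  hty {i j l} h h' x hx := by
    change X L M i at x
    have e := leftHty_hty (M := M) (π := fun i => S.τ i ∘ₗ p.f i) S.hty h h' x
    have e' : mapLin (fun i => S.τ i ∘ₗ p.f i) (fun i => LinearMap.id (M := M.X i)) i x = 0 := by
      have hx' : mapLin p.f (NCdga.Hom.f (𝟙 M)) i x = 0 := hx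
      have := mapLin_comp p.f (NCdga.Hom.f (𝟙 M)) S.τ (fun i => LinearMap.id (M := M.X i)) x
      rw [hx', map_zero] at this
      exact this.symm
    rw [e', sub_zero] at e
    exact e

/-- The contraction of the kernel of `Tot (L ⊗ M) ⟶ Tot (L ⊗ M')` induced by a homotopy from a
composition `M ⟶ M' ⟶ M` to the identity. -/
def contractionRight (L : DGLA k) {g : M ⟶ M'} (c : ∀ i, M'.X i →ₗ[k] M.X i)
    (s : ∀ {i j : ℤ}, i + 1 = j → M.X i →ₗ[k] M.X j)
    (hg : ∀ {i j : ℤ} (h : i + 1 = j) x, g.f j (s h x) = 0)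
    (hs : ∀ {i j l : ℤ} (h : i + 1 = j) (h' : l + 1 = i) (x : M.X i),
      M.d h (s h x) + s h' (M.d h' x) = x - c i (g.f i x)) (Φ : M.Filt)
    (hΦ : ∀ {i j : ℤ} (h : i + 1 = j) {r : ℕ} {x : M.X i}, x ∈ Φ.F r i → s h x ∈ Φ.F r j) :
    DGLA.Contraction (Tot.map (𝟙 L) g) (Tot.filt L Φ) where
  s h := rightHty L s h
  map_s {i j} h x := by
    change X L M i at x
    change mapLin (DGLA.Hom.f (𝟙 L)) g.f j (rightHty L s h x) = 0
    rw [mapLin_comp_rightHty _ s (fun _ => 0) (fun h x => hg h x)]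
    generalize mapLin (DGLA.Hom.f (𝟙 L)) g.f i x = y
    induction y using ind with
    | h0 => simp
    | hadd x y hx hy => simp only [map_add, hx, hy, add_zero]
    | @htm p q hpq u a =>
      rw [rightHty_tm _ h hpq (i' := q + 1) rfl, LinearMap.zero_apply, tm_zero_right, smul_zero]
  s_mem {i j} h {r x} hx := by
    refine map_mem (L := L) Φ (rightHty L s h) (filtStep L Φ r j) (fun {p q} hpq u a ha => ?_) hx
    rw [rightHty_tm s h hpq (i' := q + 1) rfl]
    exact Submodule.smul_mem _ _ (tm_mem Φ _ _ (hΦ _ ha))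
  hty {i j l} h h' x hx := by
    change X L M i at x
    have e := rightHty_hty (L := L) (π := fun i => c i ∘ₗ g.f i) hs h h' x
    have e' : mapLin (fun i => LinearMap.id (M := L.X i)) (fun i => c i ∘ₗ g.f i) i x = 0 := by
      have hx' : mapLin (DGLA.Hom.f (𝟙 L)) g.f i x = 0 := hx
      have := mapLin_comp (DGLA.Hom.f (𝟙 L)) g.f (fun i => LinearMap.id (M := L.X i)) c x
      rw [hx', map_zero] at this
      exact this.symm
    rw [e', sub_zero] at e
    exact e

end Tot

end

end Koszul

namespace Koszul

noncomputable section

/-! ### Deformations and surjective quasi-isomorphisms -/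

variable {k : Type u} [Field k]

/-- The action of `Gg(L,A)` on `mc(L,A)`, for a pro-object `A`. -/
def gaugeAct [CharZero k] {L : DGLA k} {A : ProDgArt k} (x : A.eval ((ggArt k).obj L))
    (ω : A.eval ((mcArt k).obj L)) : A.eval ((mcArt k).obj L) where
  app X := ↾fun b =>
    (⟨DGLA.gauge (Tot.dgla L X.unop.unop.maxIdeal) (x.app X b)
      (show (Tot.dgla L X.unop.unop.maxIdeal).MC from ω.app X b).1,
      DGLA.gauge_isMC (ad_isNilpotent L _ _)
        (show (Tot.dgla L X.unop.unop.maxIdeal).MC from ω.app X b).2⟩ :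
      (Tot.dgla L X.unop.unop.maxIdeal).MC)
  naturality X Y f := by
    ext b
    have hx := ConcreteCategory.congr_hom (x.naturality f) b
    have hω := ConcreteCategory.congr_hom (ω.naturality f) b
    refine Subtype.ext ?_
    have e := DGLA.Hom.map_gauge (Tot.map (𝟙 L) (DgArt.mapIdeal f.unop.unop)) (x.app X b)
      (show (Tot.dgla L X.unop.unop.maxIdeal).MC from ω.app X b).1 (ad_isNilpotent L _ _)
    refine Eq.trans ?_ e.symm
    exact congrArg₂ (DGLA.gauge (Tot.dgla L Y.unop.unop.maxIdeal)) hx (congrArg Subtype.val hω)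

theorem gaugeRel_gaugeAct [CharZero k] {L : DGLA k} {A : ProDgArt k}
    (x : A.eval ((ggArt k).obj L)) (ω : A.eval ((mcArt k).obj L)) :
    gaugeRel L A ω (gaugeAct x ω) := ⟨x, fun _ _ => rfl⟩

section splitting

variable {L M : DGLA k} {p : L ⟶ M} (S : DGLA.Splitting p)

/-- The linear section of a morphism of DGLAs, on the degree zero parts of totalisations. -/
def sectionGg : (ggArt k).obj M ⟶ (ggArt k).obj L where
  app B := ↾fun x : Tot.X M B.maxIdeal 0 =>
    (Tot.mapLin S.σ (NCdga.Hom.f (𝟙 B.maxIdeal)) 0 x : Tot.X L B.maxIdeal 0)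
  naturality B B' f := by
    ext x
    refine (Tot.mapLin_comp _ _ _ _ _).trans (Eq.trans ?_ (Tot.mapLin_comp _ _ _ _ _).symm)
    rfl

theorem map_sectionGg (B : DgArt k) (x : Tot.X M B.maxIdeal 0) :
    Tot.mapLin p.f (NCdga.Hom.f (𝟙 B.maxIdeal)) 0 ((sectionGg S).app B x) = x := by
  refine (Tot.mapLin_comp _ _ _ _ _).trans (Eq.trans ?_ (Tot.mapLin_id x))
  exact congrArg (fun f => Tot.mapLin f (fun i => LinearMap.id (M := B.maxIdeal.X i)) 0 x)
    (funext fun q => LinearMap.ext (S.map_σ q))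

theorem map_σ_one (B : DgArt k) (ω : Tot.X M B.maxIdeal 1) :
    DGLA.Hom.f (Tot.map p (𝟙 B.maxIdeal)) 1
      (Tot.mapLin S.σ (NCdga.Hom.f (𝟙 B.maxIdeal)) 1 ω) = ω := by
  refine (Tot.mapLin_comp _ _ _ _ _).trans (Eq.trans ?_ (Tot.mapLin_id ω))
  exact congrArg (fun f => Tot.mapLin f (fun i => LinearMap.id (M := B.maxIdeal.X i)) 1 ω)
    (funext fun q => LinearMap.ext (S.map_σ q))

theorem map_leftHty {B B' : DgArt k} (f : B ⟶ B') {n m : ℤ} (h : m + 1 = n)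
    (x : Tot.X L B.maxIdeal n) :
    DGLA.Hom.f (Tot.map (𝟙 L) (DgArt.mapIdeal f)) m (Tot.leftHty B.maxIdeal S.s h x) =
      Tot.leftHty B'.maxIdeal S.s h (DGLA.Hom.f (Tot.map (𝟙 L) (DgArt.mapIdeal f)) n x) :=
  Tot.mapLin_comp_leftHty (f := DGLA.Hom.f (𝟙 L)) _ S.s S.s (fun _ _ => rfl) h x

variable [CharZero k]

/-- A natural lift of Maurer-Cartan elements along a surjective quasi-isomorphism. -/
def liftMc : (mcArt k).obj M ⟶ (mcArt k).obj L where
  app B := ↾fun ω : (Tot.dgla M B.maxIdeal).MC =>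
    (⟨DGLA.liftFix ((Tot.contractionLeft S B.adicFilt).s (show (1 : ℤ) + 1 = 2 by norm_num))
      (Tot.mapLin S.σ (NCdga.Hom.f (𝟙 B.maxIdeal)) 1 ω.1),
      (DGLA.liftFix_isMC (Tot.contractionLeft S B.adicFilt)
        (by rw [map_σ_one S B ω.1]; exact ω.2) _).1⟩ : (Tot.dgla L B.maxIdeal).MC)
  naturality B B' f := by
    ext ω
    change (Tot.dgla M B.maxIdeal).MC at ω
    refine Subtype.ext ?_
    have e := DGLA.map_liftFix (Tot.contractionLeft S B.adicFilt)
      (Tot.map (𝟙 L) (DgArt.mapIdeal f)) (show (1 : ℤ) + 1 = 2 by norm_num)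
      (s' := (Tot.contractionLeft S B'.adicFilt).s (show (1 : ℤ) + 1 = 2 by norm_num))
      (fun x => map_leftHty S f (show (1 : ℤ) + 1 = 2 by norm_num) x)
      (ω := Tot.mapLin S.σ (NCdga.Hom.f (𝟙 B.maxIdeal)) 1 ω.1)
      (by rw [map_σ_one S B ω.1]; exact ω.2)
    refine Eq.trans (congrArg (DGLA.liftFix _) ?_) e.symm
    refine (Tot.mapLin_comp _ _ _ _ _).trans (Eq.trans ?_ (Tot.mapLin_comp _ _ _ _ _).symm)
    rfl

theorem map_liftMc (B : DgArt k) (ω : (Tot.dgla M B.maxIdeal).MC) :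
    ((mcArt k).map p).app B ((liftMc S).app B ω) = ω :=
  Subtype.ext ((DGLA.liftFix_isMC (Tot.contractionLeft S B.adicFilt)
    (by rw [map_σ_one S B ω.1]; exact ω.2) _).2.trans (map_σ_one S B ω.1))

/-- Maurer-Cartan elements with the same image under a surjective quasi-isomorphism are gauge
equivalent. -/
theorem gaugeRel_of_map_eq (S : DGLA.Splitting p) (A : ProDgArt k) (ω ω' : A.eval ((mcArt k).obj L))
    (h : ω' ≫ Functor.whiskerLeft (unopUnop (DgArt k)) ((mcArt k).map p) =
      ω ≫ Functor.whiskerLeft (unopUnop (DgArt k)) ((mcArt k).map p)) :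
    gaugeRel L A ω ω' := by
  have hp : ∀ (X : (DgArt k)ᵒᵖᵒᵖ) (b : A.h.obj X), DGLA.Hom.f (Tot.map p (𝟙 X.unop.unop.maxIdeal)) 1
      (show (Tot.dgla L X.unop.unop.maxIdeal).MC from ω'.app X b).1 =
      DGLA.Hom.f (Tot.map p (𝟙 X.unop.unop.maxIdeal)) 1
      (show (Tot.dgla L X.unop.unop.maxIdeal).MC from ω.app X b).1 := by
    intro X b
    have e := ConcreteCategory.congr_hom (NatTrans.congr_app h X) b
    exact congrArg Subtype.val e
  refine ⟨⟨fun X => ↾fun b =>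
    (DGLA.gaugeFix ((Tot.contractionLeft S X.unop.unop.adicFilt).s (zero_add 1))
      (show (Tot.dgla L X.unop.unop.maxIdeal).MC from ω.app X b).1
      (show (Tot.dgla L X.unop.unop.maxIdeal).MC from ω'.app X b).1 :
      (Tot.dgla L X.unop.unop.maxIdeal).X 0), fun X Y f => ?_⟩, fun B b => ?_⟩
  · ext b
    have hω := ConcreteCategory.congr_hom (ω.naturality f) b
    have hω' := ConcreteCategory.congr_hom (ω'.naturality f) b
    have e := DGLA.map_gaugeFix (Tot.contractionLeft S X.unop.unop.adicFilt)
      (Tot.map (𝟙 L) (DgArt.mapIdeal f.unop.unop))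
      (s' := (Tot.contractionLeft S Y.unop.unop.adicFilt).s (zero_add 1))
      (fun x => map_leftHty S f.unop.unop (zero_add 1) x)
      (show (Tot.dgla L X.unop.unop.maxIdeal).MC from ω.app X b).2
      (show (Tot.dgla L X.unop.unop.maxIdeal).MC from ω'.app X b).2 (hp X b)
    refine Eq.trans ?_ e.symm
    exact congrArg₂ (DGLA.gaugeFix _) (congrArg Subtype.val hω) (congrArg Subtype.val hω')
  · exact (DGLA.gauge_gaugeFix (Tot.contractionLeft S B.adicFilt)
      (show (Tot.dgla L B.maxIdeal).MC from ω.app (op (op B)) b).2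
      (show (Tot.dgla L B.maxIdeal).MC from ω'.app (op (op B)) b).2 (hp (op (op B)) b)).symm

/-- Deformations are invariant under surjective quasi-isomorphisms: natural lifts give an inverse,
which is well defined since gauge transformations lift linearly and lifts of the same element are
gauge equivalent. -/
theorem ddef_map_bijective_of_splitting (S : DGLA.Splitting p) (A : ProDgArt k) :
    Function.Bijective (((ddef k).obj A).map p) := by
  have hlift : ∀ μ : A.eval ((mcArt k).obj M),
      (μ ≫ Functor.whiskerLeft (unopUnop (DgArt k)) (liftMc S)) ≫
        Functor.whiskerLeft (unopUnop (DgArt k)) ((mcArt k).map p) = μ := by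
    intro μ
    ext X b
    exact map_liftMc S _ (μ.app X b)
  have hinv : ∃ g : ((ddef k).obj A).obj M → ((ddef k).obj A).obj L, ∀ μ, g (ddef.mk μ) =
      ddef.mk (μ ≫ Functor.whiskerLeft (unopUnop (DgArt k)) (liftMc S)) := by
    refine ⟨Quot.lift (fun μ => ddef.mk (μ ≫ Functor.whiskerLeft (unopUnop (DgArt k)) (liftMc S)))
      ?_, fun μ => rfl⟩
    rintro μ μ' ⟨x, hx⟩
    let x' : A.eval ((ggArt k).obj L) :=
      x ≫ Functor.whiskerLeft (unopUnop (DgArt k)) (sectionGg S)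
    refine (Quot.sound (gaugeRel_gaugeAct x' _)).trans (Quot.sound (gaugeRel_of_map_eq S A _ _ ?_))
    rw [hlift]
    ext X b
    refine Subtype.ext ((hx X.unop.unop b).trans ?_)
    refine Eq.trans ?_ (DGLA.Hom.map_gauge (Tot.map p (𝟙 X.unop.unop.maxIdeal)) _ _
      (ad_isNilpotent L _ _)).symm
    refine congrArg₂ (DGLA.gauge (Tot.dgla M X.unop.unop.maxIdeal)) ?_ ?_
    · exact (map_sectionGg S X.unop.unop (x.app X b)).symm
    · exact (congrArg Subtype.val (map_liftMc S X.unop.unop (μ.app X b))).symm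
  obtain ⟨g, hg⟩ := hinv
  refine Function.bijective_iff_has_inverse.mpr ⟨g, fun a => ?_, fun a => ?_⟩
  · induction a using Quot.ind with | mk ω =>
    refine (hg _).trans (Quot.sound (gaugeRel_of_map_eq S A _ _ ?_))
    exact (hlift _).symm
  · induction a using Quot.ind with | mk μ =>
    refine (congrArg _ (hg μ)).trans ?_
    exact congrArg (Quot.mk _) (hlift μ)

end splitting

end

end Koszul

namespace Koszul

noncomputable section

/-! ### Polynomial differential forms on the line -/

variable {k : Type u} [Field k]

/-- The primitive of a polynomial that vanishes at the origin. -/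
def primitive (k : Type u) [Field k] : Polynomial k →ₗ[k] Polynomial k :=
  (Polynomial.basisMonomials k).constr k fun n => Polynomial.monomial (n + 1) ((n + 1 : k)⁻¹)

theorem primitive_monomial (n : ℕ) :
    primitive k (Polynomial.monomial n 1) = Polynomial.monomial (n + 1) ((n + 1 : k)⁻¹) := by
  have := (Polynomial.basisMonomials k).constr_basis k
    (fun n => Polynomial.monomial (n + 1) ((n + 1 : k)⁻¹)) n
  rwa [Polynomial.coe_basisMonomials] at this

theorem linearMap_ext_monomial {V : Type*} [AddCommMonoid V] [Module k V]
    {f g : Polynomial k →ₗ[k] V}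
    (h : ∀ n, f (Polynomial.monomial n 1) = g (Polynomial.monomial n 1)) : f = g :=
  (Polynomial.basisMonomials k).ext fun n => by simpa using h n

theorem derivative_primitive [CharZero k] (p : Polynomial k) :
    Polynomial.derivative (primitive k p) = p := by
  have : Polynomial.derivative ∘ₗ primitive k = LinearMap.id := linearMap_ext_monomial fun n => by
    have hn : (n + 1 : k) ≠ 0 := Nat.cast_add_one_ne_zero n
    simp [primitive_monomial, hn]
  exact LinearMap.congr_fun this p

theorem primitive_derivative [CharZero k] (p : Polynomial k) :
    primitive k (Polynomial.derivative p) = p - Polynomial.C (p.eval 0) := by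
  have : primitive k ∘ₗ Polynomial.derivative =
      LinearMap.id - Polynomial.monomial 0 ∘ₗ Polynomial.leval 0 :=
    linearMap_ext_monomial fun n => by
    cases n with
    | zero => simp [Polynomial.leval]
    | succ n =>
      have hn : (n + 1 : k) ≠ 0 := Nat.cast_add_one_ne_zero n
      have h1 : Polynomial.derivative (Polynomial.monomial (n + 1) (1 : k)) =
          (n + 1 : k) • Polynomial.monomial n 1 := by
        simp [Polynomial.smul_monomial]
      rw [LinearMap.comp_apply, h1, map_smul, primitive_monomial]
      simp [Polynomial.leval, Polynomial.smul_monomial, hn]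
  exact LinearMap.congr_fun this p

theorem eval_zero_primitive (p : Polynomial k) : (primitive k p).eval 0 = 0 := by
  have : Polynomial.leval 0 ∘ₗ primitive k = 0 := linearMap_ext_monomial fun n => by
    simp [primitive_monomial, Polynomial.leval]
  exact LinearMap.congr_fun this p

namespace NCdga

/-- The polynomials over a cdga, in a variable of degree zero and with zero differential. -/
def poly (M : NCdga k) : NCdga k where
  X n := M.X n ⊗[k] Polynomial k
  d h := LinearMap.rTensor _ (M.d h)
  mul h := TensorProduct.map₂ (M.mul h) (LinearMap.mul k (Polynomial k))
  d_d h h' x := by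
    induction x using TensorProduct.induction_on with
    | zero => simp
    | add x y hx hy => simp only [map_add, hx, hy, add_zero]
    | tmul a p => simp [M.d_d]
  mul_comm h h' x y := by
    induction x using TensorProduct.induction_on with
    | zero => simp
    | add x x' hx hx' => simp only [map_add, LinearMap.add_apply, hx, hx', smul_add]
    | tmul a p =>
      induction y using TensorProduct.induction_on with
      | zero => simp
      | add x x' hx hx' => simp only [map_add, LinearMap.add_apply, hx, hx', smul_add]
      | tmul b q =>
        simp [M.mul_comm h h' a b, _root_.mul_comm p q, TensorProduct.smul_tmul']
  mul_assoc hb h₂ ha h₁ x y z := by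
    induction x using TensorProduct.induction_on with
    | zero => simp
    | add x x' hx hx' => simp only [map_add, LinearMap.add_apply, hx, hx']
    | tmul a p =>
      induction y using TensorProduct.induction_on with
      | zero => simp
      | add x x' hx hx' => simp only [map_add, LinearMap.add_apply, hx, hx']
      | tmul b q =>
        induction z using TensorProduct.induction_on with
        | zero => simp
        | add x x' hx hx' => simp only [map_add, hx, hx']
        | tmul c r => simp [M.mul_assoc hb h₂ ha h₁, _root_.mul_assoc]
  d_mul h hn hi hj h₁ h₂ x y := by
    induction x using TensorProduct.induction_on with
    | zero => simp
    | add x x' hx hx' =>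
      simp only [map_add, LinearMap.add_apply, hx, hx', smul_add]
      abel
    | tmul a p =>
      induction y using TensorProduct.induction_on with
      | zero => simp
      | add x x' hx hx' =>
        simp only [map_add, hx, hx', smul_add]
        abel
      | tmul b q =>
        simp [M.d_mul h hn hi hj h₁ h₂, TensorProduct.add_tmul, TensorProduct.smul_tmul']

/-- A derivation of degree zero that commutes with the differential. -/
structure Deriv (R : NCdga k) where
  D : ∀ {i j : ℤ}, i = j → R.X i →ₗ[k] R.X j
  map_d : ∀ {i j i' j' : ℤ} (h : j + 1 = i) (hi : i = i') (hj : j = j') (h' : j' + 1 = i')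
    (x : R.X i), D hj (R.d h x) = R.d h' (D hi x)
  leibniz : ∀ {i j n i' j' n' : ℤ} (h : i + j = n) (hi : i = i') (hj : j = j') (hn : n = n')
    (h₁ : i' + j = n') (h₂ : i + j' = n') (x : R.X i) (y : R.X j),
    D hn (R.mul h x y) = R.mul h₁ (D hi x) y + R.mul h₂ x (D hj y)

/-- The derivative with respect to the variable. -/
def polyDeriv (M : NCdga k) : M.poly.Deriv where
  D {i j} h := h ▸ LinearMap.lTensor (M.X i) Polynomial.derivative
  map_d {i j _ _} h hi hj h' x := by
    subst hi hj
    change M.X i ⊗[k] Polynomial k at x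
    change LinearMap.lTensor _ _ (LinearMap.rTensor _ _ x) =
      LinearMap.rTensor _ _ (LinearMap.lTensor _ _ x)
    induction x using TensorProduct.induction_on with
    | zero => simp
    | add x y hx hy => simp only [map_add, hx, hy]
    | tmul a p => simp
  leibniz {i j n i' j' n'} h hi hj hn h₁ h₂ x y := by
    subst hi hj hn
    change M.X i ⊗[k] Polynomial k at x
    change M.X j ⊗[k] Polynomial k at y
    change LinearMap.lTensor _ _ (TensorProduct.map₂ (M.mul h) (LinearMap.mul k _) x y) =
      TensorProduct.map₂ (M.mul h) (LinearMap.mul k _) (LinearMap.lTensor _ _ x) y +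
        TensorProduct.map₂ (M.mul h) (LinearMap.mul k _) x (LinearMap.lTensor _ _ y)
    induction x using TensorProduct.induction_on with
    | zero => simp
    | add x x' hx hx' =>
      simp only [map_add, LinearMap.add_apply, hx, hx']
      abel
    | tmul a p =>
      induction y using TensorProduct.induction_on with
      | zero => simp
      | add x x' hx hx' =>
        simp only [map_add, hx, hx']
        abel
      | tmul b q => simp [TensorProduct.tmul_add]

theorem sgn_succ {i j : ℤ} (h : j + 1 = i) : sgn k i = -sgn k j := by
  rw [← h, sgn_add, sgn_one, mul_neg_one]

/-- The cdga `R ⊕ R dt` obtained by adjoining the differential `dt`, of degree `-1` and square zero,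
of a variable `t` to a cdga with a derivation `∂/∂t`.  The pair `(f, g)` stands for `f + g dt`. -/
def adjoinDt (R : NCdga k) (δ : R.Deriv) : NCdga k where
  X n := R.X n × R.X (n + 1)
  d {i j} h := (R.d h ∘ₗ LinearMap.fst k _ _).prod
    (R.d (by omega) ∘ₗ LinearMap.snd k _ _ + sgn k i • δ.D h.symm ∘ₗ LinearMap.fst k _ _)
  mul {i j n} h := LinearMap.mk₂ k
    (fun x y => (R.mul h x.1 y.1,
      R.mul (show i + (j + 1) = n + 1 by omega) x.1 y.2
        + sgn k j • R.mul (show i + 1 + j = n + 1 by omega) x.2 y.1))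
    (fun x x' y => Prod.ext (by simp) (by
      simp only [Prod.fst_add, Prod.snd_add, map_add, LinearMap.add_apply, smul_add]; abel))
    (fun c x y => Prod.ext (by simp) (by simp [smul_comm c (sgn k j)]))
    (fun x y y' => Prod.ext (by simp) (by
      simp only [Prod.fst_add, Prod.snd_add, map_add, smul_add]; abel))
    (fun c x y => Prod.ext (by simp) (by simp [smul_comm c (sgn k j)]))
  d_d {i j l} h h' x := by
    refine Prod.ext (R.d_d h h' x.1) ?_
    simp only [LinearMap.prod_apply, Function.prod_apply, LinearMap.comp_apply,
      LinearMap.add_apply, LinearMap.smul_apply, LinearMap.fst_apply, LinearMap.snd_apply, map_add,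
      map_smul, R.d_d, δ.map_d h h.symm h'.symm (by omega), sgn_succ (k := k) h]
    simp
  mul_comm {i j n} h h' x y := by
    refine Prod.ext (R.mul_comm h h' x.1 y.1) ?_
    simp only [LinearMap.mk₂_apply, Prod.smul_snd]
    rw [R.mul_comm _ (show j + 1 + i = n + 1 by omega) x.1 y.2,
      R.mul_comm _ (show j + (i + 1) = n + 1 by omega) x.2 y.1, smul_add, smul_smul, smul_smul,
      ← sgn_add, ← sgn_add, sgn_congr k (a := j + (i + 1) * j) (b := i * j) j (by ring),
      sgn_congr k (a := i * (j + 1)) (b := i * j + i) 0 (by ring)]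
    exact _root_.add_comm _ _
  mul_assoc {p q r a b n} hb h₂ ha h₁ x y z := by
    refine Prod.ext (R.mul_assoc hb h₂ ha h₁ x.1 y.1 z.1) ?_
    simp only [LinearMap.mk₂_apply, map_add, map_smul, LinearMap.add_apply, LinearMap.smul_apply,
      smul_add]
    have hs : sgn k a = sgn k r * sgn k q := by rw [← sgn_add, ← ha, _root_.add_comm]
    rw [R.mul_assoc hb _ (show q + (r + 1) = a + 1 by omega) (by omega),
      R.mul_assoc (show p + (q + 1) = b + 1 by omega) _ (show q + 1 + r = a + 1 by omega)
        (by omega),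
      R.mul_assoc (show p + 1 + q = b + 1 by omega) _ ha (by omega), smul_smul, hs]
    exact (_root_.add_assoc (G := R.X (n + 1)) _ _ _).symm
  d_mul {i j n i' j' n'} h hn hi hj h₁ h₂ x y := by
    refine Prod.ext (R.d_mul h hn hi hj h₁ h₂ x.1 y.1) ?_
    simp only [LinearMap.mk₂_apply, LinearMap.prod_apply, Function.prod_apply,
      LinearMap.comp_apply, LinearMap.add_apply, LinearMap.smul_apply, LinearMap.fst_apply,
      LinearMap.snd_apply, map_add, map_smul, smul_add, Prod.snd_add, Prod.smul_snd]
    have hs : sgn k n = -(sgn k i * sgn k j') := by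
      rw [← h, sgn_add, sgn_succ (k := k) hj, mul_neg]
    have key : ∀ a b c e f g : R.X (n' + 1),
        a + b + (-c + e) + (-f + -g) = a + (-c + -f) + (b + -g + e) := by
      intros
      abel
    rw [R.d_mul _ _ hi (show j' + 1 + 1 = j + 1 by omega) (by omega) (by omega) x.1 y.2,
      R.d_mul _ _ (show i' + 1 + 1 = i + 1 by omega) hj (by omega) (by omega) x.2 y.1,
      δ.leibniz h hi.symm hj.symm hn.symm (by omega) (by omega), smul_add, smul_add, smul_smul,
      smul_smul, smul_smul, smul_smul, hs, sgn_succ (k := k) hj,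
      sgn_succ (k := k) (show i + 1 = i + 1 from rfl)]
    simp only [mul_neg, neg_mul, neg_smul, neg_neg, _root_.mul_comm (sgn k j')]
    exact key _ _ _ _ _ _

end NCdga

end

end Koszul

namespace Koszul

noncomputable section

namespace NCdga

variable {k : Type u} [Field k] (M : NCdga k)

/-- Evaluation of polynomials at `c`. -/
def evPoly (c : k) (n : ℤ) : M.X n ⊗[k] Polynomial k →ₗ[k] M.X n :=
  (TensorProduct.rid k (M.X n)).toLinearMap ∘ₗ LinearMap.lTensor (M.X n) (Polynomial.leval c)

@[simp] theorem evPoly_tmul (c : k) {n : ℤ} (a : M.X n) (p : Polynomial k) :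
    M.evPoly c n (a ⊗ₜ p) = p.eval c • a := by
  simp [evPoly, Polynomial.leval]

/-- The cdga `M[t, dt]` of polynomial differential forms on the line with values in `M`. -/
def path : NCdga k := M.poly.adjoinDt M.polyDeriv

/-- The polynomial `a p(t)`. -/
def polyTm (p : Polynomial k) (n : ℤ) : M.X n →ₗ[k] M.poly.X n :=
  (TensorProduct.mk k (M.X n) (Polynomial k)).flip p

/-- The form `a p(t)`. -/
def form (p : Polynomial k) (n : ℤ) : M.X n →ₗ[k] M.path.X n :=
  LinearMap.inl k (M.poly.X n) (M.poly.X (n + 1)) ∘ₗ M.polyTm p n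

theorem polyDeriv_tmul {i j : ℤ} (h : i = j) (a : M.X i) :
    M.polyDeriv.D h (M.polyTm 1 i a) = 0 := by
  subst h
  change LinearMap.lTensor (M.X i) Polynomial.derivative (a ⊗ₜ 1) = 0
  simp

/-- Evaluation of forms at the point `c` of the line. -/
def evPath (c : k) : M.path ⟶ M where
  f n := M.evPoly c n ∘ₗ LinearMap.fst k (M.poly.X n) (M.poly.X (n + 1))
  map_d {i j} h x := by
    obtain ⟨x, y⟩ := x
    change M.evPoly c j (LinearMap.rTensor _ (M.d h) x) = M.d h (M.evPoly c i x)
    change M.X i ⊗[k] Polynomial k at x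
    clear y
    induction x using TensorProduct.induction_on with
    | zero => simp
    | add x y hx hy => simp only [map_add, hx, hy]
    | tmul a p => simp
  map_mul {i j n} h x y := by
    obtain ⟨x, x'⟩ := x
    obtain ⟨y, y'⟩ := y
    change M.evPoly c n (TensorProduct.map₂ (M.mul h) (LinearMap.mul k _) x y) =
      M.mul h (M.evPoly c i x) (M.evPoly c j y)
    change M.X i ⊗[k] Polynomial k at x
    change M.X j ⊗[k] Polynomial k at y
    clear x' y'
    induction x using TensorProduct.induction_on with
    | zero => simp
    | add x x' hx hx' => simp only [map_add, LinearMap.add_apply, hx, hx']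
    | tmul a p =>
      induction y using TensorProduct.induction_on with
      | zero => simp
      | add x x' hx hx' => simp only [map_add, hx, hx']
      | tmul b q => simp [smul_smul, _root_.mul_comm]

theorem evPath_form (c : k) (p : Polynomial k) {n : ℤ} (a : M.X n) :
    (M.evPath c).f n (M.form p n a) = p.eval c • a := M.evPoly_tmul c a p

/-- The inclusion of the constant forms. -/
def constPath : M ⟶ M.path where
  f := M.form 1
  map_d {i j} h x := Prod.ext (LinearMap.rTensor_tmul _ _ _ _).symm (by
    change (0 : M.poly.X (j + 1)) = M.poly.d (show j + 1 + 1 = i + 1 by omega) 0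
      + sgn k i • M.polyDeriv.D h.symm (M.polyTm 1 i x)
    rw [polyDeriv_tmul, map_zero, smul_zero, add_zero])
  map_mul {i j n} h x y := Prod.ext (by
      change M.mul h x y ⊗ₜ[k] (1 : Polynomial k) =
        TensorProduct.map₂ (M.mul h) (LinearMap.mul k _) (x ⊗ₜ 1) (y ⊗ₜ 1)
      simp) (by
    change (0 : M.poly.X (n + 1)) =
      M.poly.mul (show i + (j + 1) = n + 1 by omega) (M.polyTm 1 i x) 0 +
        sgn k j • M.poly.mul (show i + 1 + j = n + 1 by omega) 0 (M.polyTm 1 j y)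
    rw [map_zero, map_zero, LinearMap.zero_apply, smul_zero, add_zero])

theorem evPath_constPath (c : k) {n : ℤ} (a : M.X n) :
    (M.evPath c).f n (M.constPath.f n a) = a := by
  refine (M.evPath_form c 1 a).trans ?_
  rw [Polynomial.eval_one, one_smul]

/-- Integration of polynomials. -/
def polyInt {i j : ℤ} (h : i = j) : M.poly.X i →ₗ[k] M.poly.X j :=
  h ▸ LinearMap.lTensor (M.X i) (primitive k)

theorem polyInt_d {i j i' j' : ℤ} (h : j + 1 = i) (hi : i = i') (hj : j = j') (h' : j' + 1 = i')
    (x : M.poly.X i) : M.polyInt hj (M.poly.d h x) = M.poly.d h' (M.polyInt hi x) := by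
  subst hi hj
  change M.X i ⊗[k] Polynomial k at x
  change LinearMap.lTensor _ _ (LinearMap.rTensor _ _ x) =
    LinearMap.rTensor _ _ (LinearMap.lTensor _ _ x)
  induction x using TensorProduct.induction_on with
  | zero => simp
  | add x y hx hy => simp only [map_add, hx, hy]
  | tmul a p => simp

theorem polyDeriv_polyInt [CharZero k] {i j : ℤ} (h : i = j) (h' : j = i) (x : M.poly.X i) :
    M.polyDeriv.D h' (M.polyInt h x) = x := by
  subst h
  change M.X i ⊗[k] Polynomial k at x
  change LinearMap.lTensor _ Polynomial.derivative (LinearMap.lTensor _ (primitive k) x) = x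
  induction x using TensorProduct.induction_on with
  | zero => simp
  | add x y hx hy => simp only [map_add, hx, hy]
  | tmul a p => simp [derivative_primitive]

theorem polyInt_polyDeriv [CharZero k] {i j : ℤ} (h : i = j) (h' : j = i) (x : M.poly.X i) :
    M.polyInt h' (M.polyDeriv.D h x) = x - M.polyTm 1 i (M.evPoly 0 i x) := by
  subst h
  change M.X i ⊗[k] Polynomial k at x
  change LinearMap.lTensor _ (primitive k) (LinearMap.lTensor _ Polynomial.derivative x) =
    x - M.evPoly 0 i x ⊗ₜ[k] (1 : Polynomial k)
  induction x using TensorProduct.induction_on with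
  | zero => simp
  | add x y hx hy => simp only [map_add, hx, hy, TensorProduct.add_tmul]; abel
  | tmul a p =>
    simp only [LinearMap.lTensor_tmul, primitive_derivative, evPoly_tmul, TensorProduct.tmul_sub,
      TensorProduct.smul_tmul]
    rw [Polynomial.smul_eq_C_mul, mul_one]

theorem evPoly_polyInt {i j : ℤ} (h : i = j) (x : M.poly.X i) :
    M.evPoly 0 j (M.polyInt h x) = 0 := by
  subst h
  change M.X i ⊗[k] Polynomial k at x
  change M.evPoly 0 i (LinearMap.lTensor _ (primitive k) x) = 0
  induction x using TensorProduct.induction_on with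
  | zero => simp
  | add x y hx hy => simp only [map_add, hx, hy, add_zero]
  | tmul a p => simp [eval_zero_primitive]

/-- The contraction of `M[t, dt]` onto `M` given by integration from `0`. -/
def pathHty {i j : ℤ} (h : i + 1 = j) : M.path.X i →ₗ[k] M.path.X j :=
  LinearMap.inl k (M.poly.X j) (M.poly.X (j + 1)) ∘ₗ
    (-sgn k i • M.polyInt h) ∘ₗ LinearMap.snd k (M.poly.X i) (M.poly.X (i + 1))

theorem evPath_pathHty {i j : ℤ} (h : i + 1 = j) (x : M.path.X i) :
    (M.evPath 0).f j (M.pathHty h x) = 0 := by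
  refine ((M.evPoly 0 j).map_smul (-sgn k i) (M.polyInt h x.2)).trans ?_
  exact (congrArg _ (M.evPoly_polyInt h x.2)).trans (smul_zero _)

theorem sgn_mul_self (n : ℤ) : sgn k n * sgn k n = 1 := by
  rw [← sgn_add, ← sgn_zero]
  exact sgn_congr k n (by ring)

theorem pathHty_hty [CharZero k] {i j l : ℤ} (h : i + 1 = j) (h' : l + 1 = i) (x : M.path.X i) :
    M.path.d h (M.pathHty h x) + M.pathHty h' (M.path.d h' x) =
      x - M.constPath.f i ((M.evPath 0).f i x) := by
  refine Prod.ext ?_ ?_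
  · change M.poly.d h (-sgn k i • M.polyInt h x.2) + -sgn k l • M.polyInt h'
      (M.poly.d (by omega) x.2 + sgn k i • M.polyDeriv.D h'.symm x.1) =
      x.1 - M.polyTm 1 i (M.evPoly 0 i x.1)
    rw [map_add, map_smul, map_smul, polyInt_polyDeriv, M.polyInt_d _ h h' h, smul_add, smul_smul,
      sgn_succ (k := k) h', neg_mul_neg, sgn_mul_self, one_smul, neg_neg, ← add_assoc,
      ← add_smul, add_neg_cancel, zero_smul, zero_add]
  · change (M.poly.d (show i + 1 + 1 = j + 1 by omega) 0 +
      sgn k j • M.polyDeriv.D h.symm (-sgn k i • M.polyInt h x.2)) + 0 =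
      x.2 - 0
    rw [map_zero, map_smul, polyDeriv_polyInt, smul_smul, sgn_succ (k := k) h, neg_mul_neg,
      sgn_mul_self, one_smul, zero_add, add_zero, sub_zero]

/-- The functoriality of `M[t, dt]`. -/
def pathMap {M M' : NCdga k} (F : M ⟶ M') : M.path ⟶ M'.path where
  f n := LinearMap.prodMap (M := M.poly.X n) (M₂ := M.poly.X (n + 1)) (M₃ := M'.poly.X n)
    (M₄ := M'.poly.X (n + 1)) (LinearMap.rTensor _ (F.f n)) (LinearMap.rTensor _ (F.f (n + 1)))
  map_d {i j} h x := by
    have hd : ∀ {i j : ℤ} (h : j + 1 = i) (x : M.X i ⊗[k] Polynomial k),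
        LinearMap.rTensor (Polynomial k) (F.f j) (M.poly.d h x) =
          M'.poly.d h (LinearMap.rTensor (Polynomial k) (F.f i) x) := by
      intro i j h x
      change LinearMap.rTensor _ _ (LinearMap.rTensor _ _ x) =
        LinearMap.rTensor _ _ (LinearMap.rTensor _ _ x)
      induction x using TensorProduct.induction_on with
      | zero => simp
      | add x y hx hy => simp only [map_add, hx, hy]
      | tmul a p => simp [F.map_d]
    have hD : ∀ {i j : ℤ} (h : i = j) (x : M.X i ⊗[k] Polynomial k),
        LinearMap.rTensor (Polynomial k) (F.f j) (M.polyDeriv.D h x) =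
          M'.polyDeriv.D h (LinearMap.rTensor (Polynomial k) (F.f i) x) := by
      intro i j h x
      subst h
      change LinearMap.rTensor _ _ (LinearMap.lTensor _ _ x) =
        LinearMap.lTensor _ _ (LinearMap.rTensor _ _ x)
      induction x using TensorProduct.induction_on with
      | zero => simp
      | add x y hx hy => simp only [map_add, hx, hy]
      | tmul a p => simp
    refine Prod.ext (hd h x.1) ?_
    refine ((LinearMap.rTensor (Polynomial k) (F.f (j + 1))).map_add _ _).trans ?_
    refine congrArg₂ (· + ·) (hd _ x.2) ?_
    exact ((LinearMap.rTensor (Polynomial k) (F.f (j + 1))).map_smul _ _).trans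
      (congrArg (sgn k i • ·) (hD h.symm x.1))
  map_mul {i j n} h x y := by
    have hm : ∀ {i j n : ℤ} (h : i + j = n) (x : M.X i ⊗[k] Polynomial k)
        (y : M.X j ⊗[k] Polynomial k),
        LinearMap.rTensor (Polynomial k) (F.f n) (M.poly.mul h x y) =
          M'.poly.mul h (LinearMap.rTensor (Polynomial k) (F.f i) x)
            (LinearMap.rTensor (Polynomial k) (F.f j) y) := by
      intro i j n h x y
      change LinearMap.rTensor _ _ (TensorProduct.map₂ (M.mul h) (LinearMap.mul k _) x y) =
        TensorProduct.map₂ (M'.mul h) (LinearMap.mul k _) _ _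
      induction x using TensorProduct.induction_on with
      | zero => simp
      | add x x' hx hx' => simp only [map_add, LinearMap.add_apply, hx, hx']
      | tmul a p =>
        induction y using TensorProduct.induction_on with
        | zero => simp
        | add x x' hx hx' => simp only [map_add, hx, hx']
        | tmul b q => simp [F.map_mul]
    refine Prod.ext (hm h x.1 y.1) ?_
    refine ((LinearMap.rTensor (Polynomial k) (F.f (n + 1))).map_add _ _).trans ?_
    refine congrArg₂ (· + ·) (hm _ x.1 y.2) ?_
    exact ((LinearMap.rTensor (Polynomial k) (F.f (n + 1))).map_smul _ _).trans
      (congrArg (sgn k j • ·) (hm _ x.2 y.1))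

theorem pathMap_form {M M' : NCdga k} (F : M ⟶ M') (p : Polynomial k) {n : ℤ} (a : M.X n) :
    (pathMap F).f n (M.form p n a) = M'.form p n (F.f n a) :=
  Prod.ext (LinearMap.rTensor_tmul _ _ _ _)
    (LinearMap.map_zero (LinearMap.rTensor (Polynomial k) (F.f (_ + 1))))

theorem evPath_pathMap {M M' : NCdga k} (F : M ⟶ M') (c : k) {n : ℤ} (x : M.path.X n) :
    (M'.evPath c).f n ((pathMap F).f n x) = F.f n ((M.evPath c).f n x) := by
  obtain ⟨x, y⟩ := x
  change M'.evPoly c n (LinearMap.rTensor _ (F.f n) x) = F.f n (M.evPoly c n x)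
  change M.X n ⊗[k] Polynomial k at x
  clear y
  induction x using TensorProduct.induction_on with
  | zero => simp
  | add x y hx hy => simp only [map_add, hx, hy]
  | tmul a p => simp

theorem pathMap_pathHty {M M' : NCdga k} (F : M ⟶ M') {i j : ℤ} (h : i + 1 = j)
    (x : M.path.X i) :
    (pathMap F).f j (M.pathHty h x) = M'.pathHty h ((pathMap F).f i x) := by
  have hI : ∀ {i j : ℤ} (h : i = j) (x : M.X i ⊗[k] Polynomial k),
      LinearMap.rTensor (Polynomial k) (F.f j) (M.polyInt h x) =
        M'.polyInt h (LinearMap.rTensor (Polynomial k) (F.f i) x) := by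
    intro i j h x
    subst h
    change LinearMap.rTensor _ _ (LinearMap.lTensor _ _ x) =
      LinearMap.lTensor _ _ (LinearMap.rTensor _ _ x)
    induction x using TensorProduct.induction_on with
    | zero => simp
    | add x y hx hy => simp only [map_add, hx, hy]
    | tmul a p => simp
  refine Prod.ext ?_ (LinearMap.map_zero (LinearMap.rTensor (Polynomial k) (F.f (_ + 1))))
  exact ((LinearMap.rTensor (Polynomial k) (F.f j)).map_smul _ _).trans
    (congrArg (-sgn k i • ·) (hI h x.2))

end NCdga

end

end Koszul

namespace Koszul

noncomputable section

/-! ### Path objects of DGLAs -/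

variable {k : Type u} [Field k]

namespace Tot

/-- The coordinate of an element of degree zero of the ground field. -/
def unitCoeff (k : Type u) [Field k] : Module.Dual k ((DgArt.unitCdga k).X 0) := Submodule.subtype _

theorem eq_unitCoeff_smul (b : (DgArt.unitCdga k).X 0) :
    b = unitCoeff k b • (DgArt.unitCdga k).one := Subtype.ext (mul_one b.1).symm

/-- Tensoring with the ground field does nothing. -/
def unitor (L : DGLA k) : dgla L (DgArt.unitCdga k).toNCdga ⟶ L where
  f n := contr (M := (DgArt.unitCdga k).toNCdga) (sub_zero n) (unitCoeff k)
  map_d {n m} h x := by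
    change X L (DgArt.unitCdga k).toNCdga n at x
    change contr _ _ (d h x) = L.d h (contr _ _ x)
    induction x using ind with
    | h0 => simp
    | hadd x y hx hy => simp only [map_add, hx, hy]
    | @htm p i hs u a =>
      by_cases hi : i = 0
      · subst hi
        obtain rfl : p = n := by omega
        have hd : (DgArt.unitCdga k).d (sub_add_cancel 0 1) a = 0 := rfl
        rw [d_tm h hs h (sub_add_cancel 0 1), hd, tm_zero_right, smul_zero, add_zero, contr_tm,
          contr_tm, map_smul]
      · have ha : a = 0 := Subtype.ext (a.2 hi)
        rw [ha, tm_zero_right, map_zero, map_zero, map_zero, map_zero]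
  map_br {m n r} h x y := by
    change X L (DgArt.unitCdga k).toNCdga m at x
    change X L (DgArt.unitCdga k).toNCdga n at y
    change contr _ _ (br h x y) = L.br h (contr _ _ x) (contr _ _ y)
    induction x using ind with
    | h0 => simp
    | hadd x y hx hy => simp only [map_add, LinearMap.add_apply, hx, hy]
    | @htm p i hs u a =>
      induction y using ind with
      | h0 => simp
      | hadd x y hx hy => simp only [map_add, hx, hy]
      | @htm q j ht v b =>
        by_cases hi : i = 0
        · by_cases hj : j = 0
          · subst hi hj
            obtain rfl : p = m := by omega
            obtain rfl : q = n := by omega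
            rw [br_tm h hs ht h (add_zero 0), map_smul, contr_tm, contr_tm, contr_tm, mul_zero,
              sgn_zero, one_smul, map_smul, map_smul, LinearMap.smul_apply, smul_smul, mul_comm]
            rfl
          · have hb : b = 0 := Subtype.ext (b.2 hj)
            rw [hb, tm_zero_right, map_zero, map_zero, map_zero, map_zero]
        · have ha : a = 0 := Subtype.ext (a.2 hi)
          rw [ha, tm_zero_right, map_zero, LinearMap.zero_apply, map_zero, map_zero, map_zero,
            LinearMap.zero_apply]

end Tot

namespace DGLA

variable (L : DGLA k)

/-- The cdga of polynomial differential forms on the line. -/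
abbrev forms (k : Type u) [Field k] : NCdga k := (DgArt.unitCdga k).toNCdga.path

/-- The path object `L[t, dt]`. -/
def path : DGLA k := Tot.dgla L (forms k)

/-- Evaluation of paths at time `c`. -/
def evPath (c : k) : L.path ⟶ L := Tot.map (𝟙 L) (NCdga.evPath _ c) ≫ Tot.unitor L

/-- The form `p(t)`. -/
def fn (p : Polynomial k) : (forms k).X 0 := NCdga.form _ p 0 (DgArt.unitCdga k).one

/-- The path `u p(t)`. -/
def pathTm (p : Polynomial k) (n : ℤ) : L.X n →ₗ[k] L.path.X n where
  toFun u := Tot.tm (sub_zero n) u (fn p)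
  map_add' u v := Tot.tm_add_left _ u v _
  map_smul' c u := Tot.tm_smul_left _ c u _

theorem evPath_pathTm (c : k) (p : Polynomial k) {n : ℤ} (u : L.X n) :
    (L.evPath c).f n (L.pathTm p n u) = p.eval c • u := by
  have h1 : Tot.mapLin (Hom.f (𝟙 L)) (NCdga.evPath (DgArt.unitCdga k).toNCdga c).f n
      (Tot.tm (sub_zero n) u (fn p)) =
      Tot.tm (sub_zero n) u (p.eval c • (DgArt.unitCdga k).one) := by
    rw [Tot.mapLin_tm]
    exact congrArg _ (NCdga.evPath_form _ c p _)
  refine (congrArg ((Tot.unitor L).f n) h1).trans ((Tot.contr_tm _ _ _ _).trans ?_)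
  exact congrArg (· • u) (mul_one (p.eval c))

theorem d_fn_one : (forms k).d (sub_add_cancel 0 1) (fn 1) = 0 :=
  ((NCdga.constPath (DgArt.unitCdga k).toNCdga).map_d (sub_add_cancel 0 1) _).symm.trans
    (map_zero ((NCdga.constPath (DgArt.unitCdga k).toNCdga).f (0 - 1)))

/-- The constant paths. -/
def constPath : L ⟶ L.path where
  f := L.pathTm 1
  map_d {i j} h x := by
    refine Eq.symm ((Tot.d_tm h (sub_zero i) h (sub_add_cancel 0 1) x (fn 1)).trans ?_)
    rw [d_fn_one, Tot.tm_zero_right, smul_zero, add_zero]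
    rfl
  map_br {i j n} h x y := by
    have h1 : (forms k).mul (add_zero 0) (fn 1) (fn 1) = fn 1 :=
      ((NCdga.constPath (DgArt.unitCdga k).toNCdga).map_mul (add_zero 0) _ _).symm.trans
        (congrArg ((NCdga.constPath (DgArt.unitCdga k).toNCdga).f 0)
          ((DgArt.unitCdga k).one_mul (DgArt.unitCdga k).one))
    refine Eq.symm ((Tot.br_tm h (sub_zero i) (sub_zero j) h (add_zero 0) x (fn 1) y
      (fn 1)).trans ?_)
    rw [h1, mul_zero, sgn_zero, one_smul]
    rfl

theorem evPath_constPath (c : k) {n : ℤ} (u : L.X n) :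
    (L.evPath c).f n (L.constPath.f n u) = u :=
  (L.evPath_pathTm c 1 u).trans (by rw [Polynomial.eval_one, one_smul])

theorem pathTm_unitor {n : ℤ} (x : Tot.X L (DgArt.unitCdga k).toNCdga n) :
    L.pathTm 1 n ((Tot.unitor L).f n x) = Tot.mapLin (L := L) (L' := L) (fun _ => LinearMap.id)
      (NCdga.constPath (DgArt.unitCdga k).toNCdga).f n x := by
  change L.pathTm 1 n (Tot.contr (sub_zero n) (Tot.unitCoeff k) x) = _
  induction x using Tot.ind with
  | h0 =>
    simp only [map_zero]
    rfl
  | hadd x y hx hy =>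
    simp only [map_add, hx, hy]
    rfl
  | @htm p i hs u b =>
    rw [Tot.mapLin_tm]
    by_cases hi : i = 0
    · subst hi
      obtain rfl : p = n := by omega
      rw [Tot.contr_tm, map_smul]
      refine ((Tot.tm_smul_right (M := forms k) (sub_zero p) (Tot.unitCoeff k b) u
        (fn 1)).symm).trans (congrArg (Tot.tm (M := forms k) _ u) ?_)
      exact (((NCdga.constPath (DgArt.unitCdga k).toNCdga).f 0).map_smul _ _).symm.trans
        (congrArg ((NCdga.constPath (DgArt.unitCdga k).toNCdga).f 0)
          (Tot.eq_unitCoeff_smul b).symm)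
    · have hb : b = 0 := Subtype.ext (b.2 hi)
      rw [hb, map_zero, Tot.tm_zero_right, Tot.tm_zero_right, map_zero, map_zero]
      rfl

theorem constPath_evPath {n : ℤ} (x : L.path.X n) :
    Tot.mapLin (L := L) (L' := L) (fun _ => LinearMap.id)
      (fun i => (NCdga.constPath (DgArt.unitCdga k).toNCdga).f i ∘ₗ
        (NCdga.evPath (DgArt.unitCdga k).toNCdga 0).f i) n x =
      L.constPath.f n ((L.evPath 0).f n x) :=
  (Tot.mapLin_comp (L := L) (L' := L) (L'' := L) (fun _ => LinearMap.id)
    (NCdga.evPath (DgArt.unitCdga k).toNCdga 0).f (fun _ => LinearMap.id)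
    (NCdga.constPath (DgArt.unitCdga k).toNCdga).f x).symm.trans (L.pathTm_unitor _).symm

/-- The contraction of `L[t, dt]` onto `L` given by integration from `0`. -/
def pathHty {n m : ℤ} (h : m + 1 = n) : L.path.X n →ₗ[k] L.path.X m :=
  Tot.rightHty (M := forms k) L (NCdga.pathHty _) h

theorem pathHty_hty [CharZero k] {n m l : ℤ} (h : m + 1 = n) (h' : n + 1 = l) (x : L.path.X n) :
    L.path.d h (L.pathHty h x) + L.pathHty h' (L.path.d h' x) =
      x - L.constPath.f n ((L.evPath 0).f n x) := by
  rw [← constPath_evPath]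
  exact Tot.rightHty_hty (M := forms k) (s := NCdga.pathHty _)
    (π := fun i => (NCdga.constPath (DgArt.unitCdga k).toNCdga).f i ∘ₗ
        (NCdga.evPath (DgArt.unitCdga k).toNCdga 0).f i)
    (NCdga.pathHty_hty _) h h' x

theorem evPath_pathHty {n m : ℤ} (h : m + 1 = n) (x : L.path.X n) :
    (L.evPath 0).f m (L.pathHty h x) = 0 := by
  change Tot.X L (forms k) n at x
  have h1 : Tot.mapLin (Hom.f (𝟙 L)) (NCdga.evPath (DgArt.unitCdga k).toNCdga 0).f m
      (Tot.rightHty (M := forms k) L (NCdga.pathHty _) h x) = 0 := by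
    induction x using Tot.ind with
    | h0 => simp
    | hadd x y hx hy => simp only [map_add, hx, hy, add_zero]
    | @htm p i hs u a =>
      rw [Tot.rightHty_tm _ h hs (i' := i + 1) rfl, map_smul, Tot.mapLin_tm,
        NCdga.evPath_pathHty, Tot.tm_zero_right, smul_zero]
  exact (congrArg ((Tot.unitor L).f m) h1).trans (map_zero _)

theorem quasiIso_constPath [CharZero k] : quasiIso k L.constPath := by
  refine (quasiIso_iff _).mpr fun {i j l} h h' => ⟨fun x hx hy => ?_, fun y hy => ?_⟩
  · obtain ⟨y, hy⟩ := hy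
    refine ⟨(L.evPath 0).f i y, ?_⟩
    rw [← (L.evPath 0).map_d, hy, evPath_constPath]
  · refine ⟨(L.evPath 0).f j y, ?_, L.pathHty h y, ?_⟩
    · rw [← (L.evPath 0).map_d, hy, map_zero]
    · have := L.pathHty_hty h h' y
      rwa [hy, map_zero, add_zero] at this

theorem constPath_comp_evPath (c : k) : L.constPath ≫ L.evPath c = 𝟙 L :=
  hom_ext fun _ u => L.evPath_constPath c u

/-- The fibre product of DGLAs. -/
def pullback {L M N : DGLA k} (f : L ⟶ M) (g : N ⟶ M) : DGLA k where
  X n := LinearMap.eqLocus (f.f n ∘ₗ LinearMap.fst k (L.X n) (N.X n))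
    (g.f n ∘ₗ LinearMap.snd k (L.X n) (N.X n))
  d {i j} h := (LinearMap.prodMap (L.d h) (N.d h)).restrict fun x hx => by
    have hx : f.f i x.1 = g.f i x.2 := hx
    change f.f j (L.d h x.1) = g.f j (N.d h x.2)
    rw [f.map_d, g.map_d, hx]
  br {i j n} h := LinearMap.mk₂ k
    (fun x y => ⟨(L.br h x.1.1 y.1.1, N.br h x.1.2 y.1.2), by
      have hx : f.f i x.1.1 = g.f i x.1.2 := x.2
      have hy : f.f j y.1.1 = g.f j y.1.2 := y.2
      change f.f n (L.br h x.1.1 y.1.1) = g.f n (N.br h x.1.2 y.1.2)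
      rw [f.map_br, g.map_br, hx, hy]⟩)
    (fun x x' y => Subtype.ext (by simp)) (fun c x y => Subtype.ext (by simp))
    (fun x y y' => Subtype.ext (by simp)) (fun c x y => Subtype.ext (by simp))
  d_d h h' x := Subtype.ext (Prod.ext (L.d_d h h' x.1.1) (N.d_d h h' x.1.2))
  br_symm h h' x y := Subtype.ext (Prod.ext (L.br_symm h h' x.1.1 y.1.1)
    (N.br_symm h h' x.1.2 y.1.2))
  jacobi ha h₁ hb h₂ hc h₃ x y z := Subtype.ext (Prod.ext
    (L.jacobi ha h₁ hb h₂ hc h₃ x.1.1 y.1.1 z.1.1) (N.jacobi ha h₁ hb h₂ hc h₃ x.1.2 y.1.2 z.1.2))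
  d_br h hn hi hj h₁ h₂ x y := Subtype.ext (Prod.ext
    (L.d_br h hn hi hj h₁ h₂ x.1.1 y.1.1) (N.d_br h hn hi hj h₁ h₂ x.1.2 y.1.2))

variable {L} {M : DGLA k} (f : L ⟶ M)

/-- The mapping path object of a morphism: pairs of an element of the source and a path in the
target that starts at its image. -/
abbrev mapPath : DGLA k := pullback f (M.evPath 0)

/-- The projection from the mapping path object to the source. -/
def mapPathFst : mapPath f ⟶ L where
  f n := LinearMap.fst k _ _ ∘ₗ Submodule.subtype _
  map_d _ _ := rfl
  map_br _ _ _ := rfl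

/-- The end point of the path. -/
def mapPathEnd : mapPath f ⟶ M where
  f n := (M.evPath 1).f n ∘ₗ LinearMap.snd k _ _ ∘ₗ Submodule.subtype _
  map_d h x := (M.evPath 1).map_d h x.1.2
  map_br h x y := (M.evPath 1).map_br h x.1.2 y.1.2

/-- The inclusion of the source as the constant paths. -/
def mapPathConst : L ⟶ mapPath f where
  f n := (LinearMap.prod LinearMap.id (M.constPath.f n ∘ₗ f.f n)).codRestrict _ fun x =>
    (M.evPath_constPath 0 (f.f n x)).symm
  map_d h x := Subtype.ext (Prod.ext rfl ((congrArg _ (f.map_d h x)).trans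
    (M.constPath.map_d h _)))
  map_br h x y := Subtype.ext (Prod.ext rfl ((congrArg _ (f.map_br h x y)).trans
    (M.constPath.map_br h _ _)))

theorem mapPathConst_comp_fst : mapPathConst f ≫ mapPathFst f = 𝟙 L := rfl

theorem mapPathConst_comp_end : mapPathConst f ≫ mapPathEnd f = f :=
  hom_ext fun n x => M.evPath_constPath 1 (f.f n x)

theorem mapPathFst_surjective (n : ℤ) : Function.Surjective ((mapPathFst f).f n) :=
  fun x => ⟨(mapPathConst f).f n x, rfl⟩

theorem mapPathEnd_surjective (n : ℤ) : Function.Surjective ((mapPathEnd f).f n) := by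
  intro y
  have h0 : f.f n 0 = (M.evPath 0).f n (M.pathTm Polynomial.X n y) := by
    rw [evPath_pathTm, map_zero, Polynomial.eval_X, zero_smul]
  refine ⟨⟨(0, M.pathTm Polynomial.X n y), h0⟩, ?_⟩
  refine (M.evPath_pathTm 1 Polynomial.X y).trans ?_
  rw [Polynomial.eval_X, one_smul]

/-- The projection to the source is a quasi-isomorphism, because paths that start at `0` can be
contracted. -/
theorem quasiIso_mapPathFst [CharZero k] : quasiIso k (mapPathFst f) := by
  refine (quasiIso_iff _).mpr fun {i j l} h h' => ⟨fun x hx hy => ?_, fun y hy => ?_⟩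
  · obtain ⟨y, hy⟩ := hy
    obtain ⟨⟨x₁, x₂⟩, hx₁⟩ := x
    change f.f j x₁ = (M.evPath 0).f j x₂ at hx₁
    change L.d h y = x₁ at hy
    have hx₂ : M.path.d h' x₂ = 0 := congrArg (fun z => z.1.2) hx
    -- after subtracting a constant path, the path starts at `0` and is contracted by integration
    let w : M.path.X i := M.constPath.f i (f.f i y) + M.pathHty h x₂
    have hw : f.f i y = (M.evPath 0).f i w := by
      rw [map_add, evPath_constPath, evPath_pathHty, add_zero]
    refine ⟨⟨(y, w), hw⟩, Subtype.ext (Prod.ext hy ?_)⟩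
    have e := M.pathHty_hty h h' x₂
    rw [hx₂, map_zero, add_zero, ← hx₁, ← hy] at e
    change M.path.d h w = x₂
    rw [map_add, e, ← M.constPath.map_d, ← f.map_d]
    exact add_sub_cancel _ _
  · refine ⟨(mapPathConst f).f j y, ?_, 0, ?_⟩
    · rw [← (mapPathConst f).map_d, hy, map_zero]
    · rw [map_zero]
      exact (sub_self y).symm

theorem quasiIso_mapPathConst [CharZero k] : quasiIso k (mapPathConst f) :=
  (quasiIso k).of_postcomp _ (mapPathFst f) (quasiIso_mapPathFst f)
    (by
      rw [mapPathConst_comp_fst]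
      exact (quasiIso_iff _).mpr fun h h' => ⟨fun x _ hy => hy, fun y hy =>
        ⟨y, hy, 0, (map_zero _).trans (sub_self y).symm⟩⟩)

theorem quasiIso_mapPathEnd [CharZero k] (hf : quasiIso k f) : quasiIso k (mapPathEnd f) :=
  (quasiIso k).of_precomp (mapPathConst f) _ (quasiIso_mapPathConst f)
    (by rwa [mapPathConst_comp_end])

end DGLA

open DGLA in
/-- Deformations are invariant under quasi-isomorphisms. -/
theorem quasiIso_isInvertedBy_ddef [CharZero k] (A : ProDgArt k) :
    (quasiIso k).IsInvertedBy ((ddef k).obj A) := by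
  have key : ∀ {L M : DGLA k} (p : L ⟶ M), (∀ n, Function.Surjective (p.f n)) → quasiIso k p →
      IsIso (((ddef k).obj A).map p) := fun p hp hq =>
    (isIso_iff_bijective _).mpr (ddef_map_bijective_of_splitting (exists_splitting hp hq).some A)
  intro L M f hf
  have h₁ := key _ (mapPathFst_surjective f) (quasiIso_mapPathFst f)
  have h₂ := key _ (mapPathEnd_surjective f) (quasiIso_mapPathEnd f hf)
  have h₃ : IsIso (((ddef k).obj A).map (mapPathConst f)) := by
    have : IsIso (((ddef k).obj A).map (mapPathConst f) ≫ ((ddef k).obj A).map (mapPathFst f)) := by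
      rw [← Functor.map_comp, mapPathConst_comp_fst]
      infer_instance
    exact IsIso.of_isIso_comp_right _ (((ddef k).obj A).map (mapPathFst f))
  rw [← mapPathConst_comp_end f, Functor.map_comp]
  infer_instance

end

end Koszul

namespace Koszul

noncomputable section

/-! ### Gauge equivalence and paths -/

section gaugePath

variable {k : Type u} [Field k]

/-- Postcomposition with a morphism of DGLAs. -/
abbrev mcMap {L M : DGLA k} (F : L ⟶ M) {A : ProDgArt k} (ω : A.eval ((mcArt k).obj L)) :
    A.eval ((mcArt k).obj M) :=
  ω ≫ Functor.whiskerLeft (unopUnop (DgArt k)) ((mcArt k).map F)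

/-- Multiplication by the parameter, as a map from `Tot (L ⊗ 𝔪(B))⁰` to
`Tot (L[t, dt] ⊗ 𝔪(B))⁰`. -/
def ggPathTm (L : DGLA k) : (ggArt k).obj L ⟶ (ggArt k).obj L.path where
  app B := ↾fun x : Tot.X L B.maxIdeal 0 =>
    (Tot.mapLin (L.pathTm Polynomial.X) (NCdga.Hom.f (𝟙 B.maxIdeal)) 0 x :
      Tot.X L.path B.maxIdeal 0)
  naturality B B' f := by
    ext x
    refine (Tot.mapLin_comp _ _ _ _ _).trans (Eq.trans ?_ (Tot.mapLin_comp _ _ _ _ _).symm)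
    rfl

theorem evPath_ggPathTm (L : DGLA k) (c : k) (B : DgArt k) (x : Tot.X L B.maxIdeal 0) :
    Tot.mapLin (L.evPath c).f (NCdga.Hom.f (𝟙 B.maxIdeal)) 0 ((ggPathTm L).app B x) = c • x := by
  refine (Tot.mapLin_comp _ _ _ _ _).trans ?_
  induction x using Tot.ind with
  | h0 => simp
  | hadd x y hx hy => simp only [map_add, hx, hy, smul_add]
  | @htm p i hs u a =>
    rw [Tot.mapLin_tm]
    refine Eq.trans ?_ (Tot.tm_smul_left hs c u a)
    refine congrArg (fun v => Tot.tm hs v a) ((L.evPath_pathTm c Polynomial.X u).trans ?_)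
    rw [Polynomial.eval_X]

/-- Gauge equivalent Maurer-Cartan elements `ω` and `e^x ⋆ ω` are the end points of the path
`e^{tx} ⋆ ω`. -/
theorem exists_path_of_gaugeRel [CharZero k] {L : DGLA k} {A : ProDgArt k}
    {ω ω' : A.eval ((mcArt k).obj L)}
    (h : gaugeRel L A ω ω') : ∃ η : A.eval ((mcArt k).obj L.path),
      mcMap (L.evPath 0) η = ω ∧ mcMap (L.evPath 1) η = ω' := by
  obtain ⟨x, hx⟩ := h
  let η : A.eval ((mcArt k).obj L.path) :=
    gaugeAct (x ≫ Functor.whiskerLeft (unopUnop (DgArt k)) (ggPathTm L)) (mcMap L.constPath ω)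
  have key : ∀ (c : k) (X : (DgArt k)ᵒᵖᵒᵖ) (b : A.h.obj X) (y : Tot.X L X.unop.unop.maxIdeal 0),
      c • (show Tot.X L X.unop.unop.maxIdeal 0 from x.app X b) = y →
      (show (Tot.dgla L X.unop.unop.maxIdeal).MC from (mcMap (L.evPath c) η).app X b).1 =
        DGLA.gauge (Tot.dgla L X.unop.unop.maxIdeal) y
          (show (Tot.dgla L X.unop.unop.maxIdeal).MC from ω.app X b).1 := by
    intro c X b y hy
    refine (DGLA.Hom.map_gauge (Tot.map (L.evPath c) (𝟙 X.unop.unop.maxIdeal)) _ _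
      (ad_isNilpotent L.path _ _)).trans ?_
    refine congrArg₂ (DGLA.gauge (Tot.dgla L X.unop.unop.maxIdeal)) ?_ ?_
    · exact (evPath_ggPathTm L c X.unop.unop (x.app X b)).trans hy
    · refine (Tot.mapLin_comp _ _ _ _ _).trans (Eq.trans ?_ (Tot.mapLin_id _))
      exact congrArg (fun f => Tot.mapLin f
          (fun i => LinearMap.id (M := X.unop.unop.maxIdeal.X i)) 1 _)
        (funext fun q => LinearMap.ext fun u => L.evPath_constPath c u)
  refine ⟨η, ?_, ?_⟩
  · ext X b
    exact Subtype.ext ((key 0 X b 0 (zero_smul k _)).trans (DGLA.gauge_zero _))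
  · ext X b
    exact Subtype.ext ((key 1 X b (x.app X b) (one_smul k _)).trans (hx X.unop.unop b).symm)

end gaugePath

/-! ### A criterion for representability in a localization -/

section yoneda

variable {C H : Type*} [Category* C] [Category.{v} H] (W : MorphismProperty C) (Q : C ⥤ H)
  [Q.IsLocalization W]

/-- A functor `D` that inverts `W` and is generated by an element `x` of `D(c)` corepresents the
same functor on the localization as `c`, as soon as the classes of the morphisms out of `c` in the
localization depend on their value in `D` only. -/
theorem bijective_of_isInvertedBy (D : C ⥤ Type v) (hD : W.IsInvertedBy D) {c : C} (x : D.obj c)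
    (Ψ : D ⟶ Q ⋙ coyoneda.obj (op (Q.obj c))) (hΨ : Ψ.app c x = 𝟙 (Q.obj c))
    (hx : ∀ {Y : C} (d : D.obj Y), ∃ f : c ⟶ Y, D.map f x = d) (Y : C) :
    Function.Bijective (Ψ.app Y) := by
  have hQ : ∀ {Y : C} (f : c ⟶ Y), Ψ.app Y (D.map f x) = Q.map f := fun f => by
    have := ConcreteCategory.congr_hom (Ψ.naturality f) x
    refine this.trans ?_
    change Ψ.app c x ≫ Q.map f = _
    rw [hΨ, Category.id_comp]
  let D' := Localization.lift D hD Q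
  let e : Q ⋙ D' ≅ D := Localization.fac D hD Q
  let Ψ' : D' ⟶ coyoneda.obj (op (Q.obj c)) :=
    Localization.liftNatTrans Q W D (Q ⋙ coyoneda.obj (op (Q.obj c))) D'
      (coyoneda.obj (op (Q.obj c))) Ψ
  have hΨ' : ∀ (Y : C) (z : D'.obj (Q.obj Y)), Ψ'.app (Q.obj Y) z = Ψ.app Y (e.hom.app Y z) := by
    intro Y z
    have := Localization.liftNatTrans_app Q W D (Q ⋙ coyoneda.obj (op (Q.obj c))) D'
      (coyoneda.obj (op (Q.obj c))) Ψ Y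
    exact ConcreteCategory.congr_hom this z
  have he : ∀ {Y : C} (z : D.obj Y), e.hom.app Y (e.inv.app Y z) = z := fun {Y} z =>
    ConcreteCategory.congr_hom (e.inv_hom_id_app Y) z
  refine ⟨fun d d' h => ?_, fun g => ?_⟩
  · obtain ⟨f, rfl⟩ := hx d
    obtain ⟨f', rfl⟩ := hx d'
    rw [hQ, hQ] at h
    have key : ∀ f : c ⟶ Y, D.map f x = e.hom.app Y (D'.map (Q.map f) (e.inv.app c x)) := by
      intro f
      have := ConcreteCategory.congr_hom (e.hom.naturality f) (e.inv.app c x)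
      refine Eq.trans ?_ this.symm
      exact congrArg (D.map f) (he x).symm
    rw [key, key, h]
  · refine ⟨e.hom.app Y (D'.map g (e.inv.app c x)), ?_⟩
    rw [← hΨ']
    refine (ConcreteCategory.congr_hom (Ψ'.naturality g) (e.inv.app c x)).trans ?_
    change Ψ'.app (Q.obj c) (e.inv.app c x) ≫ g = g
    rw [hΨ', he, hΨ]
    exact Category.id_comp g

end yoneda

/-! ### Morphisms in the homotopy category of DGLAs -/

section homDGLA

variable {k : Type u} [Field k]

/-- Morphisms `β*A ⟶ L` are the elements of `mc(L,A)`. -/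
def mcEquiv (A : ProDgArt k) (L : DGLA k) :
    ((betaStar k).obj (op A) ⟶ L) ≃ A.eval ((mcArt k).obj L) :=
  ((betaAdj k).homEquiv (op A) L).trans ((opEquiv _ _).trans (proRep L A))

theorem mcEquiv_comp (A : ProDgArt k) {L M : DGLA k} (f : (betaStar k).obj (op A) ⟶ L)
    (g : L ⟶ M) : mcEquiv A M (f ≫ g) = mcMap g (mcEquiv A L f) := by
  change proRep M A ((betaAdj k).homEquiv (op A) M (f ≫ g)).unop = _
  rw [Adjunction.homEquiv_naturality_right]
  exact proRep_naturality_left g A _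

theorem mcEquiv_map {A A' : ProDgArt k} (a : A ⟶ A') (L : DGLA k)
    (f : (betaStar k).obj (op A) ⟶ L) :
    mcEquiv A' L ((betaStar k).map a.op ≫ f) = (Ind.inclusion _).map a.unop ≫ mcEquiv A L f := by
  change proRep L A' ((betaAdj k).homEquiv (op A') L ((betaStar k).map a.op ≫ f)).unop = _
  rw [Adjunction.homEquiv_naturality_left]
  exact proRep_naturality_right L a _

variable [CharZero k]

/-- Both evaluations are inverse to the inclusion of the constant paths. -/
theorem Q_evPath (L : DGLA k) : (DGLA.quasiIso k).Q.map (L.evPath 0) =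
    (DGLA.quasiIso k).Q.map (L.evPath 1) := by
  have := Localization.inverts (DGLA.quasiIso k).Q (DGLA.quasiIso k) _ L.quasiIso_constPath
  rw [← cancel_epi ((DGLA.quasiIso k).Q.map L.constPath), ← Functor.map_comp, ← Functor.map_comp,
    L.constPath_comp_evPath, L.constPath_comp_evPath]

theorem Q_eq_of_gaugeRel {L : DGLA k} {A : ProDgArt k} {ω ω' : A.eval ((mcArt k).obj L)}
    (h : gaugeRel L A ω ω') : (DGLA.quasiIso k).Q.map ((mcEquiv A L).symm ω) =
      (DGLA.quasiIso k).Q.map ((mcEquiv A L).symm ω') := by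
  obtain ⟨η, rfl, rfl⟩ := exists_path_of_gaugeRel h
  have key : ∀ c, (mcEquiv A L).symm (mcMap (L.evPath c) η) =
      (mcEquiv A L.path).symm η ≫ L.evPath c := by
    intro c
    rw [Equiv.symm_apply_eq, mcEquiv_comp, Equiv.apply_symm_apply]
  rw [key, key, Functor.map_comp, Functor.map_comp, Q_evPath]

variable (k) in
/-- The map from deformations to morphisms in the homotopy category of DGLAs. -/
def ddefToHoDGLA : ddef k ⟶ homHoDGLA k where
  app A :=
    { app := fun L => ↾Quot.lift (fun ω => (DGLA.quasiIso k).Q.map ((mcEquiv A L).symm ω))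
        fun _ _ h => Q_eq_of_gaugeRel h
      naturality := fun L M f => by
        ext ω
        induction ω using Quot.ind with | mk ω =>
        change (DGLA.quasiIso k).Q.map ((mcEquiv A M).symm (mcMap f ω)) =
          (DGLA.quasiIso k).Q.map ((mcEquiv A L).symm ω) ≫ (DGLA.quasiIso k).Q.map f
        rw [← Functor.map_comp]
        congr 1
        rw [Equiv.symm_apply_eq, mcEquiv_comp, Equiv.apply_symm_apply] }
  naturality A A' a := by
    ext L ω
    induction ω using Quot.ind with | mk ω =>
    change (DGLA.quasiIso k).Q.map ((mcEquiv A' L).symm ((Ind.inclusion _).map a.unop ≫ ω)) =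
      (DGLA.quasiIso k).Q.map ((betaStar k).map a.op) ≫
        (DGLA.quasiIso k).Q.map ((mcEquiv A L).symm ω)
    rw [← Functor.map_comp]
    congr 1
    rw [Equiv.symm_apply_eq, mcEquiv_map, Equiv.apply_symm_apply]

theorem ddefToHoDGLA_mk (A : ProDgArt k) (L : DGLA k) (ω : A.eval ((mcArt k).obj L)) :
    ((ddefToHoDGLA k).app A).app L (ddef.mk ω) =
      (DGLA.quasiIso k).Q.map ((mcEquiv A L).symm ω) := rfl

theorem ddefToHoDGLA_bijective (A : ProDgArt k) (L : DGLA k) :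
    Function.Bijective (((ddefToHoDGLA k).app A).app L) := by
  refine bijective_of_isInvertedBy (DGLA.quasiIso k) (DGLA.quasiIso k).Q ((ddef k).obj A)
    (quasiIso_isInvertedBy_ddef A) (c := (betaStar k).obj (op A))
    (ddef.mk (mcEquiv A _ (𝟙 _))) ((ddefToHoDGLA k).app A) ?_ ?_ L
  · refine (ddefToHoDGLA_mk A _ _).trans ?_
    rw [Equiv.symm_apply_apply]
    exact (DGLA.quasiIso k).Q.map_id _
  · intro M d
    induction d using Quot.ind with | mk ω =>
    refine ⟨(mcEquiv A M).symm ω, ?_⟩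
    change ddef.mk (mcMap ((mcEquiv A M).symm ω) _) = ddef.mk ω
    rw [← mcEquiv_comp, Category.id_comp, Equiv.apply_symm_apply]

instance : IsIso (ddefToHoDGLA k) := by
  have : ∀ A, IsIso ((ddefToHoDGLA k).app A) := fun A => by
    have : ∀ L, IsIso (((ddefToHoDGLA k).app A).app L) := fun L =>
      (isIso_iff_bijective _).mpr (ddefToHoDGLA_bijective A L)
    exact NatIso.isIso_of_isIso_app _
  exact NatIso.isIso_of_isIso_app _

end homDGLA

end

end Koszul

namespace Koszul

noncomputable section

/-! ### The Rees filtration on polynomials over a local Artinian cdga -/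

variable {k : Type u} [Field k]

namespace NCdga

/-- The subalgebra of a cdga given by a family of submodules. -/
def sub (R : NCdga k) (S : ∀ n, Submodule k (R.X n))
    (hd : ∀ {i j : ℤ} (h : j + 1 = i) {x : R.X i}, x ∈ S i → R.d h x ∈ S j)
    (hm : ∀ {i j n : ℤ} (h : i + j = n) {x : R.X i} {y : R.X j}, x ∈ S i → y ∈ S j →
      R.mul h x y ∈ S n) : NCdga k where
  X n := S n
  d h := (R.d h).restrict fun _ hx => hd h hx
  mul h := LinearMap.mk₂ k (fun x y => ⟨R.mul h x.1 y.1, hm h x.2 y.2⟩)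
    (fun x x' y => Subtype.ext (by simp)) (fun c x y => Subtype.ext (by simp))
    (fun x y y' => Subtype.ext (by simp)) (fun c x y => Subtype.ext (by simp))
  d_d h h' x := Subtype.ext (R.d_d h h' x.1)
  mul_comm h h' x y := Subtype.ext (R.mul_comm h h' x.1 y.1)
  mul_assoc hb h₂ ha h₁ x y z := Subtype.ext (R.mul_assoc hb h₂ ha h₁ x.1 y.1 z.1)
  d_mul h hn hi hj h₁ h₂ x y := Subtype.ext (R.d_mul h hn hi hj h₁ h₂ x.1 y.1)

variable (M : NCdga k)

theorem polyTm_smul (c : k) (p : Polynomial k) {n : ℤ} (a : M.X n) :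
    M.polyTm (c • p) n a = c • M.polyTm p n a := TensorProduct.tmul_smul c a p

theorem poly_mul_polyTm {i j n : ℤ} (h : i + j = n) (p q : Polynomial k) (a : M.X i) (b : M.X j) :
    M.poly.mul h (M.polyTm p i a) (M.polyTm q j b) = M.polyTm (p * q) n (M.mul h a b) := by
  change TensorProduct.map₂ (M.mul h) (LinearMap.mul k _) (a ⊗ₜ p) (b ⊗ₜ q) = _
  rw [TensorProduct.map₂_apply_tmul, TensorProduct.map_tmul]
  rfl

theorem poly_d_polyTm {i j : ℤ} (h : j + 1 = i) (p : Polynomial k) (a : M.X i) :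
    M.poly.d h (M.polyTm p i a) = M.polyTm p j (M.d h a) := LinearMap.rTensor_tmul _ _ _ _

theorem polyDeriv_polyTm {i : ℤ} (p : Polynomial k) (a : M.X i) :
    M.polyDeriv.D rfl (M.polyTm p i a) = M.polyTm (Polynomial.derivative p) i a :=
  LinearMap.lTensor_tmul _ _ _ _

theorem polyInt_polyTm {i : ℤ} (p : Polynomial k) (a : M.X i) :
    M.polyInt rfl (M.polyTm p i a) = M.polyTm (primitive k p) i a :=
  LinearMap.lTensor_tmul _ _ _ _

/-- The functoriality of polynomials with coefficients in a cdga. -/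
def polyMap {M M' : NCdga k} (F : M ⟶ M') (n : ℤ) : M.poly.X n →ₗ[k] M'.poly.X n :=
  LinearMap.rTensor (Polynomial k) (F.f n)

theorem polyMap_polyTm {M M' : NCdga k} (F : M ⟶ M') (p : Polynomial k) {n : ℤ} (a : M.X n) :
    polyMap F n (M.polyTm p n a) = M'.polyTm p n (F.f n a) := LinearMap.rTensor_tmul _ _ _ _

/-- The map `x ↦ x - x(0)` on polynomials. -/
def subEv (n : ℤ) : M.poly.X n →ₗ[k] M.poly.X n where
  toFun x := x - M.polyTm 1 n (M.evPoly 0 n x)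
  map_add' x y := by
    have h : M.evPoly 0 n (x + y) = M.evPoly 0 n x + M.evPoly 0 n y := (M.evPoly 0 n).map_add x y
    rw [h, map_add]
    abel
  map_smul' c x := by
    have h : M.evPoly 0 n (c • x) = c • M.evPoly 0 n x := (M.evPoly 0 n).map_smul c x
    rw [h, map_smul, RingHom.id_apply, smul_sub]

theorem subEv_polyTm (p : Polynomial k) {n : ℤ} (a : M.X n) :
    M.subEv n (M.polyTm p n a) = M.polyTm p n a - p.eval 0 • M.polyTm 1 n a := by
  rw [← map_smul]
  exact congrArg (fun z => _ - M.polyTm 1 n z) (M.evPoly_tmul 0 a p)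

end NCdga

namespace DgArt

variable (B : DgArt k)

/-- The monomial `a tⁱ`. -/
abbrev mono (i : ℕ) (n : ℤ) : B.X n →ₗ[k] B.toNCdga.poly.X n :=
  B.toNCdga.polyTm (Polynomial.monomial i 1) n

/-- The polynomials whose coefficient of `tⁱ` lies in the `max (i + s) r`-th power of the maximal
ideal, for all `i`. -/
def rees (r s : ℕ) (n : ℤ) : Submodule k (B.toNCdga.poly.X n) :=
  Submodule.span k {x | ∃ (i : ℕ) (b : B.X n), b ∈ B.pow (max (i + s) r) n ∧ x = B.mono i n b}

variable {B}

theorem mono_mem {r s i : ℕ} {n : ℤ} {b : B.X n} (h : b ∈ B.pow (max (i + s) r) n) :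
    B.mono i n b ∈ B.rees r s n := Submodule.subset_span ⟨i, b, h, rfl⟩

/-- A linear map sends `rees r s n` to a given subspace if it does so for monomials. -/
theorem map_rees {V : Type*} [AddCommGroup V] [Module k V] {r s : ℕ} {n : ℤ}
    (f : B.toNCdga.poly.X n →ₗ[k] V) (S : Submodule k V)
    (hf : ∀ (i : ℕ) (b : B.X n), b ∈ B.pow (max (i + s) r) n → f (B.mono i n b) ∈ S)
    {x : B.toNCdga.poly.X n} (hx : x ∈ B.rees r s n) : f x ∈ S := by
  induction hx using Submodule.span_induction with
  | zero => rw [map_zero]; exact zero_mem _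
  | add y z _ _ hy hz => rw [map_add]; exact add_mem hy hz
  | smul c y _ hy => rw [map_smul]; exact Submodule.smul_mem _ _ hy
  | mem y hy =>
    obtain ⟨i, b, hb, rfl⟩ := hy
    exact hf i b hb

theorem rees_anti {r s r' s' : ℕ} (h : ∀ i, max (i + s) r ≤ max (i + s') r') {n : ℤ}
    {x : B.toNCdga.poly.X n} (hx : x ∈ B.rees r' s' n) : x ∈ B.rees r s n :=
  map_rees LinearMap.id _ (fun i _ hb => mono_mem (pow_le_of_le (h i) hb)) hx

theorem rees_mul_mem {r s r' s' : ℕ} {i j n : ℤ} (h : i + j = n) {x : B.toNCdga.poly.X i}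
    {y : B.toNCdga.poly.X j} (hx : x ∈ B.rees r s i) (hy : y ∈ B.rees r' s' j) :
    B.toNCdga.poly.mul h x y ∈ B.rees (r + r') (s + s') n := by
  refine map_rees ((B.toNCdga.poly.mul h).flip y) _ (fun p b hb => ?_) hx
  refine map_rees (B.toNCdga.poly.mul h (B.mono p i b)) _ (fun q c hc => ?_) hy
  rw [NCdga.poly_mul_polyTm, Polynomial.monomial_mul_monomial, mul_one]
  exact mono_mem (pow_le_of_le (by omega) (pow_mul_mem h hb hc))

theorem rees_d_mem {r s : ℕ} {i j : ℤ} (h : j + 1 = i) {x : B.toNCdga.poly.X i}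
    (hx : x ∈ B.rees r s i) : B.toNCdga.poly.d h x ∈ B.rees r s j :=
  map_rees (B.toNCdga.poly.d h) _ (fun p b hb => by
    rw [NCdga.poly_d_polyTm]
    exact mono_mem (d_pow_mem h hb)) hx

theorem rees_deriv_mem {r s : ℕ} {i j : ℤ} (h : i = j) {x : B.toNCdga.poly.X i}
    (hx : x ∈ B.rees r s i) : B.toNCdga.polyDeriv.D h x ∈ B.rees r (s + 1) j := by
  subst h
  refine map_rees (B.toNCdga.polyDeriv.D rfl) _ (fun p b hb => ?_) hx
  rw [NCdga.polyDeriv_polyTm, Polynomial.derivative_monomial]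
  rcases p with _ | p
  · have : (Polynomial.monomial (0 - 1) ((1 : k) * ((0 : ℕ) : k))) = 0 := by simp
    rw [this]
    have h0 : B.toNCdga.polyTm 0 i b = 0 := TensorProduct.tmul_zero _ _
    rw [h0]
    exact zero_mem _
  · have : Polynomial.monomial (p + 1 - 1) ((1 : k) * ((p + 1 : ℕ) : k)) =
        ((p + 1 : ℕ) : k) • Polynomial.monomial p 1 := by
      rw [Polynomial.smul_monomial, one_mul, smul_eq_mul, mul_one, Nat.add_sub_cancel]
    rw [this, NCdga.polyTm_smul]
    exact Submodule.smul_mem _ _ (mono_mem (pow_le_of_le (by omega) hb))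

theorem rees_int_mem {r s : ℕ} {i j : ℤ} (h : i = j) {x : B.toNCdga.poly.X i}
    (hx : x ∈ B.rees r (s + 1) i) : B.toNCdga.polyInt h x ∈ B.rees r s j := by
  subst h
  refine map_rees (B.toNCdga.polyInt rfl) _ (fun p b hb => ?_) hx
  have : Polynomial.monomial (p + 1) ((p + 1 : k)⁻¹) =
      (p + 1 : k)⁻¹ • Polynomial.monomial (p + 1) 1 := by
    rw [Polynomial.smul_monomial, smul_eq_mul, mul_one]
  rw [NCdga.polyInt_polyTm, primitive_monomial, this, NCdga.polyTm_smul]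
  exact Submodule.smul_mem _ _ (mono_mem (pow_le_of_le (by omega) hb))

theorem polyTm_one_mem {r : ℕ} {n : ℤ} {b : B.X n} (hb : b ∈ B.pow r n) :
    B.toNCdga.polyTm 1 n b ∈ B.rees r 0 n :=
  mono_mem (i := 0) (pow_le_of_le (by omega) hb)

theorem polyTm_X_mem {r : ℕ} {n : ℤ} {b : B.X n} (hb : b ∈ B.pow (r + 1) n) :
    B.toNCdga.polyTm Polynomial.X n b ∈ B.rees (r + 1) 0 n := by
  rw [← Polynomial.monomial_one_one_eq_X]
  exact mono_mem (pow_le_of_le (by omega) hb)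

theorem polyMap_mem {B' : DgArt k} (F : B ⟶ B') {r s : ℕ} {n : ℤ} {x : B.toNCdga.poly.X n}
    (hx : x ∈ B.rees r s n) : NCdga.polyMap F.toHom n x ∈ B'.rees r s n :=
  map_rees (NCdga.polyMap F.toHom n) _ (fun p b hb => by
    rw [NCdga.polyMap_polyTm]
    exact mono_mem (map_pow F hb)) hx

theorem rees_eq_zero {r : ℕ} (hr : ∀ n (b : B.X n), b ∈ B.pow r n → b = 0) {s : ℕ} {n : ℤ}
    {x : B.toNCdga.poly.X n} (hx : x ∈ B.rees r s n) : x = 0 :=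
  map_rees LinearMap.id ⊥ (fun p b hb => by
    rw [hr n b (pow_le_of_le (le_max_right _ _) hb), map_zero]
    exact zero_mem _) hx

/-- An element of `rees 0 0` lies in `rees 1 0` as soon as its value at `0` lies in the maximal
ideal: the other coefficients do so anyway. -/
theorem mem_rees_one {n : ℤ} {x : B.toNCdga.poly.X n} (hx : x ∈ B.rees 0 0 n)
    (h0 : B.toNCdga.evPoly 0 n x ∈ B.pow 1 n) : x ∈ B.rees 1 0 n := by
  have key : B.toNCdga.subEv n x ∈ B.rees 1 0 n := by
    refine map_rees (B.toNCdga.subEv n) _ (fun p b hb => ?_) hx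
    rw [NCdga.subEv_polyTm]
    rcases p with _ | p
    · rw [Polynomial.eval_monomial, pow_zero, mul_one, one_smul, Polynomial.monomial_zero_one,
        sub_self]
      exact zero_mem _
    · rw [Polynomial.eval_monomial, zero_pow p.succ_ne_zero, mul_zero, zero_smul, sub_zero]
      exact mono_mem (pow_le_of_le (by omega) hb)
  have := add_mem key (polyTm_one_mem h0)
  rwa [show B.toNCdga.subEv n x = x - B.toNCdga.polyTm 1 n (B.toNCdga.evPoly 0 n x) from rfl,
    sub_add_cancel] at this

/-- Only the coefficients of finitely many powers of `t` can be nonzero, by nilpotency. -/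
theorem finite_rees (n : ℤ) (s : ℕ) : Module.Finite k (B.rees 1 s n) := by
  obtain ⟨r, hr, h0⟩ := B.exists_pow_eq_bot
  have := B.fin n
  let f : (Fin r → B.aug.ker n) →ₗ[k] B.toNCdga.poly.X n :=
    ∑ i : Fin r, B.mono i n ∘ₗ (B.aug.ker n).subtype ∘ₗ LinearMap.proj i
  have hf : B.rees 1 s n ≤ LinearMap.range f := fun x hx => by
    refine map_rees LinearMap.id (LinearMap.range f) (fun p b hb => ?_) hx
    have hb1 : b ∈ B.aug.ker n := by
      rw [← pow_one]
      exact pow_le_of_le (le_max_right _ _) hb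
    by_cases hp : p < r
    · refine ⟨Pi.single ⟨p, hp⟩ ⟨b, hb1⟩, ?_⟩
      rw [LinearMap.sum_apply, Finset.sum_eq_single ⟨p, hp⟩]
      · simp
      · intro q _ hq
        simp [Pi.single_eq_of_ne hq]
      · intro h
        exact absurd (Finset.mem_univ _) h
    · rw [h0 n b (pow_le_of_le (by omega) hb), map_zero]
      exact zero_mem _
  have : Module.Finite k (LinearMap.range f) := inferInstance
  exact Module.Finite.of_injective (Submodule.inclusion hf) (Submodule.inclusion_injective hf)

/-! ### Cylinders of local Artinian cdgas -/

variable (B) in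
/-- The forms `f + g dt` where the coefficient of `tⁱ` lies in the `max i r`-th power of the maximal
ideal for `f`, and in the `max (i + 1) r`-th power for `g`.  The shift by one for `g` makes the
family stable under both differentiation and integration. -/
def cylStep (r : ℕ) (n : ℤ) : Submodule k (B.toNCdga.path.X n) :=
  (B.rees r 0 n).prod (B.rees r 1 (n + 1))

theorem cylStep_anti {r r' : ℕ} (h : r ≤ r') {n : ℤ} {x : B.toNCdga.path.X n}
    (hx : x ∈ B.cylStep r' n) : x ∈ B.cylStep r n :=
  ⟨rees_anti (fun i => by omega) hx.1, rees_anti (fun i => by omega) hx.2⟩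

theorem cylStep_d_mem {r : ℕ} {i j : ℤ} (h : j + 1 = i) {x : B.toNCdga.path.X i}
    (hx : x ∈ B.cylStep r i) : B.toNCdga.path.d h x ∈ B.cylStep r j :=
  ⟨rees_d_mem h hx.1,
    add_mem (rees_d_mem _ hx.2) (Submodule.smul_mem _ _ (rees_deriv_mem h.symm hx.1))⟩

theorem cylStep_mul_mem {r s : ℕ} {i j n : ℤ} (h : i + j = n) {x : B.toNCdga.path.X i}
    {y : B.toNCdga.path.X j} (hx : x ∈ B.cylStep r i) (hy : y ∈ B.cylStep s j) :
    B.toNCdga.path.mul h x y ∈ B.cylStep (r + s) n := by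
  obtain ⟨hx₁, hx₂⟩ := Submodule.mem_prod.mp hx
  obtain ⟨hy₁, hy₂⟩ := Submodule.mem_prod.mp hy
  have h₀ := rees_mul_mem h hx₁ hy₁
  have h₁ : B.toNCdga.poly.mul (show i + (j + 1) = n + 1 by omega) x.1 y.2 ∈
      B.rees (r + s) 1 (n + 1) :=
    rees_anti (fun _ => le_of_eq (by rw [zero_add]))
      (rees_mul_mem (show i + (j + 1) = n + 1 by omega) hx₁ hy₂)
  have h₂ : B.toNCdga.poly.mul (show i + 1 + j = n + 1 by omega) x.2 y.1 ∈
      B.rees (r + s) 1 (n + 1) :=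
    rees_anti (fun _ => le_of_eq (by rw [add_zero]))
      (rees_mul_mem (show i + 1 + j = n + 1 by omega) hx₂ hy₁)
  have h₃ := add_mem h₁ (Submodule.smul_mem _ (sgn k j) h₂)
  exact Submodule.mem_prod.mpr ⟨h₀, h₃⟩

theorem form_one_mem {r : ℕ} {n : ℤ} {b : B.X n} (hb : b ∈ B.pow r n) :
    B.toNCdga.form 1 n b ∈ B.cylStep r n := ⟨polyTm_one_mem hb, zero_mem _⟩

theorem form_X_mem {r : ℕ} {n : ℤ} {b : B.X n} (hb : b ∈ B.pow (r + 1) n) :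
    B.toNCdga.form Polynomial.X n b ∈ B.cylStep (r + 1) n := ⟨polyTm_X_mem hb, zero_mem _⟩

theorem pathHty_mem {r : ℕ} {i j : ℤ} (h : i + 1 = j) {x : B.toNCdga.path.X i}
    (hx : x ∈ B.cylStep r i) : B.toNCdga.pathHty h x ∈ B.cylStep r j :=
  ⟨Submodule.smul_mem _ _ (rees_int_mem h hx.2), zero_mem _⟩

theorem pathMap_mem {B' : DgArt k} (F : B ⟶ B') {r : ℕ} {n : ℤ} {x : B.toNCdga.path.X n}
    (hx : x ∈ B.cylStep r n) : (NCdga.pathMap F.toHom).f n x ∈ B'.cylStep r n :=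
  ⟨polyMap_mem F hx.1, polyMap_mem F hx.2⟩

theorem poly_one_mul {n : ℤ} (x : B.toNCdga.poly.X n) :
    B.toNCdga.poly.mul (zero_add n) (B.toNCdga.polyTm 1 0 B.one) x = x := by
  change B.X n ⊗[k] Polynomial k at x
  change TensorProduct.map₂ (B.mul (zero_add n)) (LinearMap.mul k _) (B.one ⊗ₜ 1) x = x
  induction x using TensorProduct.induction_on with
  | zero => rw [map_zero]
  | add x y hx hy => rw [map_add, hx, hy]
  | tmul b p => simp [B.one_mul]

theorem path_one_mul {n : ℤ} (x : B.toNCdga.path.X n) :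
    B.toNCdga.path.mul (zero_add n) (B.toNCdga.form 1 0 B.one) x = x := by
  refine Prod.ext (poly_one_mul x.1) ?_
  refine (congrArg₂ (· + ·) (poly_one_mul x.2) (?_ : _ = (0 : B.toNCdga.poly.X (n + 1)))).trans
    (add_zero _)
  refine (congrArg (sgn k n • ·) ?_).trans (smul_zero (sgn k n))
  exact (congrArg (fun f => f x.1) (map_zero (B.toNCdga.poly.mul
    (show 0 + 1 + n = n + 1 by omega))))

variable (B) in
/-- The Rees subalgebra of `B[t, dt]`: the forms `f + g dt` where the coefficient of `tⁱ` lies in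
the `i`-th power of the maximal ideal for `f`, and in the `(i + 1)`-st power for `g`. -/
def cylCdga : Cdga k where
  toNCdga := B.toNCdga.path.sub (B.cylStep 0) (fun h _ hx => cylStep_d_mem h hx)
    (fun h _ _ hx hy => cylStep_anti (Nat.zero_le _) (cylStep_mul_mem h hx hy))
  one := ⟨B.toNCdga.form 1 0 B.one, form_one_mem Submodule.mem_top⟩
  one_mul x := Subtype.ext (path_one_mul x.1)

variable (B) in
/-- The augmentation of the cylinder, by evaluation at `0`. -/
def cylAug : Augmentation B.cylCdga where
  ε n := B.aug.ε n ∘ₗ (B.toNCdga.evPath 0).f n ∘ₗ (B.cylStep 0 n).subtype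
  ε_of_ne hn x := B.aug.ε_of_ne hn _
  ε_one := (congrArg (B.aug.ε 0) (NCdga.evPath_constPath B.toNCdga 0 B.one)).trans B.aug.ε_one
  ε_mul h x y := (congrArg (B.aug.ε _) ((B.toNCdga.evPath 0).map_mul h x.1 y.1)).trans
    (B.aug.ε_mul h _ _)
  ε_d h x := (congrArg (B.aug.ε _) ((B.toNCdga.evPath 0).map_d h x.1)).trans (B.aug.ε_d h _)

theorem mem_cylStep_one {n : ℤ} {x : B.cylCdga.X n} (hx : x ∈ B.cylAug.ker n) :
    x.1 ∈ B.cylStep 1 n := by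
  refine ⟨mem_rees_one x.2.1 ?_, rees_anti (fun i => by omega) x.2.2⟩
  rw [pow_one]
  exact hx

/-- Products in the augmentation ideal of the cylinder lie deep in the filtration, so the ideal is
nilpotent. -/
theorem mem_cylStep_of_isProd {r : ℕ} {n : ℤ} {x : B.cylCdga.X n} (hx : B.cylAug.IsProd r x) :
    x.1 ∈ B.cylStep r n := by
  induction hx with
  | one x hx => exact mem_cylStep_one hx
  | @mul r i j n h x y hx hy ih =>
    rw [add_comm]
    exact cylStep_mul_mem h (mem_cylStep_one hx) ih

theorem cylStep_eq_zero {r : ℕ} (hr : ∀ n (b : B.X n), b ∈ B.pow r n → b = 0) {n : ℤ}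
    {x : B.toNCdga.path.X n} (hx : x ∈ B.cylStep r n) : x = 0 :=
  Prod.ext (rees_eq_zero hr hx.1) (rees_eq_zero hr hx.2)

variable (B) in
/-- The cylinder of a local Artinian cdga `B`: an Artinian replacement of `B[t, dt]`. -/
def cyl : DgArt k where
  toCdga := B.cylCdga
  aug := B.cylAug
  nilp := by
    obtain ⟨r, hr, h0⟩ := B.exists_pow_eq_bot
    exact ⟨r, hr, fun n x hx => Subtype.ext (cylStep_eq_zero h0 (mem_cylStep_of_isProd hx))⟩
  fin n := by
    have := finite_rees (B := B) n 0
    have := finite_rees (B := B) (n + 1) 1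
    let f : B.cylAug.ker n →ₗ[k] B.rees 1 0 n × B.rees 1 1 (n + 1) :=
      { toFun := fun x => (⟨x.1.1.1, (mem_cylStep_one x.2).1⟩, ⟨x.1.1.2, (mem_cylStep_one x.2).2⟩)
        map_add' := fun _ _ => rfl
        map_smul' := fun _ _ => rfl }
    refine Module.Finite.of_injective f fun x y hxy => Subtype.ext (Subtype.ext (Prod.ext ?_ ?_))
    · exact congrArg (fun z => z.1.1) hxy
    · exact congrArg (fun z => z.2.1) hxy
  bdd := by
    have h : ∀ n s, B.aug.ker n = ⊥ → ∀ x ∈ B.rees 1 s n, x = 0 := fun n s hn x hx =>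
      map_rees LinearMap.id ⊥ (fun p b hb => by
        have hb1 : b ∈ B.aug.ker n := by
          rw [← pow_one]
          exact pow_le_of_le (le_max_right _ _) hb
        rw [hn, Submodule.mem_bot] at hb1
        rw [hb1, map_zero]
        exact zero_mem _) hx
    refine (B.bdd.union (B.bdd.preimage
      (f := fun n : ℤ => n + 1) (add_left_injective 1).injOn)).subset fun n hn => ?_
    by_contra hcon
    simp only [Set.mem_union, Set.mem_preimage, Set.mem_ofPred_eq, not_or, not_not] at hcon
    refine hn ((Submodule.eq_bot_iff _).mpr fun x hx => ?_)
    exact Subtype.ext (Prod.ext (h _ _ hcon.1 _ (mem_cylStep_one hx).1)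
      (h _ _ hcon.2 _ (mem_cylStep_one hx).2))

variable (k) in
/-- The cylinder, as a functor. -/
def cylFunctor : DgArt k ⥤ DgArt k where
  obj B := B.cyl
  map F :=
    { f := fun n => ((NCdga.pathMap F.toHom).f n).restrict fun _ hx => pathMap_mem F hx
      map_d := fun h x => Subtype.ext ((NCdga.pathMap F.toHom).map_d h x.1)
      map_mul := fun h x y => Subtype.ext ((NCdga.pathMap F.toHom).map_mul h x.1 y.1)
      map_one := Subtype.ext ((NCdga.pathMap_form F.toHom 1 _).trans
        (congrArg (NCdga.form _ 1 0) F.map_one)) }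
  map_id B := hom_ext fun n x => Subtype.ext (Prod.ext
    (LinearMap.congr_fun (LinearMap.rTensor_id (Polynomial k) (B.X n)) x.1.1)
    (LinearMap.congr_fun (LinearMap.rTensor_id (Polynomial k) (B.X (n + 1))) x.1.2))
  map_comp F G := hom_ext fun n x => Subtype.ext (Prod.ext
    (LinearMap.congr_fun (LinearMap.rTensor_comp (Polynomial k) (G.f n) (F.f n)) x.1.1)
    (LinearMap.congr_fun (LinearMap.rTensor_comp (Polynomial k) (G.f (n + 1)) (F.f (n + 1)))
      x.1.2))

/-- Evaluation at `c`, from the cylinder. -/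
def cylEv (c : k) : cylFunctor k ⟶ 𝟭 (DgArt k) where
  app B :=
    { f := fun n => (B.toNCdga.evPath c).f n ∘ₗ (B.cylStep 0 n).subtype
      map_d := fun h x => (B.toNCdga.evPath c).map_d h x.1
      map_mul := fun h x y => (B.toNCdga.evPath c).map_mul h x.1 y.1
      map_one := NCdga.evPath_constPath B.toNCdga c B.one }
  naturality B B' F := hom_ext fun n x => NCdga.evPath_pathMap F.toHom c x.1

variable (k) in
/-- The inclusion of the constant forms in the cylinder. -/
def cylConst : 𝟭 (DgArt k) ⟶ cylFunctor k where
  app B :=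
    { f := fun n => (B.toNCdga.constPath.f n).codRestrict _ fun x => form_one_mem Submodule.mem_top
      map_d := fun h x => Subtype.ext (B.toNCdga.constPath.map_d h x)
      map_mul := fun h x y => Subtype.ext (B.toNCdga.constPath.map_mul h x y)
      map_one := rfl }
  naturality B B' F := hom_ext fun n x =>
    Subtype.ext (NCdga.pathMap_form F.toHom 1 x).symm

theorem cylConst_comp_cylEv (c : k) : cylConst k ≫ cylEv c = 𝟙 (𝟭 (DgArt k)) :=
  NatTrans.ext (funext fun B => hom_ext fun n x => NCdga.evPath_constPath B.toNCdga c x)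

end DgArt

end

end Koszul

namespace Koszul

noncomputable section

/-! ### Gauge equivalence over cylinders -/

variable {k : Type u} [Field k]

namespace DgArt

variable (B : DgArt k)

/-- The inclusion of the maximal ideal of the cylinder in the forms. -/
def cylIncl (n : ℤ) : B.cyl.maxIdeal.X n →ₗ[k] B.toNCdga.path.X n :=
  (B.cylStep 0 n).subtype ∘ₗ (B.cylAug.ker n).subtype

theorem cylIncl_injective (n : ℤ) : Function.Injective (B.cylIncl n) :=
  Subtype.val_injective.comp Subtype.val_injective

/-- The filtration of the maximal ideal of the cylinder induced by the powers of the maximal ideal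
of `B`. -/
def cylFilt : B.cyl.maxIdeal.Filt where
  F r n := (B.cylStep (r + 1) n).comap (B.cylIncl n)
  top x := mem_cylStep_one x.2
  le h := cylStep_anti (Nat.le_succ _) h
  d_mem h _ hx := cylStep_d_mem h hx
  mul_mem {i j n r} h x y hy := by
    have := cylStep_mul_mem h (mem_cylStep_one x.2) hy
    exact cylStep_anti (by omega) this
  bot := by
    obtain ⟨r, hr, h0⟩ := B.exists_pow_eq_bot
    exact ⟨r, fun n x hx => Subtype.ext (Subtype.ext
      (cylStep_eq_zero h0 (cylStep_anti (Nat.le_succ r) hx)))⟩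

theorem mem_cyl_ker {n : ℤ} {x : B.cylCdga.X n}
    (h : (B.toNCdga.evPath 0).f n x.1 ∈ B.aug.ker n) : x ∈ B.cylAug.ker n := h

/-- Integration from `0`, on the maximal ideal of the cylinder. -/
def cylHty {i j : ℤ} (h : i + 1 = j) : B.cyl.maxIdeal.X i →ₗ[k] B.cyl.maxIdeal.X j where
  toFun x := ⟨⟨B.toNCdga.pathHty h x.1.1, pathHty_mem h x.1.2⟩, B.mem_cyl_ker (by
    have e := B.toNCdga.evPath_pathHty h x.1.1
    exact (congrArg (· ∈ B.aug.ker j) e).mpr (zero_mem _))⟩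
  map_add' x y := Subtype.ext (Subtype.ext ((B.toNCdga.pathHty h).map_add x.1.1 y.1.1))
  map_smul' c x := Subtype.ext (Subtype.ext ((B.toNCdga.pathHty h).map_smul c x.1.1))

/-- Multiplication by the parameter `t`, as a map from the maximal ideal to that of the cylinder. -/
def cylTm (n : ℤ) : B.maxIdeal.X n →ₗ[k] B.cyl.maxIdeal.X n where
  toFun b := ⟨⟨B.toNCdga.form Polynomial.X n b.1, cylStep_anti (Nat.zero_le 1)
    (form_X_mem (r := 0) (by rw [zero_add, pow_one]; exact b.2))⟩, B.mem_cyl_ker (by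
    have e := B.toNCdga.evPath_form 0 Polynomial.X b.1
    rw [Polynomial.eval_X, zero_smul] at e
    exact (congrArg (· ∈ B.aug.ker n) e).mpr (zero_mem _))⟩
  map_add' x y := Subtype.ext (Subtype.ext ((B.toNCdga.form Polynomial.X n).map_add x.1 y.1))
  map_smul' c x := Subtype.ext (Subtype.ext ((B.toNCdga.form Polynomial.X n).map_smul c x.1))

theorem evPath_cylTm (c : k) {n : ℤ} (b : B.maxIdeal.X n) :
    (mapIdeal ((cylEv c).app B)).f n (B.cylTm n b) = c • b := by
  refine Subtype.ext ((B.toNCdga.evPath_form c Polynomial.X b.1).trans ?_)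
  rw [Polynomial.eval_X]
  rfl

variable {B}

theorem map_cylTm {B' : DgArt k} (F : B ⟶ B') {n : ℤ} (b : B.maxIdeal.X n) :
    (mapIdeal ((cylFunctor k).map F)).f n (B.cylTm n b) = B'.cylTm n ((mapIdeal F).f n b) :=
  Subtype.ext (Subtype.ext (NCdga.pathMap_form F.toHom Polynomial.X b.1))

theorem map_cylHty {B' : DgArt k} (F : B ⟶ B') {i j : ℤ} (h : i + 1 = j) (x : B.cyl.maxIdeal.X i) :
    (mapIdeal ((cylFunctor k).map F)).f j (B.cylHty h x) =
      B'.cylHty h ((mapIdeal ((cylFunctor k).map F)).f i x) :=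
  Subtype.ext (Subtype.ext (NCdga.pathMap_pathHty F.toHom h x.1.1))

variable (B) in
/-- The inclusion of the constant forms, on maximal ideals. -/
def cylConstIdeal : B.maxIdeal ⟶ B.cyl.maxIdeal := mapIdeal ((cylConst k).app B)

theorem cylHty_hty [CharZero k] {i j l : ℤ} (h : i + 1 = j) (h' : l + 1 = i)
    (x : B.cyl.maxIdeal.X i) : B.cyl.maxIdeal.d h (B.cylHty h x) +
      B.cylHty h' (B.cyl.maxIdeal.d h' x) =
      x - B.cylConstIdeal.f i ((mapIdeal ((cylEv 0).app B)).f i x) := by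
  refine B.cylIncl_injective i ?_
  rw [map_add, map_sub]
  exact B.toNCdga.pathHty_hty h h' (B.cylIncl i x)

variable (B) in
/-- The contraction of the kernel of the evaluation at `0` on the cylinder, given by integration. -/
def cylContraction [CharZero k] (N : DGLA k) : DGLA.Contraction
    (Tot.map (𝟙 N) (mapIdeal ((cylEv 0).app B))) (Tot.filt N B.cylFilt) :=
  Tot.contractionRight N B.cylConstIdeal.f (fun h => B.cylHty h)
    (fun h x => Subtype.ext (B.toNCdga.evPath_pathHty h x.1.1))
    (fun h h' x => cylHty_hty h h' x) B.cylFilt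
    (fun h _ _ hx => pathHty_mem h hx)

theorem cylContraction_natural [CharZero k] (N : DGLA k) {B' : DgArt k} (F : B ⟶ B')
    {n m : ℤ} (h : m + 1 = n) (x : Tot.X N B.cyl.maxIdeal n) :
    DGLA.Hom.f (Tot.map (𝟙 N) (mapIdeal ((cylFunctor k).map F))) m
      ((B.cylContraction N).s h x) =
    (B'.cylContraction N).s h
      (DGLA.Hom.f (Tot.map (𝟙 N) (mapIdeal ((cylFunctor k).map F))) n x) :=
  Tot.mapLin_comp_rightHty (DGLA.Hom.f (𝟙 N)) (fun h => B.cylHty h) (fun h => B'.cylHty h)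
    (fun h x => map_cylHty F h x) h x

end DgArt

section gaugePairs

variable (L : DGLA k)

/-- The functor of pairs of a Maurer-Cartan element and a gauge transformation. -/
abbrev gaugePairs : DgArt k ⥤ Type u :=
  FunctorToTypes.prod ((mcArt k).obj L) ((ggArt k).obj L)

variable [CharZero k]

/-- The action of gauge transformations. -/
def gaugeNat : gaugePairs L ⟶ (mcArt k).obj L where
  app B := ↾fun z : (Tot.dgla L B.maxIdeal).MC × Tot.X L B.maxIdeal 0 =>
    (⟨DGLA.gauge (Tot.dgla L B.maxIdeal) z.2 z.1.1,
      DGLA.gauge_isMC (ad_isNilpotent L B z.2) z.1.2⟩ : (Tot.dgla L B.maxIdeal).MC)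
  naturality B B' f := by
    ext z
    exact Subtype.ext (DGLA.Hom.map_gauge (Tot.map (𝟙 L) (DgArt.mapIdeal f)) _ _
      (ad_isNilpotent L _ _)).symm

variable {L}

theorem gaugeRel_of_pair {A : ProDgArt k} (ζ : A.eval (gaugePairs L)) :
    gaugeRel L A (ζ ≫ Functor.whiskerLeft (unopUnop (DgArt k)) (FunctorToTypes.prod.fst))
      (ζ ≫ Functor.whiskerLeft (unopUnop (DgArt k)) (gaugeNat L)) :=
  ⟨ζ ≫ Functor.whiskerLeft (unopUnop (DgArt k)) FunctorToTypes.prod.snd, fun _ _ => rfl⟩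

theorem exists_pair_of_gaugeRel {A : ProDgArt k} {ω ω' : A.eval ((mcArt k).obj L)}
    (h : gaugeRel L A ω ω') : ∃ ζ : A.eval (gaugePairs L),
      ζ ≫ Functor.whiskerLeft (unopUnop (DgArt k)) (FunctorToTypes.prod.fst) = ω ∧
      ζ ≫ Functor.whiskerLeft (unopUnop (DgArt k)) (gaugeNat L) = ω' := by
  obtain ⟨x, hx⟩ := h
  refine ⟨FunctorToTypes.prod.lift ω x, rfl, ?_⟩
  ext X b
  exact Subtype.ext (hx X.unop.unop b).symm

end gaugePairs

section cylinder

variable (L : DGLA k)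

/-- The functor `mc(L,-)` on cylinders. -/
abbrev mcCyl : DgArt k ⥤ Type u := DgArt.cylFunctor k ⋙ (mcArt k).obj L

/-- Evaluation at `c` of families of Maurer-Cartan elements. -/
abbrev mcEv (c : k) : mcCyl L ⟶ (mcArt k).obj L :=
  Functor.whiskerRight (DgArt.cylEv c) ((mcArt k).obj L)

/-- The constant families of Maurer-Cartan elements. -/
abbrev mcConst : (mcArt k).obj L ⟶ mcCyl L :=
  Functor.whiskerRight (DgArt.cylConst k) ((mcArt k).obj L)

theorem mcConst_comp_mcEv (c : k) : mcConst L ≫ mcEv L c = 𝟙 _ := by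
  rw [← Functor.whiskerRight_comp, DgArt.cylConst_comp_cylEv]
  exact Functor.whiskerRight_id' _

variable {L}

theorem mcEv_mcConst {B : DgArt k} (c : k) (ω : (Tot.dgla L B.maxIdeal).MC) :
    (mcEv L c).app B ((mcConst L).app B ω) = ω :=
  ConcreteCategory.congr_hom (NatTrans.congr_app (mcConst_comp_mcEv L c) B) ω

/-- The constant family with value `η(0)`. -/
def cylBase {B : DgArt k} (η : (Tot.dgla L B.cyl.maxIdeal).MC) : (Tot.dgla L B.cyl.maxIdeal).MC :=
  (mcEv L 0 ≫ mcConst L).app B η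

theorem mcEv_cylBase {B : DgArt k} (η : (Tot.dgla L B.cyl.maxIdeal).MC) :
    DGLA.Hom.f (Tot.map (𝟙 L) (DgArt.mapIdeal ((DgArt.cylEv 0).app B))) 1 η.1 =
      DGLA.Hom.f (Tot.map (𝟙 L) (DgArt.mapIdeal ((DgArt.cylEv 0).app B))) 1 (cylBase η).1 :=
  congrArg Subtype.val (mcEv_mcConst 0 ((mcEv L 0).app B η)).symm

variable (L) [CharZero k]

/-- A natural gauge transformation from the constant family with value `η(0)` to `η`. -/
def cylFix : mcCyl L ⟶ DgArt.cylFunctor k ⋙ gaugePairs L where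
  app B := ↾fun η : (Tot.dgla L B.cyl.maxIdeal).MC =>
    ((cylBase η, DGLA.gaugeFix ((B.cylContraction L).s (zero_add 1)) (cylBase η).1 η.1) :
      (Tot.dgla L B.cyl.maxIdeal).MC × Tot.X L B.cyl.maxIdeal 0)
  naturality B B' f := by
    ext η
    change (Tot.dgla L B.cyl.maxIdeal).MC at η
    have hb := ConcreteCategory.congr_hom ((mcEv L 0 ≫ mcConst L).naturality f) η
    refine Prod.ext hb ?_
    refine Eq.trans ?_ (DGLA.map_gaugeFix (B.cylContraction L)
      (Tot.map (𝟙 L) (DgArt.mapIdeal ((DgArt.cylFunctor k).map f)))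
      (s' := (B'.cylContraction L).s (zero_add 1))
      (fun x => DgArt.cylContraction_natural L f (zero_add 1) x)
      (cylBase η).2 η.2 (mcEv_cylBase η)).symm
    exact congrArg₂ (DGLA.gaugeFix _) (congrArg Subtype.val hb) rfl

theorem cylFix_gauge :
    cylFix L ≫ Functor.whiskerLeft (DgArt.cylFunctor k) (gaugeNat L) = 𝟙 _ := by
  ext B η
  change (Tot.dgla L B.cyl.maxIdeal).MC at η
  exact Subtype.ext (DGLA.gauge_gaugeFix (B.cylContraction L) (cylBase η).2 η.2 (mcEv_cylBase η))

/-- The family of the `exp (t x) ⋆ ω`. -/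
def cylPath : gaugePairs L ⟶ mcCyl L where
  app B := ↾fun z : (Tot.dgla L B.maxIdeal).MC × Tot.X L B.maxIdeal 0 =>
    (⟨DGLA.gauge (Tot.dgla L B.cyl.maxIdeal)
        (Tot.mapLin (DGLA.Hom.f (𝟙 L)) B.cylTm 0 z.2)
        (show (Tot.dgla L B.cyl.maxIdeal).MC from (mcConst L).app B z.1).1,
      DGLA.gauge_isMC (ad_isNilpotent L B.cyl _)
        (show (Tot.dgla L B.cyl.maxIdeal).MC from (mcConst L).app B z.1).2⟩ :
      (Tot.dgla L B.cyl.maxIdeal).MC)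
  naturality B B' f := by
    ext z
    refine Subtype.ext ?_
    refine Eq.trans ?_ (DGLA.Hom.map_gauge
      (Tot.map (𝟙 L) (DgArt.mapIdeal ((DgArt.cylFunctor k).map f))) _ _
      (ad_isNilpotent L B.cyl _)).symm
    refine congrArg₂ (DGLA.gauge (Tot.dgla L B'.cyl.maxIdeal)) ?_
      (congrArg Subtype.val (ConcreteCategory.congr_hom ((mcConst L).naturality f) z.1))
    refine (Tot.mapLin_comp _ _ _ _ _).trans (Eq.trans ?_ (Tot.mapLin_comp _ _ _ _ _).symm)
    exact congrArg (fun g => Tot.mapLin (fun p => LinearMap.id (M := L.X p)) g 0 z.2)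
      (funext fun i => LinearMap.ext fun b => (DgArt.map_cylTm f b).symm)

theorem mcEv_cylPath (c : k) (B : DgArt k)
    (z : (Tot.dgla L B.maxIdeal).MC × Tot.X L B.maxIdeal 0) :
    (show (Tot.dgla L B.maxIdeal).MC from (mcEv L c).app B ((cylPath L).app B z)).1 =
      DGLA.gauge (Tot.dgla L B.maxIdeal) (c • z.2 : Tot.X L B.maxIdeal 0) z.1.1 := by
  refine (DGLA.Hom.map_gauge (Tot.map (𝟙 L) (DgArt.mapIdeal ((DgArt.cylEv c).app B))) _ _
    (ad_isNilpotent L B.cyl _)).trans ?_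
  refine congrArg₂ (DGLA.gauge (Tot.dgla L B.maxIdeal)) ?_
    (congrArg Subtype.val (mcEv_mcConst c z.1))
  refine (Tot.mapLin_comp _ _ _ _ _).trans ?_
  generalize z.2 = x
  induction x using Tot.ind with
  | h0 => simp
  | hadd x y hx hy => simp only [map_add, hx, hy, smul_add]
  | @htm p i hs u a =>
    rw [Tot.mapLin_tm]
    exact (congrArg (Tot.tm hs u) (DgArt.evPath_cylTm B c a)).trans (Tot.tm_smul_right hs c u a)

theorem cylPath_zero : cylPath L ≫ mcEv L 0 = FunctorToTypes.prod.fst := by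
  ext B z
  refine Subtype.ext ((mcEv_cylPath L 0 B z).trans ?_)
  exact (congrArg (fun x => DGLA.gauge (Tot.dgla L B.maxIdeal) x _) (zero_smul k _)).trans
    (DGLA.gauge_zero _)

theorem cylPath_one : cylPath L ≫ mcEv L 1 = gaugeNat L := by
  ext B z
  refine Subtype.ext ((mcEv_cylPath L 1 B z).trans ?_)
  exact congrArg (fun x => DGLA.gauge (Tot.dgla L B.maxIdeal) x _) (one_smul k _)

end cylinder

end

end Koszul

namespace Koszul

noncomputable section

/-! ### Prolongation of endofunctors to pro-objects -/

variable {k : Type u} [Field k]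

/-- The value at a pro-object `A` of the prolongation of an endofunctor `T` of `DgArt k`: a
pro-object `{T(A_α)}`, characterized by the limits of functors over it. -/
structure Prolongation (T : DgArt k ⥤ DgArt k) (A : ProDgArt k) where
  obj : ProDgArt k
  equiv : ∀ G : DgArt k ⥤ Type u, obj.eval G ≃ A.eval (T ⋙ G)
  equiv_comp : ∀ {G G' : DgArt k ⥤ Type u} (γ : G ⟶ G') (τ : obj.eval G),
    equiv G' (τ ≫ Functor.whiskerLeft (unopUnop (DgArt k)) γ) =
      equiv G τ ≫ Functor.whiskerLeft (unopUnop (DgArt k)) (Functor.whiskerLeft T γ)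

namespace Prolongation

variable {T : DgArt k ⥤ DgArt k} {A : ProDgArt k}

/-- If `A` is presented by the system `{A_α}`, the system `{T(A_α)}` presents its prolongation. -/
theorem nonempty (T : DgArt k ⥤ DgArt k) (A : ProDgArt k) : Nonempty (Prolongation T A) := by
  let P := Ind.presentation A.unop
  let D : P.I ⥤ (DgArt k)ᵒᵖ := P.F ⋙ T.op
  let c := colimit.cocone (D ⋙ yoneda)
  let R : IndObjectPresentation c.pt := .ofCocone c (colimit.isColimit _)
  let Y : Ind (DgArt k)ᵒᵖ := (Ind.equivalence _).inverse.obj ⟨c.pt, ⟨⟨R⟩⟩⟩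
  let i : c.pt ≅ ProDgArt.h (op Y : ProDgArt k) :=
    (ObjectProperty.ι _).mapIso ((Ind.equivalence (DgArt k)ᵒᵖ).counitIso.app ⟨c.pt, ⟨⟨R⟩⟩⟩).symm
  let R' : IndObjectPresentation (ProDgArt.h (op Y : ProDgArt k)) := R.extend i.hom
  refine ⟨⟨op Y, fun G => (ProDgArt.evalEquiv G (op Y) R').trans
    (ProDgArt.evalEquiv (T ⋙ G) A P).symm, fun {G G'} γ τ => ?_⟩⟩
  refine (ProDgArt.evalEquiv (T ⋙ G') A P).injective ?_
  refine (Equiv.apply_symm_apply (ProDgArt.evalEquiv (T ⋙ G') A P) _).trans ?_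
  refine Subtype.ext (funext fun i => ?_)
  refine Eq.trans ?_ (ProDgArt.evalEquiv_naturality (Functor.whiskerLeft T γ) A P _ i).symm
  refine (ProDgArt.evalEquiv_naturality γ (op Y) R' τ i).trans (congrArg (γ.app _) ?_)
  exact congrFun (congrArg Subtype.val
    (Equiv.apply_symm_apply (ProDgArt.evalEquiv (T ⋙ G) A P) _)).symm i

variable (P : Prolongation T A)

theorem equiv_symm_comp {G G' : DgArt k ⥤ Type u} (γ : G ⟶ G') (σ : A.eval (T ⋙ G)) :
    (P.equiv G').symm (σ ≫ Functor.whiskerLeft (unopUnop (DgArt k)) (Functor.whiskerLeft T γ)) =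
      (P.equiv G).symm σ ≫ Functor.whiskerLeft (unopUnop (DgArt k)) γ := by
  rw [Equiv.symm_apply_eq, equiv_comp, Equiv.apply_symm_apply]

/-- The functor on `DgArt k` given by a pro-object. -/
abbrev hom (A : ProDgArt k) : DgArt k ⥤ Type u := opOp (DgArt k) ⋙ A.h

/-- The identity, as an element of the functor given by a pro-object. -/
abbrev idEl (A : ProDgArt k) : A.eval (hom A) := 𝟙 A.h

/-- By the Yoneda lemma, the morphism is determined by its effect on the functor given by the
prolongation. -/
theorem exists_of_toId (ε : T ⟶ 𝟭 (DgArt k)) : ∃ g : P.obj ⟶ A,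
    ∀ (G : DgArt k ⥤ Type u) (τ : P.obj.eval G), (Ind.inclusion _).map g.unop ≫ τ =
      P.equiv G τ ≫ Functor.whiskerLeft (unopUnop (DgArt k)) (Functor.whiskerRight ε G) := by
  let φ : A.h ⟶ P.obj.h := P.equiv _ (idEl P.obj) ≫
    Functor.whiskerLeft (unopUnop (DgArt k)) (Functor.whiskerRight ε (hom P.obj))
  refine ⟨((Ind.inclusion (DgArt k)ᵒᵖ).preimage φ).op, fun G τ => ?_⟩
  have hφ : (Ind.inclusion _).map ((Ind.inclusion (DgArt k)ᵒᵖ).preimage φ) = φ :=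
    Functor.map_preimage _ _
  refine (congrArg (· ≫ τ) hφ).trans ?_
  let τ' : hom P.obj ⟶ G := Functor.whiskerLeft (opOp (DgArt k)) τ
  have e := P.equiv_comp τ' (idEl P.obj)
  have h1 : idEl P.obj ≫ Functor.whiskerLeft (unopUnop (DgArt k)) τ' = τ := rfl
  rw [h1] at e
  rw [e]
  ext X b
  exact ConcreteCategory.congr_hom (τ.naturality (ε.app X.unop.unop).op.op)
    ((P.equiv _ (idEl P.obj)).app X b)

theorem exists_of_fromId (κ : 𝟭 (DgArt k) ⟶ T) : ∃ g : A ⟶ P.obj,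
    ∀ (G : DgArt k ⥤ Type u) (τ : A.eval G), (Ind.inclusion _).map g.unop ≫ τ =
      (P.equiv G).symm
        (τ ≫ Functor.whiskerLeft (unopUnop (DgArt k)) (Functor.whiskerRight κ G)) := by
  let φ : P.obj.h ⟶ A.h := (P.equiv (hom A)).symm (idEl A ≫
    Functor.whiskerLeft (unopUnop (DgArt k)) (Functor.whiskerRight κ (hom A)))
  refine ⟨((Ind.inclusion (DgArt k)ᵒᵖ).preimage φ).op, fun G τ => ?_⟩
  have hφ : (Ind.inclusion _).map ((Ind.inclusion (DgArt k)ᵒᵖ).preimage φ) = φ :=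
    Functor.map_preimage _ _
  refine (congrArg (· ≫ τ) hφ).trans ?_
  let τ' : hom A ⟶ G := Functor.whiskerLeft (opOp (DgArt k)) τ
  refine (P.equiv_symm_comp τ' _).symm.trans (congrArg (P.equiv G).symm ?_)
  ext X b
  exact ConcreteCategory.congr_hom (τ.naturality (κ.app X.unop.unop).op.op) b

/-- The morphism to `A` induced by a transformation from `T` to the identity. -/
def toId (ε : T ⟶ 𝟭 (DgArt k)) : P.obj ⟶ A := (P.exists_of_toId ε).choose

theorem toId_comp (ε : T ⟶ 𝟭 (DgArt k)) (G : DgArt k ⥤ Type u) (τ : P.obj.eval G) :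
    (Ind.inclusion _).map (P.toId ε).unop ≫ τ =
      P.equiv G τ ≫ Functor.whiskerLeft (unopUnop (DgArt k)) (Functor.whiskerRight ε G) :=
  (P.exists_of_toId ε).choose_spec G τ

/-- The morphism from `A` induced by a transformation from the identity to `T`. -/
def fromId (κ : 𝟭 (DgArt k) ⟶ T) : A ⟶ P.obj := (P.exists_of_fromId κ).choose

theorem fromId_comp (κ : 𝟭 (DgArt k) ⟶ T) (G : DgArt k ⥤ Type u) (τ : A.eval G) :
    (Ind.inclusion _).map (P.fromId κ).unop ≫ τ = (P.equiv G).symm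
      (τ ≫ Functor.whiskerLeft (unopUnop (DgArt k)) (Functor.whiskerRight κ G)) :=
  (P.exists_of_fromId κ).choose_spec G τ

theorem fromId_comp_toId {κ : 𝟭 (DgArt k) ⟶ T} {ε : T ⟶ 𝟭 (DgArt k)} (h : κ ≫ ε = 𝟙 _) :
    P.fromId κ ≫ P.toId ε = 𝟙 A := by
  refine Quiver.Hom.unop_inj ((Ind.inclusion (DgArt k)ᵒᵖ).map_injective ?_)
  have e := P.fromId_comp κ (hom A) (idEl A)
  have e' := P.toId_comp ε (hom A) ((Ind.inclusion _).map (P.fromId κ).unop ≫ idEl A)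
  rw [e, Equiv.apply_symm_apply, ← e] at e'
  refine (Functor.map_comp _ _ _).trans (Eq.trans (congrArg _ (Category.comp_id _).symm) ?_)
  refine e'.trans ?_
  have : idEl A ≫ Functor.whiskerLeft (unopUnop (DgArt k))
      (Functor.whiskerRight (κ ≫ ε) (hom A)) = 𝟙 A.h := by
    rw [h]
    ext X b
    exact ConcreteCategory.congr_hom (A.h.map_id X) b
  refine (Category.assoc _ _ _).trans (Eq.trans ?_ ((Ind.inclusion (DgArt k)ᵒᵖ).map_id A.unop).symm)
  refine Eq.trans (congrArg (idEl A ≫ ·) ?_) this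
  rw [Functor.whiskerRight_comp]
  rfl

end Prolongation

/-! ### Path objects of pro-objects -/

/-- The path object of a pro-object: the prolongation of the cylinder functor. -/
def proCyl (A : ProDgArt k) : Prolongation (DgArt.cylFunctor k) A :=
  (Prolongation.nonempty _ A).some

/-- Evaluation at `c`, from the path object of a pro-object. -/
def proEv (c : k) (A : ProDgArt k) : (proCyl A).obj ⟶ A := (proCyl A).toId (DgArt.cylEv c)

/-- The inclusion of the constant forms in the path object of a pro-object. -/
def proConst (A : ProDgArt k) : A ⟶ (proCyl A).obj := (proCyl A).fromId (DgArt.cylConst k)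

theorem proConst_comp_proEv (c : k) (A : ProDgArt k) : proConst A ≫ proEv c A = 𝟙 A :=
  (proCyl A).fromId_comp_toId (DgArt.cylConst_comp_cylEv c)

end

end Koszul

namespace Koszul

noncomputable section

/-! ### Weak equivalences and deformations -/

variable {k : Type u} [Field k]

/-- The quasi-isomorphisms of DGLAs are saturated, because cohomology detects them. -/
theorem quasiIso_of_isIso_Q {L M : DGLA k} (f : L ⟶ M) (h : IsIso ((DGLA.quasiIso k).Q.map f)) :
    DGLA.quasiIso k f := by
  change QuasiIso ((DGLA.toComplex k).map f)
  rw [quasiIso_iff]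
  intro n
  rw [quasiIsoAt_iff_isIso_homologyMap]
  let H : DGLA k ⥤ ModuleCat.{u} k :=
    DGLA.toComplex k ⋙ HomologicalComplex.homologyFunctor _ _ n
  have hH : (DGLA.quasiIso k).IsInvertedBy H := fun X Y g hg =>
    HomologicalComplex.homologyFunctor_inverts_quasiIso _ _ n _ hg
  let e := Localization.fac H hH (DGLA.quasiIso k).Q
  exact (NatIso.isIso_map_iff e f).mp (by dsimp; infer_instance)

variable [CharZero k]

/-- Weak equivalences of pro-objects are detected by deformations, because the latter are the
morphisms out of `β*` in the homotopy category. -/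
theorem proWeakEq_iff {A A' : ProDgArt k} (a : A ⟶ A') : proWeakEq k a ↔
    ∀ L : DGLA k, IsIso (((ddef k).map a).app L) := by
  have h₁ : ∀ L, IsIso (((ddef k).map a).app L) ↔ IsIso (((homHoDGLA k).map a).app L) := fun L =>
    NatIso.isIso_map_iff (((flipFunctor _ _ _).mapIso (asIso (ddefToHoDGLA k))).app L) a
  have h₂ : ∀ L : DGLA k, IsIso (((homHoDGLA k).map a).app L) ↔
      IsIso ((coyoneda.map ((DGLA.quasiIso k).Q.map ((betaStar k).map a.op)).op).app
        ((DGLA.quasiIso k).Q.obj L)) := fun L => Iff.rfl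
  have h₃ : proWeakEq k a ↔ IsIso ((DGLA.quasiIso k).Q.map ((betaStar k).map a.op)) :=
    ⟨fun h => Localization.inverts (DGLA.quasiIso k).Q (DGLA.quasiIso k) _ h,
      fun h => quasiIso_of_isIso_Q _ h⟩
  simp only [h₁, h₂]
  rw [h₃, isIso_iff_isIso_coyoneda_map]
  refine ⟨fun h L => h _, fun h c => ?_⟩
  obtain ⟨L, rfl⟩ := (Localization.Construction.objEquiv (DGLA.quasiIso k)).surjective c
  exact h L

theorem proWeakEq_isInvertedBy_ddef (L : DGLA k) :
    (proWeakEq k).IsInvertedBy ((ddef k).flip.obj L) := fun _ _ a ha => (proWeakEq_iff a).mp ha L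

/-- Every Maurer-Cartan element over the path object is gauge equivalent to a constant one. -/
theorem gaugeRel_proConst_proEv {L : DGLA k} {A : ProDgArt k}
    (ω : (proCyl A).obj.eval ((mcArt k).obj L)) : gaugeRel L (proCyl A).obj
      ((Ind.inclusion _).map (proConst A).unop ≫ (Ind.inclusion _).map (proEv 0 A).unop ≫ ω) ω := by
  let P := proCyl A
  let ζ : P.obj.eval (gaugePairs L) := (P.equiv _).symm
    (P.equiv _ ω ≫ Functor.whiskerLeft (unopUnop (DgArt k)) (cylFix L))
  have h₁ : ζ ≫ Functor.whiskerLeft (unopUnop (DgArt k)) (FunctorToTypes.prod.fst) =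
      (Ind.inclusion _).map (proConst A).unop ≫ (Ind.inclusion _).map (proEv 0 A).unop ≫ ω := by
    refine (P.equiv_symm_comp _ _).symm.trans ?_
    refine Eq.trans ?_ (P.fromId_comp (DgArt.cylConst k) ((mcArt k).obj L) _).symm
    refine congrArg (P.equiv _).symm ?_
    exact (congrArg (· ≫ Functor.whiskerLeft (unopUnop (DgArt k)) (mcConst L))
      (P.toId_comp (DgArt.cylEv 0) ((mcArt k).obj L) ω)).symm
  have h₂ : ζ ≫ Functor.whiskerLeft (unopUnop (DgArt k)) (gaugeNat L) = ω := by
    refine (P.equiv_symm_comp _ _).symm.trans ((P.equiv _).symm_apply_eq.mpr ?_)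
    refine (Category.assoc _ _ _).trans ?_
    rw [← Functor.whiskerLeft_comp, cylFix_gauge]
    exact Category.comp_id _
  have := gaugeRel_of_pair ζ
  rwa [h₁, h₂] at this

theorem proWeakEq_proEv (A : ProDgArt k) : proWeakEq k (proEv 0 A) := by
  refine (proWeakEq_iff _).mpr fun L => ⟨((ddef k).map (proConst A)).app L, ?_, ?_⟩
  · ext ω
    induction ω using Quot.ind with | mk ω =>
    exact Quot.sound (gaugeRel_proConst_proEv ω)
  · rw [← NatTrans.comp_app, ← Functor.map_comp, proConst_comp_proEv, CategoryTheory.Functor.map_id]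
    rfl

/-- Both evaluations are inverse to the inclusion of the constant forms. -/
theorem Q_proEv (A : ProDgArt k) :
    (proWeakEq k).Q.map (proEv 0 A) = (proWeakEq k).Q.map (proEv 1 A) := by
  have h₀ : IsIso ((proWeakEq k).Q.map (proEv 0 A)) :=
    Localization.inverts (proWeakEq k).Q (proWeakEq k) _ (proWeakEq_proEv A)
  have h : ∀ c, (proWeakEq k).Q.map (proConst A) ≫ (proWeakEq k).Q.map (proEv c A) = 𝟙 _ := by
    intro c
    rw [← Functor.map_comp, proConst_comp_proEv, CategoryTheory.Functor.map_id]
  have h₁ : IsIso ((proWeakEq k).Q.map (proConst A)) := by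
    have : IsIso ((proWeakEq k).Q.map (proConst A) ≫ (proWeakEq k).Q.map (proEv 0 A)) := by
      rw [h]
      infer_instance
    exact IsIso.of_isIso_comp_right _ ((proWeakEq k).Q.map (proEv 0 A))
  rw [← cancel_epi ((proWeakEq k).Q.map (proConst A)), h, h]

/-- Gauge equivalent Maurer-Cartan elements are the end points of a path. -/
theorem exists_proEv_of_gaugeRel {L : DGLA k} {A : ProDgArt k} {ω ω' : A.eval ((mcArt k).obj L)}
    (h : gaugeRel L A ω ω') : ∃ η : (proCyl A).obj.eval ((mcArt k).obj L),
      (Ind.inclusion _).map (proEv 0 A).unop ≫ η = ω ∧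
      (Ind.inclusion _).map (proEv 1 A).unop ≫ η = ω' := by
  obtain ⟨ζ, rfl, rfl⟩ := exists_pair_of_gaugeRel h
  let P := proCyl A
  have key : ∀ c, (Ind.inclusion _).map (proEv c A).unop ≫
      (P.equiv _).symm (ζ ≫ Functor.whiskerLeft (unopUnop (DgArt k)) (cylPath L)) =
      ζ ≫ Functor.whiskerLeft (unopUnop (DgArt k)) (cylPath L ≫ mcEv L c) := by
    intro c
    refine (P.toId_comp (DgArt.cylEv c) _ _).trans ?_
    rw [Equiv.apply_symm_apply]
    exact Category.assoc _ _ _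
  refine ⟨(P.equiv _).symm (ζ ≫ Functor.whiskerLeft (unopUnop (DgArt k)) (cylPath L)), ?_, ?_⟩
  · rw [key, cylPath_zero]
  · rw [key, cylPath_one]

/-! ### Morphisms in the homotopy category of pro-objects -/

theorem Q_proRep_eq_of_gaugeRel {L : DGLA k} {A : ProDgArt k} {ω ω' : A.eval ((mcArt k).obj L)}
    (h : gaugeRel L A ω ω') : (proWeakEq k).Q.map ((proRep L A).symm ω) =
      (proWeakEq k).Q.map ((proRep L A).symm ω') := by
  obtain ⟨η, rfl, rfl⟩ := exists_proEv_of_gaugeRel h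
  have key : ∀ c, (proRep L A).symm ((Ind.inclusion _).map (proEv c A).unop ≫ η) =
      (proRep L (proCyl A).obj).symm η ≫ proEv c A := by
    intro c
    rw [Equiv.symm_apply_eq, proRep_naturality_right, Equiv.apply_symm_apply]
  rw [key, key, Functor.map_comp, Functor.map_comp, Q_proEv]

variable (k) in
/-- The map from deformations to morphisms in the homotopy category of pro-objects. -/
def ddefToHoPro : ddef k ⟶ homHoPro k where
  app A :=
    { app := fun L => ↾Quot.lift (fun ω => (proWeakEq k).Q.map ((proRep L A).symm ω))
        fun _ _ h => Q_proRep_eq_of_gaugeRel h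
      naturality := fun L M f => by
        ext ω
        induction ω using Quot.ind with | mk ω =>
        change (proWeakEq k).Q.map ((proRep M A).symm (mcMap f ω)) =
          (proWeakEq k).Q.map ((beta k).map f).unop ≫
            (proWeakEq k).Q.map ((proRep L A).symm ω)
        rw [← Functor.map_comp]
        congr 1
        rw [Equiv.symm_apply_eq, proRep_naturality_left, Equiv.apply_symm_apply] }
  naturality A A' a := by
    ext L ω
    induction ω using Quot.ind with | mk ω =>
    change (proWeakEq k).Q.map ((proRep L A').symm ((Ind.inclusion _).map a.unop ≫ ω)) =
      (proWeakEq k).Q.map ((proRep L A).symm ω) ≫ (proWeakEq k).Q.map a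
    rw [← Functor.map_comp]
    congr 1
    rw [Equiv.symm_apply_eq, proRep_naturality_right, Equiv.apply_symm_apply]

theorem ddefToHoPro_mk (A : ProDgArt k) (L : DGLA k) (ω : A.eval ((mcArt k).obj L)) :
    ((ddefToHoPro k).app A).app L (ddef.mk ω) =
      (proWeakEq k).Q.map ((proRep L A).symm ω) := rfl

theorem ddefToHoPro_bijective (A : ProDgArt k) (L : DGLA k) :
    Function.Bijective (((ddefToHoPro k).app A).app L) := by
  refine bijective_of_isInvertedBy (proWeakEq k) (proWeakEq k).Q ((ddef k).flip.obj L)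
    (proWeakEq_isInvertedBy_ddef L) (c := ((beta k).obj L).unop)
    (ddef.mk (proRep L _ (𝟙 _)))
    ((show (ddef k).flip ⟶ (homHoPro k).flip from
      (flipFunctor _ _ _).map (ddefToHoPro k)).app L) ?_ ?_ A
  · refine (ddefToHoPro_mk _ L _).trans ?_
    rw [Equiv.symm_apply_apply]
    exact (proWeakEq k).Q.map_id _
  · intro B d
    induction d using Quot.ind with | mk ω =>
    refine ⟨(proRep L B).symm ω, ?_⟩
    change ddef.mk ((Ind.inclusion _).map ((proRep L B).symm ω).unop ≫ proRep L _ (𝟙 _)) =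
      ddef.mk ω
    rw [← proRep_naturality_right, Category.id_comp, Equiv.apply_symm_apply]

instance : IsIso (ddefToHoPro k) := by
  have : ∀ A, IsIso ((ddefToHoPro k).app A) := fun A => by
    have : ∀ L, IsIso (((ddefToHoPro k).app A).app L) := fun L =>
      (isIso_iff_bijective _).mpr (ddefToHoPro_bijective A L)
    exact NatIso.isIso_of_isIso_app _
  exact NatIso.isIso_of_isIso_app _

end

end Koszul

theorem mainTheorem2 (k : Type u) [Field k] [CharZero k] :
    ∃ (e₁ : homHoDGLA k ≅ ddef k) (e₂ : ddef k ≅ homHoPro k),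
      (∀ (A : ProDgArt k) (L : DGLA k) (f : (betaStar k).obj (op A) ⟶ L),
        (e₁.hom.app A).app L ((DGLA.quasiIso k).Q.map f) =
          ddef.mk (proRep L A ((betaAdj k).homEquiv (op A) L f).unop)) ∧
      (∀ (A : ProDgArt k) (L : DGLA k) (g : ((beta k).obj L).unop ⟶ A),
        (e₂.hom.app A).app L (ddef.mk (proRep L A g)) = (proWeakEq k).Q.map g) := by
  refine ⟨(asIso (ddefToHoDGLA k)).symm, asIso (ddefToHoPro k), fun A L f => ?_, fun A L g => ?_⟩
  · refine (ddefToHoDGLA_bijective A L).1 ?_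
    have h : ((ddefToHoDGLA k).app A).app L (ddef.mk (mcEquiv A L f)) =
        (DGLA.quasiIso k).Q.map f := by
      rw [ddefToHoDGLA_mk, Equiv.symm_apply_apply]
    refine Eq.trans ?_ h.symm
    exact ConcreteCategory.congr_hom (NatTrans.congr_app
      (NatTrans.congr_app (asIso (ddefToHoDGLA k)).inv_hom_id A) L) ((DGLA.quasiIso k).Q.map f)
  · refine (ddefToHoPro_mk A L _).trans ?_
    rw [Equiv.symm_apply_apply]
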